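/- Let $1<\alpha\le 2$, $|\theta|\le\min\{\alpha,2-\alpha\}$, $1<\mu\le 2$, $0\le\nu\le 1$, $k\in\mathbb R$ ($k=0$ allowed). Write $$\hat u(\kappa)=\int_{\mathbb R}u(x)e^{i\kappa x}\,dx,\qquad \psi_\alpha^\theta(\kappa)=|\kappa|^\alpha e^{i\,\mathrm{sign}(\kappa)\theta\pi/2},\qquad E_{a,b}(z)=\sum_{n\ge0}\frac{z^n}{\Gamma(an+b)},$$ let $I_{0+}^{a}$ be the Riemann–Liouville integral $\frac1{\Gamma(a)}\int_0^t(t-s)^{a-1}u(s)\,ds$ (identity for $a=0$), let ${}_tD^{\mu,\nu}_{0+}=I_{0+}^{\nu(2-\mu)}\frac{d^2}{dt^2}I_{0+}^{(1-\nu)(2-\mu)}$ be the Hilfer derivative, and let ${}_xD^\alpha_\theta$ be the Riesz–Feller derivative, i.e. $\mathcal F[{}_xD_\theta^\alpha u]=-\psi_\alpha^\theta\,\mathcal F[u]$, where $\mathcal F$ is the Fourier transform in the sense of tempered distributions, $\mathcal F[u]$ being a function. Consider $${}_tD_{0+}^{\mu,\nu}N={}_xD_\theta^\alpha N-k^2N+\Phi\qquad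 (x\in\mathbb R,\ t>0),$$ $$I_{0+}^{(1-\nu)(2-\mu)}N\to f(x),\quad \tfrac{d}{dt}I_{0+}^{(1-\nu)(2-\mu)}N\to g(x)\quad(t\to0+),\qquad \lim_{x\to\pm\infty}N(x,t)=0 .$$ Here $f,g\in L^1(\mathbb R)$, $\Phi(\cdot,t)\in L^1(\mathbb R)$ for $t>0$ and $\Phi\in L^1(\mathbb R\times(0,T))$ for every $T>0$. A solution is a continuous function $N:\mathbb R\times(0,\infty)\to\mathbb C$ satisfying all these relations pointwise, such that: $w=I_{0+}^{(1-\nu)(2-\mu)}N(x,\cdot)$ is $C^2$ on $(0,\infty)$ for each $x$; for every $T$, $|N|$ and $|\partial_t^2w|$ are at most $B(t)(1+|x|)^m$ on $\mathbb R\times(0,T]$ for some $m\in\mathbb N$ and some $B$ continuous and integrable on $(0,T]$; and the $x$-Fourier transform of $N(\cdot,t)$ is for each $t>0$ a function $\hat N(\kappa,t)$, with $(1+|\kappa|)^{-m}\hat N\in L^1(\mathbb R\times(0,T))$ for every $T$ and some $m=m(T)$. Consider the formula $$\begin{aligned}N(x,t)={}&\frac{t^{-(1-\nu)(2-\mu)}}{2\pi}\int_{\mathbb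 R}E_{\mu,1-(1-\nu)(2-\mu)}\bigl(-t^\mu(\psi_\alpha^\theta(\kappa)+k^2)\bigr)\hat f(\kappa)e^{-i\kappa x}\,d\kappa\\&+\frac{t^{1-(1-\nu)(2-\mu)}}{2\pi}\int_{\mathbb R}E_{\mu,2-(1-\nu)(2-\mu)}\bigl(-t^\mu(\psi_\alpha^\theta(\kappa)+k^2)\bigr)\hat g(\kappa)e^{-i\kappa x}\,d\kappa\\&+\frac1{2\pi}\int_{\mathbb R}\Bigl({}_t\mathcal E_{0+;\mu,\mu}^{-(\psi_\alpha^\theta(\kappa)+k^2);1}\hat\Phi\Bigr)(\kappa,t)\,e^{-i\kappa x}\,d\kappa ,\end{aligned}\tag{$*$}$$ where $\hat\Phi(\kappa,t)$ is the Fourier transform of $\Phi(\cdot,t)$ and $({}_t\mathcal E_{0+;\mu,\mu}^{\omega;1}\varphi)(t)=\int_0^t(t-\xi)^{\mu-1}E_{\mu,\mu}(\omega(t-\xi)^\mu)\varphi(\xi)\,d\xi$ is the Prabhakar operator. (a) If the three $\kappa$-integrals in $(*)$ converge absolutely for every $t>0$, then every solution $N$ is given by $(*)$ for all $x\in\mathbb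 R$, $t>0$. (b) Suppose $f$, $g$ and $\Phi(\cdot,t)$ ($t>0$) are continuous, there is a (jointly) measurable $\rho(\kappa,t)$, continuous in $t>0$, with $\hat\Phi(\kappa,\cdot)=I_{0+}^{\nu(2-\mu)}\rho(\kappa,\cdot)$, and for every $T>0$ there are $G\in L^1(\mathbb R)$ and $B$ continuous and integrable on $(0,T]$ such that, with $z=-t^\mu(\psi_\alpha^\theta(\kappa)+k^2)$, $$(1+|\kappa|^\alpha)|E_{\mu,\mu-1}(z)\hat f(\kappa)|\le G(\kappa),\quad(1+|\kappa|^\alpha)|E_{\mu,1}(z)\hat g(\kappa)|\le G(\kappa),\quad(1+|\kappa|^\alpha)|E_{\mu,1}(z)\rho(\kappa,s)|\le G(\kappa)B(s)$$ for all $\kappa\in\mathbb R$, $t\in[0,T]$, $s\in(0,T]$. Then the integrals in $(*)$ converge absolutely, and a function $N$ is a solution if and only if it is given by $(*)$ for all $x\in\mathbb R$, $t>0$. -/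

import Mathlib

open MeasureTheory Set Filter Topology
open scoped SchwartzMap

noncomputable section

namespace FracWave

/-! Special functions -/

/-- The two parameter Mittag-Leffler function `E_{a,b}(z) = ∑ zⁿ / Γ(a n + b)`. -/
def mittagLeffler (a b : ℝ) (z : ℂ) : ℂ :=
  ∑' n : ℕ, z ^ n / Complex.Gamma ((a : ℂ) * n + b)

/-- The three parameter (Prabhakar) Mittag-Leffler function
`E^γ_{a,b}(z) = ∑ (γ)ₙ / Γ(a n + b) · zⁿ / n!`. -/
def mittagLeffler₃ (a b : ℝ) (γ : ℂ) (z : ℂ) : ℂ :=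
  ∑' n : ℕ, (ascPochhammer ℂ n).eval γ / Complex.Gamma ((a : ℂ) * n + b)
    * (z ^ n / (n.factorial : ℂ))

/-! Fractional calculus in the time variable -/

/-- The Riemann-Liouville fractional integral `I_{0+}^a` of order `a ≥ 0`
(the identity for `a = 0`). -/
def rlIntegral (a : ℝ) (u : ℝ → ℂ) (t : ℝ) : ℂ :=
  if a = 0 then u t
  else (1 / Real.Gamma a : ℝ) * ∫ s in (0 : ℝ)..t, (((t - s) ^ (a - 1) : ℝ) : ℂ) * u s

/-- The Hilfer derivative `D_{0+}^{μ,ν} u = I^{ν(n-μ)} (d/dt)ⁿ I^{(1-ν)(n-μ)} u`, where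
`n - 1 < μ ≤ n`. -/
def hilferDeriv (μ ν : ℝ) (u : ℝ → ℂ) (t : ℝ) : ℂ :=
  rlIntegral (ν * ((⌈μ⌉₊ : ℝ) - μ))
    (iteratedDeriv ⌈μ⌉₊ (rlIntegral ((1 - ν) * ((⌈μ⌉₊ : ℝ) - μ)) u)) t

/-- The Prabhakar integral operator `(𝓔_{0+;a,b}^{ω;γ} φ)(t)`. -/
def prabhakar (a b : ℝ) (ω γ : ℂ) (φ : ℝ → ℂ) (t : ℝ) : ℂ :=
  ∫ ξ in (0 : ℝ)..t, (((t - ξ) ^ (b - 1) : ℝ) : ℂ)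
    * mittagLeffler₃ a b γ (ω * (((t - ξ) ^ a : ℝ) : ℂ)) * φ ξ

/-! Fourier transform and Riesz-Feller derivative in the space variable -/

/-- `û(κ) = ∫ u(x) e^{iκx} dx`. -/
def fourierHat (u : ℝ → ℂ) (κ : ℝ) : ℂ :=
  ∫ x : ℝ, u x * Complex.exp (Complex.I * κ * x)

/-- `(F⁻¹ h)(x) = (1/2π) ∫ h(κ) e^{-iκx} dκ`. -/
def fourierInv (h : ℝ → ℂ) (x : ℝ) : ℂ :=
  1 / (2 * Real.pi : ℂ) * ∫ κ : ℝ, h κ * Complex.exp (-(Complex.I * κ * x))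

/-- A measurable function that is integrable against some negative power of `1 + |x|`,
hence defines a tempered distribution. -/
def IsTempered (u : ℝ → ℂ) : Prop :=
  ∃ m : ℕ, Integrable fun x : ℝ => (((1 + |x|) ^ m)⁻¹ : ℝ) • u x

/-- The function `h` is the Fourier transform of the function `u`, in the sense of tempered
distributions: `⟨u, φ̂⟩ = ⟨h, φ⟩` for all Schwartz functions `φ`. For integrable `u` this means
`h = û` almost everywhere. -/
def IsFourierTransform (u h : ℝ → ℂ) : Prop :=
  IsTempered u ∧ IsTempered h ∧
    ∀ φ : 𝓢(ℝ, ℂ), ∫ x : ℝ, u x * fourierHat φ x = ∫ κ : ℝ, h κ * φ κ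

/-- `ψ_α^θ(κ) = |κ|^α exp(i sign(κ) θ π / 2)`. -/
def psi (α θ κ : ℝ) : ℂ :=
  ((|κ| ^ α : ℝ) : ℂ) * Complex.exp (Complex.I * (Real.sign κ * (θ * Real.pi / 2) : ℝ))

/-- `v` is the Riesz-Feller derivative `D_θ^α u`: its Fourier transform is `-ψ_α^θ` times the
Fourier transform of `u`. -/
def IsRieszFeller (α θ : ℝ) (u v : ℝ → ℂ) : Prop :=
  ∃ h : ℝ → ℂ, IsFourierTransform u h ∧ IsFourierTransform v fun κ => -psi α θ κ * h κ

/-! The initial-boundary value problem -/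

/-- `N` is a solution of `D_t^{μ,ν} N = D_θ^α N - k² N + Φ` on `ℝ × (0,∞)` with
`I_t^{(1-ν)(2-μ)} N → f`, `∂_t I_t^{(1-ν)(2-μ)} N → g` as `t → 0+` and `N → 0` as `x → ±∞`. -/
structure IsSolution (α θ μ ν k : ℝ) (f g : ℝ → ℂ) (Φ N : ℝ → ℝ → ℂ) : Prop where
  continuousOn : ContinuousOn (Function.uncurry N) (univ ×ˢ Ioi 0)
  contDiffOn : ∀ x, ContDiffOn ℝ 2 (rlIntegral ((1 - ν) * (2 - μ)) (N x)) (Ioi 0)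
  /-- At most polynomial growth in `x`, and an integrable singularity at `t = 0`. -/
  growth : ∀ T > 0, ∃ (m : ℕ) (B : ℝ → ℝ), ContinuousOn B (Ioc 0 T) ∧ IntegrableOn B (Ioc 0 T) ∧
    ∀ x, ∀ t ∈ Ioc 0 T, ‖N x t‖ ≤ B t * (1 + |x|) ^ m ∧
      ‖iteratedDeriv 2 (rlIntegral ((1 - ν) * (2 - μ)) (N x)) t‖ ≤ B t * (1 + |x|) ^ m
  /-- `N` has a Fourier transform in `x` that is a function, locally integrable in time. -/
  hasFourier : ∃ Nhat : ℝ → ℝ → ℂ,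
    (∀ t > 0, IsFourierTransform (fun x => N x t) fun κ => Nhat κ t) ∧
    ∀ T > 0, ∃ m : ℕ, Integrable
      (fun p : ℝ × ℝ => (((1 + |p.1|) ^ m)⁻¹ : ℝ) • Nhat p.1 p.2)
      (volume.prod (volume.restrict (Ioc 0 T)))
  equation : ∀ t > 0, ∃ v : ℝ → ℂ, IsRieszFeller α θ (fun x => N x t) v ∧
    ∀ x, hilferDeriv μ ν (N x) t = v x - (k : ℂ) ^ 2 * N x t + Φ x t
  initial_value : ∀ x,
    Tendsto (rlIntegral ((1 - ν) * (2 - μ)) (N x)) (𝓝[>] 0) (𝓝 (f x))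
  initial_velocity : ∀ x,
    Tendsto (deriv (rlIntegral ((1 - ν) * (2 - μ)) (N x))) (𝓝[>] 0) (𝓝 (g x))
  boundary : ∀ t > 0, Tendsto (fun x => N x t) atTop (𝓝 0) ∧ Tendsto (fun x => N x t) atBot (𝓝 0)

/-- `E_{μ,b}(-t^μ (ψ_α^θ(κ) + k²))`. -/
def symbolML (α θ μ k b t κ : ℝ) : ℂ :=
  mittagLeffler μ b (-((t ^ μ : ℝ) : ℂ) * (psi α θ κ + (k : ℂ) ^ 2))

/-- `(𝓔_{0+;μ,μ}^{-(ψ_α^θ(κ)+k²);1} Φ̂)(κ,t)`. -/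
def sourceTerm (α θ μ k : ℝ) (Φ : ℝ → ℝ → ℂ) (t κ : ℝ) : ℂ :=
  prabhakar μ μ (-(psi α θ κ + (k : ℂ) ^ 2)) 1 (fun s => fourierHat (fun x => Φ x s) κ) t

/-- The closed form of the solution. -/
def solutionFormula (α θ μ ν k : ℝ) (f g : ℝ → ℂ) (Φ : ℝ → ℝ → ℂ) (x t : ℝ) : ℂ :=
  ((t ^ (-((1 - ν) * (2 - μ))) : ℝ) : ℂ) *
      fourierInv (fun κ => symbolML α θ μ k (1 - (1 - ν) * (2 - μ)) t κ * fourierHat f κ) x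
    + ((t ^ (1 - (1 - ν) * (2 - μ)) : ℝ) : ℂ) *
      fourierInv (fun κ => symbolML α θ μ k (2 - (1 - ν) * (2 - μ)) t κ * fourierHat g κ) x
    + fourierInv (sourceTerm α θ μ k Φ t) x

/-- The three Fourier integrals in the closed form converge absolutely. -/
structure FormulaConverges (α θ μ ν k : ℝ) (f g : ℝ → ℂ) (Φ : ℝ → ℝ → ℂ) : Prop where
  value : ∀ t > 0, Integrable fun κ =>
    symbolML α θ μ k (1 - (1 - ν) * (2 - μ)) t κ * fourierHat f κ
  velocity : ∀ t > 0, Integrable fun κ =>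
    symbolML α θ μ k (2 - (1 - ν) * (2 - μ)) t κ * fourierHat g κ
  source : ∀ t > 0, Integrable (sourceTerm α θ μ k Φ t)

/-- The data are regular enough for the closed form to be a classical solution: `f`, `g` and
`Φ(·,t)` are continuous, and their Fourier transforms decay fast enough relative to the
Mittag-Leffler factors, locally uniformly in time. The source is `I^{ν(2-μ)}` of a function
continuous in time, on the Fourier side. -/
structure RegularData (α θ μ ν k : ℝ) (f g : ℝ → ℂ) (Φ : ℝ → ℝ → ℂ) : Prop where
  continuous_f : Continuous f
  continuous_g : Continuous g
  continuous_source : ∀ t > 0, Continuous fun x => Φ x t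
  decay_f : ∀ T > 0, ∃ G : ℝ → ℝ, Integrable G ∧ ∀ κ, ∀ t ∈ Icc 0 T,
    (1 + |κ| ^ α) * ‖symbolML α θ μ k (μ - 1) t κ * fourierHat f κ‖ ≤ G κ
  decay_g : ∀ T > 0, ∃ G : ℝ → ℝ, Integrable G ∧ ∀ κ, ∀ t ∈ Icc 0 T,
    (1 + |κ| ^ α) * ‖symbolML α θ μ k 1 t κ * fourierHat g κ‖ ≤ G κ
  decay_source : ∃ ρ : ℝ → ℝ → ℂ, Measurable (Function.uncurry ρ) ∧
    (∀ κ, ContinuousOn (ρ κ) (Ioi 0)) ∧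
    (∀ κ, ∀ t > 0, fourierHat (fun x => Φ x t) κ = rlIntegral (ν * (2 - μ)) (ρ κ) t) ∧
    ∀ T > 0, ∃ G B : ℝ → ℝ, Integrable G ∧ ContinuousOn B (Ioc 0 T) ∧ IntegrableOn B (Ioc 0 T) ∧
      ∀ κ, ∀ t ∈ Icc 0 T, ∀ s ∈ Ioc 0 T,
        (1 + |κ| ^ α) * ‖symbolML α θ μ k 1 t κ * ρ κ s‖ ≤ G κ * B s

end FracWave

end

noncomputable section

namespace FracWave

/-! One-sided convolution and the Mittag-Leffler kernels -/

/-! Put β = (1-ν)(2-μ), γ = ν(2-μ), so that β + γ = 2 - μ and β < 1, and c = ψ(κ) + k². Everything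
in time is convolution on (0,t) with two families of kernels: k_a = t^{a-1}/Γ(a), and e_b =
t^{b-1}E_{μ,b}(-ct^μ) = Σ (-c)^n k_{μn+b}. Two identities do the algebra: k_a ⋆ e_b = e_{a+b}
(`conv_powKer_mlKer`) and e_b = k_b - c e_{b+μ} (`mlKer_eq_powKer_sub`). On the Fourier side the
closed form is the mode H = e_{1-β} f̂ + e_{2-β} ĝ + e_μ ⋆ Φ̂ (`modeSol`).

Existence. With Φ̂ = I^γ ρ, let P = -c e_{μ-1} f̂ - c e_μ ĝ + ρ - c e_μ ⋆ ρ (`modeAccel`). The two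
identities give I^β H = f̂ + t ĝ + k₂ ⋆ P and I^γ P = -cH + Φ̂, which are the initial conditions and
the Hilfer equation for one frequency. The decay hypotheses are what is needed to bound P by an
integrable function of κ times a continuous integrable function of t (`norm_modeAccel_le`); the same
bound for H comes from H = k_{1-β} f̂ + k_{2-β} ĝ + k_{2-β} ⋆ P. Fubini and dominated convergence
then carry the mode identities over to N (`isSolution_of_modes`).

Uniqueness. A solution has a Fourier transform N̂ that is defined only almost everywhere in κ for
each t, so the equation for a single frequency is not available at the outset. Testing N against φ̂,
with φ a Schwartz function, Taylor's formula for I^β N and convolution with k_{1-β} give an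
integrated equation k₁ ⋆ N̂ = k_{2-β} f̂ + k_{3-β} ĝ + k_{μ+1} ⋆ (-c N̂ + Φ̂), tested against φ
(`IsSolution.tested`). Both sides are continuous in t, so equality for a.e. κ at every rational t
yields, for a.e. κ, equality at all t > 0. Convolving with e₁ solves this Volterra equation: k₂ ⋆ N̂
= k₂ ⋆ H (`conv_two_eq_of_volterra`). Removing k₂ needs continuity in t, which N̂ lacks but its
tested version ∫ N̂ φ = ∫ N φ̂ has; hence N̂(·,t) = H(·,t) a.e. for every t, and Fourier inversion
for the continuous function N(·,t) finishes the proof (`IsSolution.eq_solutionFormula`). -/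

/-- The one-sided convolution `∫₀ᵗ K(t-s) u(s) ds`. -/
def conv (K u : ℝ → ℂ) (t : ℝ) : ℂ := ∫ s in Ioc 0 t, K (t - s) * u s

/-- The kernel `t^{a-1} / Γ(a)` of the Riemann-Liouville integral. -/
def powKer (a t : ℝ) : ℝ := t ^ (a - 1) / Real.Gamma a

/-- The complex valued version of `powKer`. -/
abbrev cPowKer (a t : ℝ) : ℂ := (powKer a t : ℂ)

/-- The kernel `t^{b-1} E_{μ,b}(-c t^μ)`. -/
def mlKer (μ : ℝ) (c : ℂ) (b t : ℝ) : ℂ :=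
  ((t ^ (b - 1) : ℝ) : ℂ) * mittagLeffler μ b (-((t ^ μ : ℝ) : ℂ) * c)

lemma powKer_nonneg {a t : ℝ} (ha : 0 < a) (ht : 0 ≤ t) : 0 ≤ powKer a t :=
  div_nonneg (Real.rpow_nonneg ht _) (Real.Gamma_pos_of_pos ha).le

lemma continuousOn_rpow_Ioi (e : ℝ) : ContinuousOn (fun t : ℝ => t ^ e) (Ioi 0) :=
  fun _ ht => (Real.continuousAt_rpow_const _ _ (Or.inl (ne_of_gt ht))).continuousWithinAt

lemma continuousOn_powKer (a : ℝ) : ContinuousOn (powKer a) (Ioi 0) :=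
  (continuousOn_rpow_Ioi _).div_const _

lemma measurable_powKer (a : ℝ) : Measurable (powKer a) :=
  (measurable_id.pow_const _).div_const _

lemma intervalIntegrable_rpow_left {e : ℝ} (he : -1 < e) (t : ℝ) :
    IntegrableOn (fun s : ℝ => s ^ e) (Ioc 0 t) :=
  (intervalIntegral.intervalIntegrable_rpow' (a := 0) (b := t) he).1

lemma integrableOn_sub_rpow {e : ℝ} (he : -1 < e) (t : ℝ) :
    IntegrableOn (fun s : ℝ => (t - s) ^ e) (Ioc 0 t) := by
  have := (intervalIntegral.intervalIntegrable_rpow' (a := 0) (b := t) he).comp_sub_left t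
  simp only [sub_zero, sub_self] at this
  exact this.symm.1

lemma integrableOn_powKer {a : ℝ} (ha : 0 < a) (t : ℝ) : IntegrableOn (powKer a) (Ioc 0 t) :=
  (intervalIntegrable_rpow_left (by linarith) t).div_const _

lemma integrableOn_powKer_sub {a : ℝ} (ha : 0 < a) (t : ℝ) :
    IntegrableOn (fun s => powKer a (t - s)) (Ioc 0 t) :=
  (integrableOn_sub_rpow (by linarith) t).div_const _

/-- Each factor is singular at one endpoint only. After a cut at t/2 the other factor is continuous
on the half in question, and the reflection s ↦ t - s reduces the right half to the left one with a
and b exchanged. -/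
lemma integrableOn_powKer_mul_powKer {a b t : ℝ} (ha : 0 < a) (hb : 0 < b) (ht : 0 < t) :
    IntegrableOn (fun s => powKer a (t - s) * powKer b s) (Ioc 0 t) := by
  have key : ∀ {a b : ℝ}, 0 < a → 0 < b →
      IntegrableOn (fun s => powKer a (t - s) * powKer b s) (Ioc 0 (t / 2)) := by
    intro a b ha hb
    refine (integrableOn_powKer hb _).continuousOn_mul_of_subset
      (K := Icc 0 (t / 2)) ?_ isCompact_Icc measurableSet_Ioc Ioc_subset_Icc_self
    exact (continuousOn_powKer a).comp (by fun_prop) fun s hs => by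
      simp only [mem_Ioi]; linarith [hs.2]
  have h2 : IntegrableOn (fun s => powKer a (t - s) * powKer b s) (Ioc (t / 2) t) := by
    have h := key hb ha
    have h' : IntervalIntegrable (fun s => powKer b (t - s) * powKer a s) volume 0 (t / 2) :=
      (intervalIntegrable_iff_integrableOn_Ioc_of_le (by linarith)).2 h
    have h'' := (h'.comp_sub_left t).symm
    rw [sub_zero, show t - t / 2 = t / 2 by ring] at h''
    refine (h''.1).congr_fun (fun s _ => ?_) measurableSet_Ioc
    simp only [sub_sub_cancel]; ring
  rw [← Ioc_union_Ioc_eq_Ioc (show (0 : ℝ) ≤ t / 2 by linarith) (show t / 2 ≤ t by linarith)]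
  exact (key ha hb).union h2

/-- The semigroup law of the Riemann-Liouville kernels. -/
lemma integral_powKer_mul_powKer {a b t : ℝ} (ha : 0 < a) (hb : 0 < b) (ht : 0 < t) :
    ∫ s in Ioc 0 t, powKer a (t - s) * powKer b s = powKer (a + b) t := by
  have h := Complex.betaIntegral_scaled b a ht
  rw [Complex.betaIntegral_eq_Gamma_mul_div _ _ (by simpa) (by simpa),
    intervalIntegral.integral_of_le ht.le] at h
  have h1 : ∫ x in Ioc 0 t, (x : ℂ) ^ ((b : ℂ) - 1) * ((t : ℂ) - x) ^ ((a : ℂ) - 1) =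
      ((∫ s in Ioc 0 t, s ^ (b - 1) * (t - s) ^ (a - 1) : ℝ) : ℂ) := by
    rw [← integral_complex_ofReal]
    refine setIntegral_congr_fun measurableSet_Ioc fun s hs => ?_
    simp only [Complex.ofReal_mul]
    rw [Complex.ofReal_cpow hs.1.le, Complex.ofReal_cpow (sub_nonneg.2 hs.2)]
    push_cast; rfl
  rw [h1] at h
  have h2 : (∫ s in Ioc 0 t, s ^ (b - 1) * (t - s) ^ (a - 1)) =
      t ^ (b + a - 1) * (Real.Gamma b * Real.Gamma a / Real.Gamma (b + a)) := by
    have : ((t : ℂ) ^ ((b : ℂ) + a - 1)) = ((t ^ (b + a - 1) : ℝ) : ℂ) := by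
      rw [Complex.ofReal_cpow ht.le]; push_cast; rfl
    rw [this, ← Complex.ofReal_add, Complex.Gamma_ofReal, Complex.Gamma_ofReal,
      Complex.Gamma_ofReal] at h
    exact_mod_cast h
  have hga := (Real.Gamma_pos_of_pos ha).ne'
  have hgb := (Real.Gamma_pos_of_pos hb).ne'
  calc ∫ s in Ioc 0 t, powKer a (t - s) * powKer b s
      = ∫ s in Ioc 0 t, (1 / (Real.Gamma a * Real.Gamma b)) * (s ^ (b - 1) * (t - s) ^ (a - 1)) := by
        refine setIntegral_congr_fun measurableSet_Ioc fun s _ => ?_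
        simp only [powKer]; field_simp
    _ = powKer (a + b) t := by
        rw [integral_const_mul, h2, powKer, add_comm b a]; field_simp

/-! Convergence of the Mittag-Leffler series -/

/-- Once n ≥ 1 and n(μ-1) ≥ 1 one has 2 ≤ n+1 ≤ μn+b, and Γ is increasing on [2,∞). The
Mittag-Leffler series is thus eventually dominated by the exponential series. -/
lemma factorial_le_Gamma {μ b : ℝ} (hμ : 1 < μ) (hb : 0 < b) :
    ∀ᶠ n : ℕ in atTop, (n.factorial : ℝ) ≤ Real.Gamma (μ * n + b) := by
  obtain ⟨n₀, hn₀⟩ := exists_nat_ge (1 / (μ - 1))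
  filter_upwards [eventually_ge_atTop (max n₀ 1)] with n hn
  have h1 : (1 : ℝ) ≤ n := by exact_mod_cast (le_max_right _ _).trans hn
  have h2 : 1 / (μ - 1) ≤ n := hn₀.trans (by exact_mod_cast (le_max_left _ _).trans hn)
  have h3 : 1 ≤ n * (μ - 1) := by rwa [div_le_iff₀ (by linarith)] at h2
  rw [← Real.Gamma_nat_eq_factorial]
  exact Real.Gamma_strictMonoOn_Ici.monotoneOn (by simp; linarith) (by simp; nlinarith)
    (by nlinarith)

lemma summable_pow_div_Gamma {μ b : ℝ} (hμ : 1 < μ) (hb : 0 < b) (r : ℝ) (hr : 0 ≤ r) :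
    Summable fun n : ℕ => r ^ n / Real.Gamma (μ * n + b) := by
  refine Summable.of_norm_bounded_eventually_nat (Real.summable_pow_div_factorial r) ?_
  filter_upwards [factorial_le_Gamma hμ hb] with n hn
  have : (0 : ℝ) < n.factorial := by positivity
  rw [Real.norm_of_nonneg (div_nonneg (by positivity) (this.le.trans hn))]
  gcongr

lemma Gamma_series_pos {μ b : ℝ} (hμ : 1 < μ) (hb : 0 < b) (n : ℕ) :
    0 < Real.Gamma (μ * n + b) := Real.Gamma_pos_of_pos (by positivity)

lemma norm_mittagLeffler_term {μ b : ℝ} (hμ : 1 < μ) (hb : 0 < b) (z : ℂ) (n : ℕ) :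
    ‖z ^ n / Complex.Gamma ((μ : ℂ) * n + b)‖ = ‖z‖ ^ n / Real.Gamma (μ * n + b) := by
  have : (μ : ℂ) * n + b = ((μ * n + b : ℝ) : ℂ) := by push_cast; ring
  rw [this, Complex.Gamma_ofReal, norm_div, norm_pow, Complex.norm_real,
    Real.norm_of_nonneg (Gamma_series_pos hμ hb n).le]

/-- The Mittag-Leffler function is bounded on bounded sets. -/
lemma norm_mittagLeffler_le {μ b : ℝ} (hμ : 1 < μ) (hb : 0 < b) {z : ℂ} {r : ℝ} (hz : ‖z‖ ≤ r) :
    ‖mittagLeffler μ b z‖ ≤ ∑' n : ℕ, r ^ n / Real.Gamma (μ * n + b) := by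
  refine tsum_of_norm_bounded
    (summable_pow_div_Gamma hμ hb r ((norm_nonneg z).trans hz)).hasSum fun n => ?_
  rw [norm_mittagLeffler_term hμ hb]
  have := Gamma_series_pos hμ hb n
  gcongr

lemma continuous_mittagLeffler {μ b : ℝ} (hμ : 1 < μ) (hb : 0 < b) :
    Continuous (mittagLeffler μ b) := by
  rw [continuous_iff_continuousAt]
  intro z
  have : ContinuousOn (mittagLeffler μ b) (Metric.ball 0 (‖z‖ + 1)) := by
    refine continuousOn_tsum (u := fun n : ℕ => (‖z‖ + 1) ^ n / Real.Gamma (μ * n + b))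
      (fun n => by fun_prop) (summable_pow_div_Gamma hμ hb _ (by positivity)) fun n w hw => ?_
    rw [norm_mittagLeffler_term hμ hb]
    have := Gamma_series_pos hμ hb n
    have := (mem_ball_zero_iff.1 hw).le
    gcongr
  exact this.continuousAt (Metric.isOpen_ball.mem_nhds (by simp))

lemma mlKer_series_term {μ b t : ℝ} (c : ℂ) (ht : 0 < t) (n : ℕ) :
    ((t ^ (b - 1) : ℝ) : ℂ) * ((-((t ^ μ : ℝ) : ℂ) * c) ^ n / Complex.Gamma ((μ : ℂ) * n + b)) =
      (-c) ^ n * (powKer (μ * n + b) t : ℂ) := by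
  have h : (μ : ℂ) * n + b = ((μ * n + b : ℝ) : ℂ) := by push_cast; ring
  have h2 : t ^ (μ * n + b - 1) = t ^ (b - 1) * (t ^ μ) ^ n := by
    rw [show μ * n + b - 1 = (b - 1) + μ * n by ring, Real.rpow_add ht, Real.rpow_mul ht.le,
      Real.rpow_natCast]
  rw [h, Complex.Gamma_ofReal, powKer, h2, show -((t ^ μ : ℝ) : ℂ) * c = ((t ^ μ : ℝ) : ℂ) * (-c) by
    ring, mul_pow]
  push_cast; ring

lemma hasSum_mlKer {μ b t : ℝ} (hμ : 1 < μ) (hb : 0 < b) (c : ℂ) (ht : 0 < t) :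
    HasSum (fun n : ℕ => (-c) ^ n * (powKer (μ * n + b) t : ℂ)) (mlKer μ c b t) := by
  have h : Summable fun n : ℕ => (-((t ^ μ : ℝ) : ℂ) * c) ^ n / Complex.Gamma ((μ : ℂ) * n + b) := by
    refine Summable.of_norm ?_
    simp_rw [norm_mittagLeffler_term hμ hb]
    exact summable_pow_div_Gamma hμ hb _ (norm_nonneg _)
  have := h.hasSum.mul_left ((t ^ (b - 1) : ℝ) : ℂ)
  simp only [mlKer_series_term c ht] at this
  exact this

lemma summable_mlKer_norm {μ b t : ℝ} (hμ : 1 < μ) (hb : 0 < b) (c : ℂ) (ht : 0 < t) :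
    Summable fun n : ℕ => ‖c‖ ^ n * powKer (μ * n + b) t := by
  -- At the parameter -‖c‖ all signs disappear, so ordinary summability there is absolute
  -- summability at c.
  have := (hasSum_mlKer hμ hb (-(‖c‖ : ℂ)) ht).summable
  simp only [neg_neg] at this
  exact_mod_cast this

lemma mlKer_zero {μ b t : ℝ} (hμ : 1 < μ) (hb : 0 < b) (ht : 0 < t) :
    mlKer μ 0 b t = powKer b t := by
  refine (hasSum_mlKer hμ hb 0 ht).unique ?_
  convert hasSum_single 0 fun n hn => ?_ using 1
  · simp
  · simp [hn]

/-- `e_b = k_b - c e_{b+μ}`. -/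
lemma mlKer_eq_powKer_sub {μ b t : ℝ} (hμ : 1 < μ) (hb : 0 < b) (c : ℂ) (ht : 0 < t) :
    mlKer μ c b t = powKer b t - c * mlKer μ c (b + μ) t := by
  have h1 := (hasSum_nat_add_iff' 1).2 (hasSum_mlKer hμ hb c ht)
  have h2 := (hasSum_mlKer hμ (show 0 < b + μ by linarith) c ht).mul_left (-c)
  have h4 : (fun n : ℕ => (-c) ^ (n + 1) * (powKer (μ * ((n + 1 : ℕ) : ℝ) + b) t : ℂ)) =
      fun n : ℕ => -c * ((-c) ^ n * (powKer (μ * n + (b + μ)) t : ℂ)) := by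
    ext n
    rw [pow_succ, show μ * ((n + 1 : ℕ) : ℝ) + b = μ * n + (b + μ) by push_cast; ring]; ring
  rw [h4] at h1
  have h3 := h1.unique h2
  simp only [Finset.range_one, Finset.sum_singleton, pow_zero, Nat.cast_zero, mul_zero, zero_add,
    one_mul] at h3
  linear_combination h3

lemma continuousOn_mlKer {μ b : ℝ} (hμ : 1 < μ) (hb : 0 < b) (c : ℂ) :
    ContinuousOn (mlKer μ c b) (Ioi 0) := by
  refine (Complex.continuous_ofReal.comp_continuousOn (continuousOn_rpow_Ioi _)).mul
    ((continuous_mittagLeffler hμ hb).comp_continuousOn ?_)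
  exact (Complex.continuous_ofReal.comp_continuousOn (continuousOn_rpow_Ioi _)).neg.mul
    continuousOn_const

lemma measurable_mlKer {μ b : ℝ} (hμ : 1 < μ) (hb : 0 < b) :
    Measurable fun p : ℂ × ℝ => mlKer μ p.1 b p.2 := by
  refine Measurable.mul ?_ ((continuous_mittagLeffler hμ hb).measurable.comp ?_)
  · exact Complex.measurable_ofReal.comp (measurable_snd.pow_const _)
  · exact (Complex.measurable_ofReal.comp (measurable_snd.pow_const _)).neg.mul measurable_fst

/-- On `(0, T]` the kernel `e_b` is bounded by `t^{b-1}`, locally uniformly in `c`. -/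
lemma exists_norm_mlKer_le {μ b : ℝ} (hμ : 1 < μ) (hb : 0 < b) (R T : ℝ) :
    ∃ C : ℝ, 0 ≤ C ∧ ∀ c : ℂ, ‖c‖ ≤ R → ∀ t ∈ Ioc 0 T, ‖mlKer μ c b t‖ ≤ C * powKer b t := by
  have hG := Real.Gamma_pos_of_pos hb
  -- The majorant series at the largest modulus of t^μ c; the absolute values keep it nonnegative
  -- without sign conditions on T and R.
  set S := ∑' n : ℕ, (|T| ^ μ * |R|) ^ n / Real.Gamma (μ * n + b) with hS
  have hS0 : 0 ≤ S := tsum_nonneg fun n => div_nonneg (by positivity) (Gamma_series_pos hμ hb n).le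
  refine ⟨S * Real.Gamma b, by positivity, fun c hc t ht => ?_⟩
  have h1 : ‖mittagLeffler μ b (-((t ^ μ : ℝ) : ℂ) * c)‖ ≤ S := by
    refine norm_mittagLeffler_le hμ hb ?_
    rw [norm_mul, norm_neg, Complex.norm_real, Real.norm_of_nonneg (Real.rpow_nonneg ht.1.le _)]
    have h3 := ht.1.le
    have h4 : t ≤ |T| := ht.2.trans (le_abs_self _)
    have h5 := hc.trans (le_abs_self R)
    gcongr
  rw [mlKer, norm_mul, Complex.norm_real, Real.norm_of_nonneg (Real.rpow_nonneg ht.1.le _), powKer]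
  have h3 := Real.rpow_nonneg ht.1.le (b - 1)
  calc t ^ (b - 1) * ‖mittagLeffler μ b (-((t ^ μ : ℝ) : ℂ) * c)‖ ≤ t ^ (b - 1) * S := by gcongr
    _ = S * Real.Gamma b * (t ^ (b - 1) / Real.Gamma b) := by field_simp

/-- `k_a ⋆ e_b = e_{a+b}`. -/
lemma conv_powKer_mlKer {μ a b t : ℝ} (hμ : 1 < μ) (ha : 0 < a) (hb : 0 < b) (c : ℂ) (ht : 0 < t) :
    conv (cPowKer a) (mlKer μ c b) t = mlKer μ c (a + b) t := by
  have hn : ∀ n : ℕ, 0 < μ * n + b := fun n => by positivity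
  have hI : ∀ n : ℕ, ∀ s ∈ Ioc 0 t,
      ‖(powKer a (t - s) : ℂ) * ((-c) ^ n * (powKer (μ * n + b) s : ℂ))‖ =
        ‖c‖ ^ n * (powKer a (t - s) * powKer (μ * n + b) s) := fun n s hs => by
    rw [norm_mul, norm_mul, norm_pow, norm_neg, Complex.norm_real, Complex.norm_real,
      Real.norm_of_nonneg (powKer_nonneg ha (sub_nonneg.2 hs.2)),
      Real.norm_of_nonneg (powKer_nonneg (hn n) hs.1.le)]
    ring
  -- Termwise integration of the kernel series: the semigroup law evaluates each term, and the
  -- integrals of the norms sum to the series with ‖c‖ in place of -c.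
  have h := hasSum_integral_of_summable_integral_norm (μ := volume.restrict (Ioc 0 t))
    (F := fun (n : ℕ) s => (powKer a (t - s) : ℂ) * ((-c) ^ n * (powKer (μ * n + b) s : ℂ)))
    (fun n => ?_) ?_
  · have h2 : (fun n : ℕ => ∫ s in Ioc 0 t,
        (powKer a (t - s) : ℂ) * ((-c) ^ n * (powKer (μ * n + b) s : ℂ))) =
        fun n : ℕ => (-c) ^ n * (powKer (μ * n + (a + b)) t : ℂ) := by
      ext n
      rw [show μ * n + (a + b) = a + (μ * n + b) by ring,
        ← integral_powKer_mul_powKer ha (hn n) ht, ← integral_complex_ofReal, ← integral_const_mul]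
      congr 1; ext s; push_cast; ring
    rw [h2] at h
    have h3 := h.unique (hasSum_mlKer hμ (show 0 < a + b by linarith) c ht)
    rw [← h3, conv]
    refine setIntegral_congr_fun measurableSet_Ioc fun s hs => ?_
    rw [tsum_mul_left, (hasSum_mlKer hμ hb c hs.1).tsum_eq]
  · have := (integrableOn_powKer_mul_powKer ha (hn n) ht).ofReal (𝕜 := ℂ) |>.const_mul ((-c) ^ n)
    refine this.congr (ae_of_all _ fun s => ?_)
    push_cast; simp; ring
  · have : ∀ n : ℕ, ∫ s in Ioc 0 t, ‖(powKer a (t - s) : ℂ) * ((-c) ^ n * (powKer (μ * n + b) s : ℂ))‖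
        = ‖c‖ ^ n * powKer (μ * n + (a + b)) t := fun n => by
      rw [show μ * n + (a + b) = a + (μ * n + b) by ring,
        ← integral_powKer_mul_powKer ha (hn n) ht, ← integral_const_mul]
      exact setIntegral_congr_fun measurableSet_Ioc fun s hs => hI n s hs
    simp_rw [this]
    exact summable_mlKer_norm hμ (by linarith) c ht

/-! Calculus of one-sided convolutions -/

/-- A kernel on `(0, ∞)` with at most the singularity of `t^{a-1}` at the origin. -/
structure IsKer (a : ℝ) (K : ℝ → ℂ) : Prop where
  meas : Measurable K
  cont : ContinuousOn K (Ioi 0)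
  bound : ∀ T, ∃ C, 0 ≤ C ∧ ∀ t ∈ Ioc 0 T, ‖K t‖ ≤ C * powKer a t

/-- Integrability on every interval `(0, T]`. -/
def LocInt (u : ℝ → ℂ) : Prop := ∀ T, IntegrableOn u (Ioc 0 T)

lemma isKer_cPowKer {a : ℝ} (ha : 0 < a) : IsKer a (cPowKer a) where
  meas := Complex.measurable_ofReal.comp (measurable_powKer a)
  cont := Complex.continuous_ofReal.comp_continuousOn (continuousOn_powKer a)
  bound T := ⟨1, zero_le_one, fun t ht => by
    rw [Complex.norm_real, Real.norm_of_nonneg (powKer_nonneg ha ht.1.le), one_mul]⟩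

lemma isKer_mlKer {μ b : ℝ} (hμ : 1 < μ) (hb : 0 < b) (c : ℂ) : IsKer b (mlKer μ c b) where
  meas := (measurable_mlKer hμ hb).comp (measurable_const.prodMk measurable_id)
  cont := continuousOn_mlKer hμ hb c
  bound T := by
    obtain ⟨C, h0, h⟩ := exists_norm_mlKer_le hμ hb ‖c‖ T
    exact ⟨C, h0, h c le_rfl⟩

lemma powKer_le {a t T : ℝ} (ha : 1 ≤ a) (ht : 0 ≤ t) (hT : t ≤ T) : powKer a t ≤ powKer a T := by
  have := Real.Gamma_pos_of_pos (show 0 < a by linarith)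
  unfold powKer
  gcongr

lemma powKer_one (t : ℝ) : powKer 1 t = 1 := by simp [powKer]

lemma powKer_two (t : ℝ) : powKer 2 t = t := by
  norm_num [powKer]

lemma IsKer.bound' {a : ℝ} {K : ℝ → ℂ} (hK : IsKer a K) (ha : 1 ≤ a) (T : ℝ) :
    ∃ C, 0 ≤ C ∧ ∀ t ∈ Ioc 0 T, ‖K t‖ ≤ C := by
  obtain ⟨C, h0, h⟩ := hK.bound T
  rcases le_or_gt T 0 with hT | hT
  · exact ⟨0, le_rfl, fun t ht => absurd (ht.1.trans_le ht.2) (not_lt.2 hT)⟩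
  have := powKer_nonneg (show 0 < a by linarith) hT.le
  exact ⟨C * powKer a T, by positivity, fun t ht => (h t ht).trans
    (mul_le_mul_of_nonneg_left (powKer_le ha ht.1.le ht.2) h0)⟩

/-- The endpoint s = t is a null set; it is discarded because kernel bounds say nothing about the
kernel at t - s = 0. -/
lemma ae_Ioc_mem_Ioo (t : ℝ) : ∀ᵐ s ∂(volume.restrict (Ioc 0 t)), s ∈ Ioo 0 t := by
  rw [← restrict_Ioo_eq_restrict_Ioc]
  exact ae_restrict_mem measurableSet_Ioo

lemma sub_mem_Ioc {s t : ℝ} (hs : s ∈ Ioo 0 t) : t - s ∈ Ioc 0 t :=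
  ⟨by linarith [hs.2], by linarith [hs.1]⟩

lemma measurable_kernel_sub {K : ℝ → ℂ} (hK : Measurable K) (t : ℝ) :
    Measurable fun s => K (t - s) := hK.comp (measurable_const.sub measurable_id)

/-- Convolution integrands with a bounded kernel are integrable. -/
lemma IsKer.integrableOn {a : ℝ} {K : ℝ → ℂ} (hK : IsKer a K) (ha : 1 ≤ a) {u : ℝ → ℂ} {t : ℝ}
    (hu : IntegrableOn u (Ioc 0 t)) : IntegrableOn (fun s => K (t - s) * u s) (Ioc 0 t) := by
  obtain ⟨C, -, hC⟩ := hK.bound' ha t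
  refine Integrable.bdd_mul (c := C) hu (measurable_kernel_sub hK.meas t).aestronglyMeasurable ?_
  filter_upwards [ae_Ioc_mem_Ioo t] with s hs
  exact hC _ (sub_mem_Ioc hs)

/-- A function that is continuous and integrable on `(0, t]` can be convolved with a singular
kernel. -/
lemma integrableOn_powKer_sub_mul {a t : ℝ} (ha : 0 < a) (ht : 0 < t) {b : ℝ → ℝ}
    (hb : ContinuousOn b (Ioc 0 t)) (hi : IntegrableOn b (Ioc 0 t)) :
    IntegrableOn (fun s => powKer a (t - s) * b s) (Ioc 0 t) := by
  -- Near 0 the kernel is continuous and b is integrable; near t the kernel is integrable and b is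
  -- continuous. Integrability of b alone would not control the singularity at s = t.
  have h1 : IntegrableOn (fun s => powKer a (t - s) * b s) (Ioc 0 (t / 2)) := by
    refine (hi.mono_set (Ioc_subset_Ioc_right (by linarith))).continuousOn_mul_of_subset
      (K := Icc 0 (t / 2)) ?_ isCompact_Icc measurableSet_Ioc Ioc_subset_Icc_self
    exact (continuousOn_powKer a).comp (by fun_prop) fun s hs => by
      simp only [mem_Ioi]; linarith [hs.2]
  have h2 : IntegrableOn (fun s => powKer a (t - s) * b s) (Ioc (t / 2) t) := by
    refine ((integrableOn_powKer_sub ha t).mono_set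
      (Ioc_subset_Ioc_left (by linarith))).mul_continuousOn_of_subset
      (K := Icc (t / 2) t) ?_ measurableSet_Ioc isCompact_Icc Ioc_subset_Icc_self
    exact hb.mono fun s hs => ⟨by linarith [hs.1], hs.2⟩
  rw [← Ioc_union_Ioc_eq_Ioc (show (0 : ℝ) ≤ t / 2 by linarith) (show t / 2 ≤ t by linarith)]
  exact h1.union h2

lemma IsKer.integrableOn_of_le {a : ℝ} {K : ℝ → ℂ} (hK : IsKer a K) {u : ℝ → ℂ} {v : ℝ → ℝ} {t : ℝ}
    (hu : AEStronglyMeasurable u (volume.restrict (Ioc 0 t)))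
    (hi : IntegrableOn (fun s => powKer a (t - s) * v s) (Ioc 0 t))
    (hv : ∀ s ∈ Ioc 0 t, ‖u s‖ ≤ v s) :
    IntegrableOn (fun s => K (t - s) * u s) (Ioc 0 t) := by
  obtain ⟨C, h0, hC⟩ := hK.bound t
  refine Integrable.mono' (hi.const_mul C)
    ((measurable_kernel_sub hK.meas t).aestronglyMeasurable.mul hu) ?_
  filter_upwards [ae_Ioc_mem_Ioo t] with s hs
  rw [norm_mul, ← mul_assoc]
  exact mul_le_mul (hC _ (sub_mem_Ioc hs)) (hv s ⟨hs.1, hs.2.le⟩) (norm_nonneg _)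
    ((norm_nonneg _).trans (hC _ (sub_mem_Ioc hs)))

lemma IsKer.integrableOn_mul {a b : ℝ} {K L : ℝ → ℂ} (hK : IsKer a K) (hL : IsKer b L)
    (ha : 0 < a) (hb : 0 < b) {t : ℝ} (ht : 0 < t) :
    IntegrableOn (fun s => K (t - s) * L s) (Ioc 0 t) := by
  obtain ⟨C, h0, hC⟩ := hL.bound t
  refine hK.integrableOn_of_le (v := fun s => C * powKer b s)
    hL.meas.aestronglyMeasurable ?_ hC
  exact IntegrableOn.congr_fun ((integrableOn_powKer_mul_powKer ha hb ht).const_mul C)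
    (fun s _ => by ring) measurableSet_Ioc

lemma IsKer.locInt {a : ℝ} {K : ℝ → ℂ} (hK : IsKer a K) (ha : 0 < a) : LocInt K := fun T => by
  obtain ⟨C, h0, hC⟩ := hK.bound T
  refine Integrable.mono' ((integrableOn_powKer ha T).const_mul C) hK.meas.aestronglyMeasurable ?_
  exact (ae_restrict_iff' measurableSet_Ioc).2 (ae_of_all _ hC)

lemma conv_congr {K u v : ℝ → ℂ} {t : ℝ} (h : ∀ s ∈ Ioc 0 t, u s = v s) :
    conv K u t = conv K v t :=
  setIntegral_congr_fun measurableSet_Ioc fun s hs => by simp only [h s hs]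

lemma conv_congr_ae {K u v : ℝ → ℂ} {t : ℝ} (h : u =ᵐ[volume.restrict (Ioc 0 t)] v) :
    conv K u t = conv K v t :=
  integral_congr_ae (h.mono fun s hs => by simp only [hs])

lemma conv_congr_kernel {K L u : ℝ → ℂ} {t : ℝ} (h : ∀ s ∈ Ioc 0 t, K s = L s) :
    conv K u t = conv L u t := by
  refine integral_congr_ae ?_
  filter_upwards [ae_Ioc_mem_Ioo t] with s hs
  rw [h _ (sub_mem_Ioc hs)]

lemma conv_comm {K u : ℝ → ℂ} {t : ℝ} (ht : 0 ≤ t) : conv K u t = conv u K t := by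
  have := intervalIntegral.integral_comp_sub_left (a := 0) (b := t) (fun s => K (t - s) * u s) t
  rw [sub_zero, sub_self, intervalIntegral.integral_of_le ht, intervalIntegral.integral_of_le ht]
    at this
  rw [conv, ← this, conv]
  simp only [sub_sub_cancel, mul_comm]

lemma conv_add {K u v : ℝ → ℂ} {t : ℝ} (hu : IntegrableOn (fun s => K (t - s) * u s) (Ioc 0 t))
    (hv : IntegrableOn (fun s => K (t - s) * v s) (Ioc 0 t)) :
    conv K (fun s => u s + v s) t = conv K u t + conv K v t := by
  simp only [conv, mul_add]
  exact integral_add hu hv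

lemma conv_const_mul (K u : ℝ → ℂ) (c : ℂ) (t : ℝ) :
    conv K (fun s => c * u s) t = c * conv K u t := by
  simp only [conv, ← integral_const_mul]
  congr 1; ext s; ring

lemma conv_mul_const (K u : ℝ → ℂ) (c : ℂ) (t : ℝ) :
    conv K (fun s => u s * c) t = conv K u t * c := by
  simp only [conv, ← integral_mul_const]
  congr 1; ext s; ring

lemma norm_conv_le {a t : ℝ} {u : ℝ → ℂ} {v : ℝ → ℝ} (ha : 0 < a)
    (hi : IntegrableOn (fun s => powKer a (t - s) * v s) (Ioc 0 t))
    (hv : ∀ s ∈ Ioc 0 t, ‖u s‖ ≤ v s) :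
    ‖conv (cPowKer a) u t‖ ≤ ∫ s in Ioc 0 t, powKer a (t - s) * v s := by
  refine norm_integral_le_of_norm_le hi ((ae_restrict_iff' measurableSet_Ioc).2 (ae_of_all _ ?_))
  intro s hs
  have := powKer_nonneg ha (sub_nonneg.2 hs.2)
  rw [norm_mul, Complex.norm_real, Real.norm_of_nonneg this]
  exact mul_le_mul_of_nonneg_left (hv s hs) this

/-- Associativity of one-sided convolution. -/
lemma conv_assoc {a b t : ℝ} {A B AB u : ℝ → ℂ} (hA : IsKer a A) (hB : IsKer b B) (ha : 0 < a)
    (hb : 0 < b) (hab : 1 ≤ a + b) (hAB : ∀ s, 0 < s → conv A B s = AB s)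
    (hu : IntegrableOn u (Ioc 0 t)) : conv A (conv B u) t = conv AB u t := by
  set ν := volume.restrict (Ioc 0 t) with hν
  -- Extension by zero to s ≤ r turns the triangle r < s into the full square, where Fubini applies.
  let F : ℝ → ℝ → ℂ := fun s r => A (t - s) * ((Ioi r).indicator (fun s => B (s - r)) s * u r)
  obtain ⟨CA, hA0, hCA⟩ := hA.bound t
  obtain ⟨CB, hB0, hCB⟩ := hB.bound t
  have hshift : ∀ r : ℝ, r ∈ Ioo 0 t →
      IntegrableOn (fun s => powKer a (t - s) * powKer b (s - r)) (Ioc r t) ∧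
      ∫ s in Ioc r t, powKer a (t - s) * powKer b (s - r) = powKer (a + b) (t - r) := by
    intro r hr
    have h1 := integrableOn_powKer_mul_powKer ha hb (sub_pos.2 hr.2)
    have h2 := ((intervalIntegrable_iff_integrableOn_Ioc_of_le
      (sub_pos.2 hr.2).le).2 h1).comp_sub_right r
    rw [zero_add, sub_add_cancel, intervalIntegrable_iff_integrableOn_Ioc_of_le hr.2.le] at h2
    have h3 := integral_powKer_mul_powKer ha hb (sub_pos.2 hr.2)
    rw [← intervalIntegral.integral_of_le (sub_pos.2 hr.2).le] at h3
    have h4 := intervalIntegral.integral_comp_sub_right (a := r) (b := t)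
      (fun s => powKer a (t - r - s) * powKer b s) r
    rw [sub_self, h3, intervalIntegral.integral_of_le hr.2.le] at h4
    have h5 : ∀ s, powKer a (t - r - (s - r)) = powKer a (t - s) := fun s => by congr 1; ring
    simp only [h5] at h2 h4
    exact ⟨h2, h4⟩
  have hinter : ∀ r : ℝ, 0 ≤ r → Ioc 0 t ∩ Ioi r = Ioc r t := fun r hr => by
    rw [Ioc_inter_Ioi, max_eq_right hr]
  have hdom : ∀ r ∈ Ioo 0 t, ∀ᵐ s ∂ν, ‖F s r‖ ≤
      (Ioi r).indicator (fun s => powKer a (t - s) * powKer b (s - r)) s * (CA * CB * ‖u r‖) := by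
    intro r hr
    filter_upwards [ae_Ioc_mem_Ioo t] with s hs
    simp only [F, indicator]
    split_ifs with h
    · have h1 := hCA _ (sub_mem_Ioc hs)
      have h2 := hCB (s - r) ⟨sub_pos.2 h, by linarith [hr.1, hs.2]⟩
      rw [norm_mul, norm_mul]
      have h3 : 0 ≤ CA * powKer a (t - s) := (norm_nonneg _).trans h1
      calc ‖A (t - s)‖ * (‖B (s - r)‖ * ‖u r‖)
          ≤ (CA * powKer a (t - s)) * ((CB * powKer b (s - r)) * ‖u r‖) := by gcongr
        _ = _ := by ring
    · simp
  have hdomi : ∀ r ∈ Ioo 0 t, Integrable (fun s =>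
      (Ioi r).indicator (fun s => powKer a (t - s) * powKer b (s - r)) s * (CA * CB * ‖u r‖)) ν := by
    intro r hr
    refine Integrable.mul_const ?_ _
    rw [integrable_indicator_iff measurableSet_Ioi, IntegrableOn, hν,
      Measure.restrict_restrict measurableSet_Ioi, inter_comm, hinter r hr.1.le]
    exact (hshift r hr).1
  have hmeasF : AEStronglyMeasurable (Function.uncurry F) (ν.prod ν) := by
    refine AEStronglyMeasurable.mul ?_ (AEStronglyMeasurable.mul ?_ ?_)
    · exact ((measurable_kernel_sub hA.meas t).comp measurable_fst).aestronglyMeasurable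
    · have : (fun p : ℝ × ℝ => (Ioi p.2).indicator (fun s => B (s - p.2)) p.1) =
          {p : ℝ × ℝ | p.2 < p.1}.indicator (fun p => B (p.1 - p.2)) := by
        ext p; simp [indicator]
      exact this ▸ ((hB.meas.comp (measurable_fst.sub measurable_snd)).indicator
        (measurableSet_lt measurable_snd measurable_fst)).aestronglyMeasurable
    · exact hu.aestronglyMeasurable.comp_snd
  have hFr : ∀ r ∈ Ioo 0 t, Integrable (fun s => F s r) ν := by
    intro r hr
    refine (hdomi r hr).mono' ?_ (hdom r hr)
    exact ((measurable_kernel_sub hA.meas t).mul (((hB.meas.comp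
      (measurable_id.sub_const r)).indicator measurableSet_Ioi).mul_const _)).aestronglyMeasurable
  -- The s-integral of the norm is at most a constant times k_{a+b}(t-r)‖u(r)‖. Since a + b ≥ 1 this
  -- kernel is bounded, so integrability of u suffices even when A and B are both singular.
  have hF : Integrable (Function.uncurry F) (ν.prod ν) := by
    rw [integrable_prod_iff' hmeasF]
    refine ⟨(ae_Ioc_mem_Ioo t).mono fun r hr => hFr r hr, ?_⟩
    refine Integrable.mono' (hu.norm.const_mul (powKer (a + b) t * (CA * CB)))
      (AEStronglyMeasurable.integral_prod_right' hmeasF.norm.prod_swap) ?_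
    filter_upwards [ae_Ioc_mem_Ioo t] with r hr
    rw [Real.norm_of_nonneg (integral_nonneg fun _ => norm_nonneg _)]
    calc ∫ s, ‖F s r‖ ∂ν ≤ ∫ s, (Ioi r).indicator
            (fun s => powKer a (t - s) * powKer b (s - r)) s * (CA * CB * ‖u r‖) ∂ν :=
          integral_mono_ae (hFr r hr).norm (hdomi r hr) (hdom r hr)
      _ = powKer (a + b) (t - r) * (CA * CB * ‖u r‖) := by
          rw [integral_mul_const, integral_indicator measurableSet_Ioi, hν,
            Measure.restrict_restrict measurableSet_Ioi, inter_comm, hinter r hr.1.le,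
            (hshift r hr).2]
      _ ≤ powKer (a + b) t * (CA * CB * ‖u r‖) := by
          refine mul_le_mul_of_nonneg_right (powKer_le hab (sub_pos.2 hr.2).le ?_) (by positivity)
          linarith [hr.1]
      _ = _ := by ring
  calc conv A (conv B u) t = ∫ s, ∫ r, F s r ∂ν ∂ν := by
        refine setIntegral_congr_fun measurableSet_Ioc fun s hs => ?_
        simp only [F]
        rw [integral_const_mul]
        congr 1
        have : ∀ r, (Ioi r).indicator (fun s => B (s - r)) s * u r =
            (Iio s).indicator (fun r => B (s - r) * u r) r := fun r => by
          by_cases h : r < s <;> simp [h]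
        simp_rw [this]
        rw [integral_indicator measurableSet_Iio, hν, Measure.restrict_restrict measurableSet_Iio,
          conv, integral_Ioc_eq_integral_Ioo]
        congr 2
        ext r
        simp only [mem_Ioo, mem_inter_iff, mem_Iio, mem_Ioc]
        exact ⟨fun h => ⟨h.2, h.1, h.2.le.trans hs.2⟩, fun h => ⟨h.2.1, h.1⟩⟩
    _ = ∫ r, ∫ s, F s r ∂ν ∂ν := integral_integral_swap hF
    _ = conv AB u t := by
        refine integral_congr_ae ?_
        filter_upwards [ae_Ioc_mem_Ioo t] with r hr
        have : ∀ s, F s r = (Ioi r).indicator (fun s => A (t - s) * B (s - r)) s * u r := fun s => by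
          by_cases h : r < s <;> simp [F, h, mul_assoc]
        simp_rw [this]
        rw [integral_mul_const, integral_indicator measurableSet_Ioi, hν,
          Measure.restrict_restrict measurableSet_Ioi, inter_comm, hinter r hr.1.le,
          ← hAB _ (sub_pos.2 hr.2), conv]
        congr 1
        have h4 := intervalIntegral.integral_comp_sub_right (a := r) (b := t)
          (fun s => A (t - r - s) * B s) r
        rw [sub_self, intervalIntegral.integral_of_le hr.2.le,
          intervalIntegral.integral_of_le (sub_pos.2 hr.2).le] at h4
        rw [← h4]
        congr 1; ext s; congr 2; ring

lemma conv_cPowKer_cPowKer {a b t : ℝ} (ha : 0 < a) (hb : 0 < b) (ht : 0 < t) :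
    conv (cPowKer a) (cPowKer b) t = cPowKer (a + b) t := by
  rw [cPowKer, ← integral_powKer_mul_powKer ha hb ht, ← integral_complex_ofReal, conv]
  simp

/-- Convolution with a kernel bounded near the origin is continuous in time. -/
lemma IsKer.continuousOn_conv {a : ℝ} {K : ℝ → ℂ} (hK : IsKer a K) (ha : 1 ≤ a) {u : ℝ → ℂ}
    (hu : LocInt u) : ContinuousOn (conv K u) (Ioi 0) := by
  intro t ht
  refine ContinuousAt.continuousWithinAt ?_
  obtain ⟨C, hC0, hC⟩ := hK.bound' ha (2 * t)
  have hnhds : ∀ᶠ x in 𝓝 t, x ∈ Ioo 0 (2 * t) :=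
    isOpen_Ioo.mem_nhds ⟨ht, by linarith [mem_Ioi.1 ht]⟩
  -- Writing the integral over a fixed interval with a cut-off at s = x allows dominated convergence
  -- in x.
  have h : ContinuousAt (fun x => ∫ s in Ioc 0 (2 * t),
      (Iio x).indicator (fun s => K (x - s) * u s) s) t := by
    refine continuousAt_of_dominated (bound := fun s => C * ‖u s‖) ?_ ?_
      ((hu (2 * t)).norm.const_mul C) ?_
    · refine Eventually.of_forall fun x => ?_
      exact ((measurable_kernel_sub hK.meas x).aestronglyMeasurable.mul
        (hu (2 * t)).aestronglyMeasurable).indicator measurableSet_Iio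
    · filter_upwards [hnhds] with x hx
      refine (ae_restrict_iff' measurableSet_Ioc).2 (ae_of_all _ fun s hs => ?_)
      by_cases h : s < x
      · rw [indicator_of_mem (mem_Iio.2 h), norm_mul]
        gcongr
        exact hC _ ⟨sub_pos.2 h, by linarith [hx.2, hs.1]⟩
      · rw [indicator_of_notMem (by simpa using h), norm_zero]; positivity
    -- The kernel need not vanish at 0+, so the integrand may jump in x at s = t, but only for that
    -- one s.
    · have : ∀ᵐ s ∂(volume.restrict (Ioc 0 (2 * t))), s ≠ t :=
        ae_restrict_of_ae (Measure.ae_ne volume t)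
      filter_upwards [this] with s hs
      rcases lt_or_gt_of_ne hs with h | h
      · have h1 : ContinuousAt (fun x => K (x - s) * u s) t := by
          refine ContinuousAt.mul ?_ continuousAt_const
          exact ContinuousAt.comp (f := fun x => x - s)
            (hK.cont.continuousAt (Ioi_mem_nhds (sub_pos.2 h))) (by fun_prop)
        refine h1.congr ?_
        filter_upwards [lt_mem_nhds h] with x hx
        rw [indicator_of_mem (mem_Iio.2 hx)]
      · refine (continuousAt_const (y := (0 : ℂ))).congr ?_
        filter_upwards [gt_mem_nhds h] with x hx
        rw [indicator_of_notMem (by simpa using hx.le)]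
  refine h.congr ?_
  filter_upwards [hnhds] with x hx
  rw [integral_indicator measurableSet_Iio, Measure.restrict_restrict measurableSet_Iio, conv,
    integral_Ioc_eq_integral_Ioo]
  congr 2
  ext s
  simp only [mem_Ioo, mem_inter_iff, mem_Iio, mem_Ioc]
  exact ⟨fun h => ⟨h.2.1, h.1⟩, fun h => ⟨h.2, h.1, by linarith [hx.2]⟩⟩

/-- A function continuous and bounded on each `(0, T]` is integrable there. -/
lemma locInt_of_bdd {u : ℝ → ℂ} (hc : ContinuousOn u (Ioi 0))
    (hb : ∀ T, ∃ C, ∀ t ∈ Ioc 0 T, ‖u t‖ ≤ C) : LocInt u := fun T => by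
  obtain ⟨C, hC⟩ := hb T
  refine Integrable.mono' (integrable_const C)
    ((hc.mono fun t ht => ht.1).aestronglyMeasurable measurableSet_Ioc) ?_
  exact (ae_restrict_iff' measurableSet_Ioc).2 (ae_of_all _ hC)

lemma IsKer.locInt_conv {a : ℝ} {K : ℝ → ℂ} (hK : IsKer a K) (ha : 1 ≤ a) {u : ℝ → ℂ}
    (hu : LocInt u) : LocInt (conv K u) := by
  refine locInt_of_bdd (hK.continuousOn_conv ha hu) fun T => ?_
  obtain ⟨C, hC0, hC⟩ := hK.bound' ha T
  refine ⟨∫ s in Ioc 0 T, C * ‖u s‖, fun t ht => ?_⟩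
  calc ‖conv K u t‖ ≤ ∫ s in Ioc 0 t, C * ‖u s‖ := by
        refine norm_integral_le_of_norm_le ((hu t).norm.const_mul C) ?_
        filter_upwards [ae_Ioc_mem_Ioo t] with s hs
        rw [norm_mul]
        gcongr
        exact hC _ ⟨(sub_mem_Ioc hs).1, (sub_mem_Ioc hs).2.trans ht.2⟩
    _ ≤ _ := setIntegral_mono_set ((hu T).norm.const_mul C)
        (ae_of_all _ fun s => by positivity) (Ioc_subset_Ioc_right ht.2).eventuallyLE

/-! Riemann-Liouville integrals as convolutions -/

lemma rlIntegral_zero (u : ℝ → ℂ) (t : ℝ) : rlIntegral 0 u t = u t := by simp [rlIntegral]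

lemma rlIntegral_eq_conv {a t : ℝ} (ha : a ≠ 0) (ht : 0 ≤ t) (u : ℝ → ℂ) :
    rlIntegral a u t = conv (cPowKer a) u t := by
  rw [rlIntegral, if_neg ha, intervalIntegral.integral_of_le ht, conv, ← integral_const_mul]
  congr 1; ext s
  simp only [cPowKer, powKer]
  push_cast; ring

lemma rlIntegral_congr {a t : ℝ} (ht : 0 < t) {u v : ℝ → ℂ} (h : ∀ s ∈ Ioc 0 t, u s = v s) :
    rlIntegral a u t = rlIntegral a v t := by
  by_cases ha : a = 0
  · simp only [ha, rlIntegral_zero, h t ⟨ht, le_rfl⟩]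
  · rw [rlIntegral_eq_conv ha ht.le, rlIntegral_eq_conv ha ht.le, conv_congr h]

lemma rlIntegral_add {a t : ℝ} (ht : 0 < t) {u v : ℝ → ℂ}
    (hu : IntegrableOn (fun s => cPowKer a (t - s) * u s) (Ioc 0 t))
    (hv : IntegrableOn (fun s => cPowKer a (t - s) * v s) (Ioc 0 t)) :
    rlIntegral a (fun s => u s + v s) t = rlIntegral a u t + rlIntegral a v t := by
  by_cases ha : a = 0
  · simp only [ha, rlIntegral_zero]
  · simp only [rlIntegral_eq_conv ha ht.le, conv_add hu hv]

lemma rlIntegral_const_mul (a : ℝ) (u : ℝ → ℂ) (c : ℂ) (t : ℝ) :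
    rlIntegral a (fun s => c * u s) t = c * rlIntegral a u t := by
  by_cases ha : a = 0
  · simp only [ha, rlIntegral_zero]
  · simp only [rlIntegral, if_neg ha]
    simp only [mul_left_comm _ c, intervalIntegral.integral_const_mul]

lemma rlIntegral_mul_const (a : ℝ) (u : ℝ → ℂ) (c : ℂ) (t : ℝ) :
    rlIntegral a (fun s => u s * c) t = rlIntegral a u t * c := by
  simp only [mul_comm _ c, rlIntegral_const_mul]

/-- `I^a e_b = e_{a+b}`. -/
lemma rlIntegral_mlKer {μ a b t : ℝ} (hμ : 1 < μ) (ha : 0 ≤ a) (hb : 0 < b) (c : ℂ) (ht : 0 < t) :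
    rlIntegral a (mlKer μ c b) t = mlKer μ c (a + b) t := by
  rcases ha.eq_or_lt with rfl | ha
  · rw [rlIntegral_zero, zero_add]
  · rw [rlIntegral_eq_conv ha.ne' ht.le, conv_powKer_mlKer hμ ha hb c ht]

/-- `I^a (e_b ⋆ u) = e_{a+b} ⋆ u`. -/
lemma rlIntegral_conv {μ a b t : ℝ} (hμ : 1 < μ) (ha : 0 ≤ a) (hb : 0 < b) (hab : 1 ≤ a + b) (c : ℂ)
    (ht : 0 < t) {u : ℝ → ℂ} (hu : LocInt u) :
    rlIntegral a (conv (mlKer μ c b) u) t = conv (mlKer μ c (a + b)) u t := by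
  rcases ha.eq_or_lt with rfl | ha
  · rw [rlIntegral_zero, zero_add]
  · rw [rlIntegral_eq_conv ha.ne' ht.le]
    exact conv_assoc (isKer_cPowKer ha) (isKer_mlKer hμ hb c) ha hb hab
      (fun s hs => conv_powKer_mlKer hμ ha hb c hs) (hu t)

lemma conv_mlKer_cPowKer {μ a b t : ℝ} (hμ : 1 < μ) (ha : 0 < a) (hb : 0 < b) (c : ℂ) (ht : 0 < t) :
    conv (mlKer μ c b) (cPowKer a) t = mlKer μ c (b + a) t := by
  rw [conv_comm ht.le, conv_powKer_mlKer hμ ha hb c ht, add_comm]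

/-- `e_b ⋆ I^a u = e_{b+a} ⋆ u`. -/
lemma conv_mlKer_rlIntegral {μ a b t : ℝ} (hμ : 1 < μ) (ha : 0 ≤ a) (hb : 0 < b) (hab : 1 ≤ b + a)
    (c : ℂ) {u : ℝ → ℂ} (hu : LocInt u) :
    conv (mlKer μ c b) (rlIntegral a u) t = conv (mlKer μ c (b + a)) u t := by
  rcases ha.eq_or_lt with rfl | ha
  · rw [add_zero]
    exact conv_congr fun s _ => rlIntegral_zero u s
  · rw [conv_congr fun s hs => rlIntegral_eq_conv ha.ne' hs.1.le u]
    exact conv_assoc (isKer_mlKer hμ hb c) (isKer_cPowKer ha) hb ha hab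
      (fun s hs => conv_mlKer_cPowKer hμ ha hb c hs) (hu t)

lemma conv_mlKer_conv_cPowKer {μ a b t : ℝ} (hμ : 1 < μ) (ha : 0 < a) (hb : 0 < b)
    (hab : 1 ≤ b + a) (c : ℂ) {u : ℝ → ℂ} (hu : LocInt u) :
    conv (mlKer μ c b) (conv (cPowKer a) u) t = conv (mlKer μ c (b + a)) u t :=
  conv_assoc (isKer_mlKer hμ hb c) (isKer_cPowKer ha) hb ha hab
      (fun _ hs => conv_mlKer_cPowKer hμ ha hb c hs) (hu t)

/-- `k_b ⋆ I^a u = k_{b+a} ⋆ u`. -/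
lemma conv_cPowKer_rlIntegral {a b t : ℝ} (ha : 0 ≤ a) (hb : 0 < b) (hab : 1 ≤ b + a)
    {u : ℝ → ℂ} (hu : LocInt u) :
    conv (cPowKer b) (rlIntegral a u) t = conv (cPowKer (b + a)) u t := by
  rcases ha.eq_or_lt with rfl | ha
  · rw [add_zero]
    exact conv_congr fun s _ => rlIntegral_zero u s
  · rw [conv_congr fun s hs => rlIntegral_eq_conv ha.ne' hs.1.le u]
    exact conv_assoc (isKer_cPowKer hb) (isKer_cPowKer ha) hb ha hab
      (fun s hs => conv_cPowKer_cPowKer hb ha hs) (hu t)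

lemma conv_cPowKer_conv {a b t : ℝ} (ha : 0 < a) (hb : 0 < b) (hab : 1 ≤ b + a)
    {u : ℝ → ℂ} (hu : LocInt u) :
    conv (cPowKer b) (conv (cPowKer a) u) t = conv (cPowKer (b + a)) u t :=
  conv_assoc (isKer_cPowKer hb) (isKer_cPowKer ha) hb ha hab
    (fun _ hs => conv_cPowKer_cPowKer hb ha hs) (hu t)

lemma conv_one_eq (u : ℝ → ℂ) {t : ℝ} (ht : 0 ≤ t) :
    conv (cPowKer 1) u t = ∫ s in (0 : ℝ)..t, u s := by
  rw [intervalIntegral.integral_of_le ht, conv]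
  simp only [cPowKer, powKer_one, Complex.ofReal_one, one_mul]

lemma LocInt.intervalIntegrable {u : ℝ → ℂ} (hu : LocInt u) {t : ℝ} (ht : 0 ≤ t) :
    IntervalIntegrable u volume 0 t :=
  (intervalIntegrable_iff_integrableOn_Ioc_of_le ht).2 (hu t)

lemma LocInt.add {u v : ℝ → ℂ} (hu : LocInt u) (hv : LocInt v) : LocInt fun s => u s + v s :=
  fun T => (hu T).add (hv T)

lemma LocInt.const_mul {u : ℝ → ℂ} (hu : LocInt u) (c : ℂ) : LocInt fun s => c * u s :=
  fun T => (hu T).const_mul c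

/-- The primitive of an integrable function is continuous up to 0 and vanishes there. Both initial
values of the closed form come from this. -/
lemma tendsto_conv_one {u : ℝ → ℂ} (hu : LocInt u) :
    Tendsto (conv (cPowKer 1) u) (𝓝[>] 0) (𝓝 0) := by
  have h1 : IntegrableOn u (uIcc 0 1) := by
    rw [uIcc_of_le zero_le_one, integrableOn_Icc_iff_integrableOn_Ioc]; exact hu 1
  have h2 := intervalIntegral.continuousOn_primitive_interval h1
  have h3 := (h2 0 left_mem_uIcc).tendsto
  rw [intervalIntegral.integral_same, uIcc_of_le zero_le_one] at h3
  have h4 : 𝓝[>] (0 : ℝ) ≤ 𝓝[Icc 0 1] 0 := by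
    rw [← nhdsWithin_Ioc_eq_nhdsGT zero_lt_one]
    exact nhdsWithin_mono _ Ioc_subset_Icc_self
  refine (h3.mono_left h4).congr' ?_
  filter_upwards [self_mem_nhdsWithin] with t ht
  rw [conv_one_eq u (le_of_lt ht)]

lemma hasDerivAt_conv_one {u : ℝ → ℂ} (hu : LocInt u) (hc : ContinuousOn u (Ioi 0)) {t : ℝ}
    (ht : 0 < t) : HasDerivAt (conv (cPowKer 1) u) (u t) t := by
  have h := intervalIntegral.integral_hasDerivAt_right (hu.intervalIntegrable ht.le)
    (hc.stronglyMeasurableAtFilter isOpen_Ioi t ht) (hc.continuousAt (Ioi_mem_nhds ht))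
  refine h.congr_of_eventuallyEq ?_
  filter_upwards [Ioi_mem_nhds ht] with s hs
  exact conv_one_eq u (le_of_lt hs)

lemma conv_two_eq {u : ℝ → ℂ} (hu : LocInt u) (t : ℝ) :
    conv (cPowKer 2) u t = conv (cPowKer 1) (conv (cPowKer 1) u) t := by
  rw [conv_cPowKer_conv one_pos one_pos (by norm_num) hu]; norm_num

/-- Taylor's formula with data prescribed at `0+`. -/
lemma eq_add_conv_of_contDiffOn {w : ℝ → ℂ} {a b : ℂ} (hw : ContDiffOn ℝ 2 w (Ioi 0))
    (h0 : Tendsto w (𝓝[>] 0) (𝓝 a)) (h1 : Tendsto (deriv w) (𝓝[>] 0) (𝓝 b))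
    (hi : LocInt (iteratedDeriv 2 w)) {t : ℝ} (ht : 0 < t) :
    w t = a + t * b + conv (cPowKer 2) (iteratedDeriv 2 w) t := by
  have hd1 : ∀ s, 0 < s → HasDerivAt w (deriv w s) s := fun s hs =>
    ((hw.differentiableOn (by norm_num)).differentiableAt (Ioi_mem_nhds hs)).hasDerivAt
  have hw' : ContDiffOn ℝ 1 (deriv w) (Ioi 0) :=
    ((contDiffOn_succ_iff_deriv_of_isOpen (n := 1) isOpen_Ioi).1 hw).2.2
  have hd2 : ∀ s, 0 < s → HasDerivAt (deriv w) (iteratedDeriv 2 w s) s := fun s hs => by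
    rw [iteratedDeriv_succ, iteratedDeriv_one]
    exact ((hw'.differentiableOn (by norm_num)).differentiableAt (Ioi_mem_nhds hs)).hasDerivAt
  have hder : ∀ s, 0 < s → deriv w s = b + conv (cPowKer 1) (iteratedDeriv 2 w) s := fun s hs => by
    have := intervalIntegral.integral_eq_sub_of_hasDerivAt_of_tendsto hs
      (fun x hx => hd2 x hx.1) (hi.intervalIntegrable hs.le) h1
      ((hd2 s hs).continuousAt.tendsto.mono_left nhdsWithin_le_nhds)
    rw [conv_one_eq _ hs.le, this]; ring
  have hc1 := (isKer_cPowKer one_pos).locInt_conv le_rfl hi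
  -- Integrability of w' is not assumed; it follows from the formula for w' just obtained, whose
  -- convolution term is locally integrable.
  have hli : LocInt (deriv w) := fun T =>
    ((integrable_const b).add (hc1 T)).congr
      ((ae_restrict_iff' measurableSet_Ioc).2 (ae_of_all _ fun s hs => (hder s hs.1).symm))
  have := intervalIntegral.integral_eq_sub_of_hasDerivAt_of_tendsto ht
      (fun x hx => hd1 x hx.1) (hli.intervalIntegrable ht.le) h0
      ((hd1 t ht).continuousAt.tendsto.mono_left nhdsWithin_le_nhds)
  rw [← conv_one_eq _ ht.le, conv_congr fun s hs => hder s hs.1, conv_add, ← conv_two_eq hi] at this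
  · rw [conv_one_eq _ ht.le] at this
    simp only [intervalIntegral.integral_const, sub_zero, Complex.real_smul] at this
    linear_combination -this
  · exact (isKer_cPowKer one_pos).integrableOn le_rfl (integrable_const b)
  · exact (isKer_cPowKer one_pos).integrableOn le_rfl (hc1 t)

/-- Conversely, `a + t b + k₂ ⋆ p` is twice continuously differentiable. -/
lemma contDiffOn_of_eq_add_conv {w p : ℝ → ℂ} {a b : ℂ} (hp : LocInt p)
    (hc : ContinuousOn p (Ioi 0)) (hw : ∀ t, 0 < t → w t = a + t * b + conv (cPowKer 2) p t) :
    ContDiffOn ℝ 2 w (Ioi 0) ∧ (∀ t, 0 < t → iteratedDeriv 2 w t = p t) ∧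
      Tendsto w (𝓝[>] 0) (𝓝 a) ∧ Tendsto (deriv w) (𝓝[>] 0) (𝓝 b) := by
  have hk := isKer_cPowKer one_pos
  have hq := hk.locInt_conv le_rfl hp
  have hqc := hk.continuousOn_conv le_rfl hp
  have hd1 : ∀ t, 0 < t → HasDerivAt w (b + conv (cPowKer 1) p t) t := fun t ht => by
    have h1 := ((hasDerivAt_id t).ofReal_comp.mul_const b).const_add a
    have h2 := h1.add (hasDerivAt_conv_one hq hqc ht)
    refine (h2.congr_of_eventuallyEq ?_).congr_deriv (by simp)
    filter_upwards [Ioi_mem_nhds ht] with s hs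
    rw [hw s hs, conv_two_eq hp]; simp
  have he1 : ∀ t, 0 < t → deriv w t = b + conv (cPowKer 1) p t := fun t ht => (hd1 t ht).deriv
  have hd2 : ∀ t, 0 < t → HasDerivAt (deriv w) (p t) t := fun t ht => by
    refine ((hasDerivAt_conv_one hp hc ht).const_add b).congr_of_eventuallyEq ?_
    filter_upwards [Ioi_mem_nhds ht] with s hs using he1 s hs
  have he2 : ∀ t, 0 < t → deriv (deriv w) t = p t := fun t ht => (hd2 t ht).deriv
  refine ⟨?_, fun t ht => ?_, ?_, ?_⟩
  · refine (contDiffOn_succ_iff_deriv_of_isOpen (n := 1) isOpen_Ioi).2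
      ⟨fun t ht => (hd1 t ht).differentiableAt.differentiableWithinAt, by simp, ?_⟩
    refine (contDiffOn_succ_iff_deriv_of_isOpen (n := 0) isOpen_Ioi).2
      ⟨fun t ht => (hd2 t ht).differentiableAt.differentiableWithinAt, by simp, ?_⟩
    exact contDiffOn_zero.2 (hc.congr he2)
  · rw [iteratedDeriv_succ, iteratedDeriv_one, he2 t ht]
  · have h1 : Tendsto (fun t : ℝ => a + t * b + conv (cPowKer 1) (conv (cPowKer 1) p) t)
        (𝓝[>] 0) (𝓝 (a + (0 : ℝ) * b + 0)) := by
      refine Tendsto.add (Tendsto.mono_left ?_ nhdsWithin_le_nhds) (tendsto_conv_one hq)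
      exact ((by fun_prop : Continuous fun t : ℝ => a + t * b)).tendsto 0
    simp only [Complex.ofReal_zero, zero_mul, add_zero] at h1
    refine h1.congr' ?_
    filter_upwards [self_mem_nhdsWithin] with t ht
    rw [hw t ht, conv_two_eq hp]
  · have h1 := (tendsto_conv_one hp).const_add b
    rw [add_zero] at h1
    refine h1.congr' ?_
    filter_upwards [self_mem_nhdsWithin] with t ht
    rw [he1 t ht]

/-- `k₂ ⋆ u` determines the continuous function `u`. -/
lemma eq_zero_of_conv_two_eq_zero {u : ℝ → ℂ} (hu : LocInt u) (hc : ContinuousOn u (Ioi 0))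
    (h : ∀ t, 0 < t → conv (cPowKer 2) u t = 0) {t : ℝ} (ht : 0 < t) : u t = 0 := by
  -- The zero function has the form 0 + t·0 + k₂ ⋆ u, so u is its second derivative.
  have := (contDiffOn_of_eq_add_conv (w := fun _ => 0) (a := 0) (b := 0) hu hc
    (fun t ht => by rw [h t ht]; simp)).2.1 t ht
  rw [← this]; simp

/-! The fractional oscillator equation satisfied by each Fourier mode -/

/-- The closed form of a Fourier mode with frequency parameter `c`, data `F`, `G` and source `p`. -/
def modeSol (μ β : ℝ) (c F G : ℂ) (p : ℝ → ℂ) (t : ℝ) : ℂ :=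
  mlKer μ c (1 - β) t * F + mlKer μ c (2 - β) t * G + conv (mlKer μ c μ) p t

/-- The second time derivative of the fractional integral of a Fourier mode whose source is a
fractional integral of `ρ`. -/
def modeAccel (μ : ℝ) (c F G : ℂ) (ρ : ℝ → ℂ) (t : ℝ) : ℂ :=
  -c * (mlKer μ c (μ - 1) t * F) + -c * (mlKer μ c μ t * G) + ρ t
    + -c * conv (mlKer μ c μ) ρ t

section

variable {μ β γ : ℝ} {c F G : ℂ} {p ρ : ℝ → ℂ}

lemma LocInt.mul_const {u : ℝ → ℂ} (hu : LocInt u) (c : ℂ) : LocInt fun s => u s * c :=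
  fun T => (hu T).mul_const c

lemma continuousOn_modeSol (hμ : 1 < μ) (hβ : β < 1) (hp : LocInt p) :
    ContinuousOn (modeSol μ β c F G p) (Ioi 0) :=
  (((continuousOn_mlKer hμ (by linarith) c).mul continuousOn_const).add
    ((continuousOn_mlKer hμ (by linarith) c).mul continuousOn_const)).add
    ((isKer_mlKer hμ (by linarith) c).continuousOn_conv hμ.le hp)

/-- A bounded continuous function on `(0, t]` can be convolved with any kernel. -/
lemma IsKer.integrableOn_conv {a b t : ℝ} {K L u : ℝ → ℂ} (hK : IsKer a K) (ha : 0 < a)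
    (hL : IsKer b L) (hb : 1 ≤ b) (hu : LocInt u) (ht : 0 < t) :
    IntegrableOn (fun s => K (t - s) * conv L u s) (Ioc 0 t) := by
  have hli := hL.locInt_conv hb hu
  have hc := hL.continuousOn_conv hb hu
  exact hK.integrableOn_of_le (hli t).aestronglyMeasurable (integrableOn_powKer_sub_mul ha ht
    (hc.norm.mono fun s hs => hs.1) (hli t).norm) fun s _ => le_rfl

lemma integrableOn_cPowKer_mul_mlKer {a b t : ℝ} (hμ : 1 < μ) (ha : 0 < a) (hb : 0 < b) (ht : 0 < t)
    (x : ℂ) : IntegrableOn (fun s => cPowKer a (t - s) * (mlKer μ c b s * x)) (Ioc 0 t) := by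
  have := ((isKer_cPowKer ha).integrableOn_mul (isKer_mlKer hμ hb c) ha hb ht).mul_const x
  exact IntegrableOn.congr_fun this (fun s _ => by ring) measurableSet_Ioc

lemma rlIntegral_modeSol {a t : ℝ} (hμ : 1 < μ) (hβ : β < 1) (ha : 0 ≤ a) (hp : LocInt p)
    (ht : 0 < t) : rlIntegral a (modeSol μ β c F G p) t =
      mlKer μ c (a + (1 - β)) t * F + mlKer μ c (a + (2 - β)) t * G
        + conv (mlKer μ c (a + μ)) p t := by
  rcases ha.eq_or_lt with rfl | ha
  · simp only [rlIntegral_zero, modeSol, zero_add]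
  have h1 := integrableOn_cPowKer_mul_mlKer (c := c) hμ ha (show 0 < 1 - β by linarith) ht F
  have h2 := integrableOn_cPowKer_mul_mlKer (c := c) hμ ha (show 0 < 2 - β by linarith) ht G
  have h3 := (isKer_cPowKer ha).integrableOn_conv ha (isKer_mlKer hμ (by linarith) c) hμ.le hp ht
  unfold modeSol
  rw [rlIntegral_add ht _ h3, rlIntegral_add ht h1 h2, rlIntegral_mul_const, rlIntegral_mul_const,
    rlIntegral_mlKer hμ ha.le (by linarith) c ht, rlIntegral_mlKer hμ ha.le (by linarith) c ht,
    rlIntegral_conv hμ ha.le (by linarith) (by linarith) c ht hp]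
  exact (h1.add h2).congr (ae_of_all _ fun s => by simp only [Pi.add_apply, mul_add])

lemma conv_mlKer_eq_sub (hμ : 1 < μ) {b t : ℝ} (hb : 1 ≤ b) (hp : LocInt p) :
    conv (mlKer μ c b) p t = conv (cPowKer b) p t - c * conv (mlKer μ c (b + μ)) p t := by
  have h1 := (isKer_cPowKer (show 0 < b by linarith)).integrableOn hb (hp t)
  have h2 := (isKer_mlKer hμ (show 0 < b + μ by linarith) c).integrableOn (by linarith) (hp t)
  rw [conv_congr_kernel fun s hs => mlKer_eq_powKer_sub hμ (by linarith) c hs.1]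
  simp only [conv]
  rw [← integral_const_mul, ← integral_sub h1 (h2.const_mul c)]
  congr 1; ext s; ring

/-- Uniqueness for the integrated Volterra equation of a Fourier mode. -/
lemma conv_two_eq_of_volterra (hμ : 1 < μ) (hβ : β < 1) {y : ℝ → ℂ} (hy : LocInt y)
    (hp : LocInt p)
    (h : ∀ t, 0 < t → conv (cPowKer 1) y t = cPowKer (2 - β) t * F + cPowKer (3 - β) t * G
      + conv (cPowKer (μ + 1)) (fun s => -c * y s + p s) t) {t : ℝ} (ht : 0 < t) :
    conv (cPowKer 2) y t = conv (cPowKer 2) (modeSol μ β c F G p) t := by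
  have he := isKer_mlKer hμ one_pos c
  have hyp : LocInt fun s => -c * y s + p s := (hy.const_mul _).add hp
  have i1 : IntegrableOn (fun s => mlKer μ c 1 (t - s) * (cPowKer (2 - β) s * F)) (Ioc 0 t) :=
    he.integrableOn le_rfl ((((isKer_cPowKer (by linarith)).locInt (by linarith)).mul_const F) t)
  have i2 : IntegrableOn (fun s => mlKer μ c 1 (t - s) * (cPowKer (3 - β) s * G)) (Ioc 0 t) :=
    he.integrableOn le_rfl ((((isKer_cPowKer (by linarith)).locInt (by linarith)).mul_const G) t)
  have i3 : IntegrableOn (fun s => mlKer μ c 1 (t - s) *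
      conv (cPowKer (μ + 1)) (fun s => -c * y s + p s) s) (Ioc 0 t) :=
    he.integrableOn le_rfl
      (((isKer_cPowKer (by linarith)).locInt_conv (by linarith) hyp) t)
  have i12 : IntegrableOn (fun s => mlKer μ c 1 (t - s) *
      (cPowKer (2 - β) s * F + cPowKer (3 - β) s * G)) (Ioc 0 t) :=
    (i1.add i2).congr (ae_of_all _ fun s => by simp only [Pi.add_apply, mul_add])
  -- Both sides of the Volterra equation are convolved with e₁. The left becomes e₂ ⋆ y = k₂ ⋆ y - c
  -- e_{μ+2} ⋆ y, and its second term cancels the unknown on the right; what remains is k₂ ⋆ y =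
  -- e_{3-β}F + e_{4-β}G + e_{μ+2} ⋆ p, the double integral of the mode.
  have key : conv (mlKer μ c 1) (conv (cPowKer 1) y) t = mlKer μ c (3 - β) t * F +
      mlKer μ c (4 - β) t * G + conv (mlKer μ c (μ + 2)) (fun s => -c * y s + p s) t := by
    rw [conv_congr fun s hs => h s hs.1, conv_add i12 i3, conv_add i1 i2, conv_mul_const,
      conv_mul_const, conv_mlKer_cPowKer hμ (by linarith) one_pos c ht,
      conv_mlKer_cPowKer hμ (by linarith) one_pos c ht,
      conv_mlKer_conv_cPowKer hμ (by linarith) one_pos (by linarith) c hyp]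
    ring_nf
  have hker := isKer_mlKer hμ (show 0 < μ + 2 by linarith) c
  rw [conv_mlKer_conv_cPowKer hμ one_pos one_pos (by norm_num) c hy, conv_add
    (hker.integrableOn (by linarith) ((hy.const_mul (-c)) t))
    (hker.integrableOn (by linarith) (hp t)), conv_const_mul,
    conv_mlKer_eq_sub hμ (by norm_num) hy, show (1 : ℝ) + 1 = 2 by norm_num,
    add_comm (2 : ℝ) μ] at key
  rw [← rlIntegral_eq_conv two_ne_zero ht.le (modeSol μ β c F G p),
    rlIntegral_modeSol hμ hβ zero_le_two hp ht, show (2 : ℝ) + (1 - β) = 3 - β by ring,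
    show (2 : ℝ) + (2 - β) = 4 - β by ring, add_comm (2 : ℝ) μ]
  linear_combination key

lemma continuousOn_modeAccel (hμ : 1 < μ) (hρ : LocInt ρ) (hc : ContinuousOn ρ (Ioi 0)) :
    ContinuousOn (modeAccel μ c F G ρ) (Ioi 0) :=
  (((continuousOn_const.mul ((continuousOn_mlKer hμ (by linarith) c).mul continuousOn_const)).add
    (continuousOn_const.mul ((continuousOn_mlKer hμ (by linarith) c).mul continuousOn_const))).add
    hc).add (continuousOn_const.mul
      ((isKer_mlKer hμ (by linarith) c).continuousOn_conv hμ.le hρ))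

/-- Fractional integrals of `modeAccel`. -/
lemma rlIntegral_modeAccel {a t : ℝ} (hμ : 1 < μ) (ha : 0 ≤ a) (hρ : LocInt ρ)
    (hc : ContinuousOn ρ (Ioi 0)) (ht : 0 < t) :
    rlIntegral a (modeAccel μ c F G ρ) t =
      -c * (mlKer μ c (a + (μ - 1)) t * F) + -c * (mlKer μ c (a + μ) t * G) + rlIntegral a ρ t
        + -c * conv (mlKer μ c (a + μ)) ρ t := by
  rcases ha.eq_or_lt with rfl | ha
  · simp only [rlIntegral_zero, modeAccel, zero_add]
  have hk := isKer_cPowKer ha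
  have h1 : IntegrableOn (fun s => cPowKer a (t - s) * (-c * (mlKer μ c (μ - 1) s * F)))
      (Ioc 0 t) := IntegrableOn.congr_fun
    ((integrableOn_cPowKer_mul_mlKer (c := c) hμ ha (show 0 < μ - 1 by linarith) ht F).const_mul (-c))
    (fun s _ => by ring) measurableSet_Ioc
  have h2 : IntegrableOn (fun s => cPowKer a (t - s) * (-c * (mlKer μ c μ s * G)))
      (Ioc 0 t) := IntegrableOn.congr_fun
    ((integrableOn_cPowKer_mul_mlKer (c := c) hμ ha (show 0 < μ by linarith) ht G).const_mul (-c))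
    (fun s _ => by ring) measurableSet_Ioc
  have h3 : IntegrableOn (fun s => cPowKer a (t - s) * ρ s) (Ioc 0 t) :=
    hk.integrableOn_of_le (hρ t).aestronglyMeasurable (integrableOn_powKer_sub_mul ha ht
      (hc.norm.mono fun s hs => hs.1) (hρ t).norm) fun s _ => le_rfl
  have h4 : IntegrableOn (fun s => cPowKer a (t - s) * (-c * conv (mlKer μ c μ) ρ s)) (Ioc 0 t) :=
    IntegrableOn.congr_fun
    ((hk.integrableOn_conv ha (isKer_mlKer hμ (by linarith) c) hμ.le hρ ht).const_mul (-c))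
    (fun s _ => by ring) measurableSet_Ioc
  have h12 : IntegrableOn (fun s => cPowKer a (t - s) * (-c * (mlKer μ c (μ - 1) s * F) +
      -c * (mlKer μ c μ s * G))) (Ioc 0 t) :=
    (h1.add h2).congr (ae_of_all _ fun s => by simp only [Pi.add_apply, mul_add])
  have h123 : IntegrableOn (fun s => cPowKer a (t - s) * (-c * (mlKer μ c (μ - 1) s * F) +
      -c * (mlKer μ c μ s * G) + ρ s)) (Ioc 0 t) :=
    (h12.add h3).congr (ae_of_all _ fun s => by simp only [Pi.add_apply, mul_add])
  unfold modeAccel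
  rw [rlIntegral_add ht h123 h4, rlIntegral_add ht h12 h3, rlIntegral_add ht h1 h2,
    rlIntegral_const_mul, rlIntegral_const_mul, rlIntegral_const_mul, rlIntegral_mul_const,
    rlIntegral_mul_const,
    rlIntegral_mlKer hμ ha.le (by linarith) c ht, rlIntegral_mlKer hμ ha.le (by linarith) c ht,
    rlIntegral_conv hμ ha.le (by linarith) (by linarith) c ht hρ]

lemma conv_source_eq (hμ : 1 < μ) (hγ : 0 ≤ γ) (hρ : LocInt ρ)
    (hp : ∀ t, 0 < t → p t = rlIntegral γ ρ t) {t b : ℝ} (hb : 1 ≤ b) :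
    conv (mlKer μ c b) p t = conv (mlKer μ c (b + γ)) ρ t := by
  rw [conv_congr fun s hs => hp s hs.1,
    conv_mlKer_rlIntegral hμ hγ (by linarith) (by linarith) c hρ]

lemma mlKer_shift (hμ : 1 < μ) {a b t : ℝ} (hb : 0 < b) (hab : a = b + μ) (ht : 0 < t) :
    -c * mlKer μ c a t = mlKer μ c b t - cPowKer b t := by
  rw [mlKer_eq_powKer_sub hμ hb c ht, hab]; ring

lemma conv_mlKer_shift (hμ : 1 < μ) {a b t : ℝ} (hb : 1 ≤ b) (hab : a = b + μ) (hρ : LocInt ρ) :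
    -c * conv (mlKer μ c a) ρ t = conv (mlKer μ c b) ρ t - conv (cPowKer b) ρ t := by
  rw [conv_mlKer_eq_sub hμ hb hρ, hab]; ring

/-- The mode recovered from its acceleration. -/
lemma modeSol_eq_add_conv (hμ : 1 < μ) (hβ : β < 1) (hγ : 0 ≤ γ)
    (hsum : β + γ = 2 - μ) (hρ : LocInt ρ) (hc : ContinuousOn ρ (Ioi 0))
    (hp : ∀ t, 0 < t → p t = rlIntegral γ ρ t) {t : ℝ} (ht : 0 < t) :
    modeSol μ β c F G p t = cPowKer (1 - β) t * F + cPowKer (2 - β) t * G +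
      conv (cPowKer (2 - β)) (modeAccel μ c F G ρ) t := by
  rw [← rlIntegral_eq_conv (by linarith) ht.le,
    rlIntegral_modeAccel hμ (by linarith) hρ hc ht, rlIntegral_eq_conv (by linarith) ht.le, modeSol,
    conv_source_eq hμ hγ hρ hp hμ.le, show μ + γ = 2 - β by linarith,
    conv_mlKer_shift hμ (show (1 : ℝ) ≤ 2 - β by linarith) (by ring) hρ]
  have h1 := mlKer_shift (c := c) (μ := μ) hμ (show (0 : ℝ) < 1 - β by linarith)
    (show 2 - β + (μ - 1) = 1 - β + μ by ring) ht
  have h2 := mlKer_shift (c := c) (μ := μ) hμ (show (0 : ℝ) < 2 - β by linarith)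
    (show 2 - β + μ = 2 - β + μ by ring) ht
  linear_combination -F * h1 - G * h2

/-- The fractional integral of a mode is `F + t G` plus the double integral of `modeAccel`. -/
lemma rlIntegral_modeSol_eq (hμ : 1 < μ) (hβ0 : 0 ≤ β) (hβ : β < 1) (hγ : 0 ≤ γ)
    (hsum : β + γ = 2 - μ) (hρ : LocInt ρ) (hc : ContinuousOn ρ (Ioi 0)) (hp' : LocInt p)
    (hp : ∀ t, 0 < t → p t = rlIntegral γ ρ t) {t : ℝ} (ht : 0 < t) :
    rlIntegral β (modeSol μ β c F G p) t = F + t * G +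
      conv (cPowKer 2) (modeAccel μ c F G ρ) t := by
  rw [rlIntegral_modeSol hμ hβ hβ0 hp' ht, conv_source_eq hμ hγ hρ hp (by linarith),
    ← rlIntegral_eq_conv two_ne_zero ht.le, rlIntegral_modeAccel hμ zero_le_two hρ hc ht,
    rlIntegral_eq_conv two_ne_zero ht.le, show β + μ + γ = 2 by linarith,
    show β + (1 - β) = 1 by ring, show β + (2 - β) = 2 by ring,
    conv_mlKer_shift hμ one_le_two rfl hρ]
  -- The recursion strips the leading power from e₁ and e₂; those powers k₁ = 1 and k₂ = t carry the
  -- two initial values.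
  have h1 := mlKer_shift (c := c) (μ := μ) hμ one_pos (show 2 + (μ - 1) = 1 + μ by ring) ht
  have h2 := mlKer_shift (c := c) (μ := μ) hμ two_pos (show 2 + μ = 2 + μ by ring) ht
  simp only [cPowKer, powKer_one, powKer_two, Complex.ofReal_one] at h1 h2
  linear_combination -F * h1 - G * h2

/-- The Hilfer equation for a single mode. -/
lemma rlIntegral_modeAccel_eq (hμ : 1 < μ) (hγ : 0 ≤ γ)
    (hsum : β + γ = 2 - μ) (hρ : LocInt ρ) (hc : ContinuousOn ρ (Ioi 0))
    (hp : ∀ t, 0 < t → p t = rlIntegral γ ρ t) {t : ℝ} (ht : 0 < t) :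
    rlIntegral γ (modeAccel μ c F G ρ) t = -c * modeSol μ β c F G p t + p t := by
  rw [rlIntegral_modeAccel hμ hγ hρ hc ht, modeSol, conv_source_eq hμ hγ hρ hp hμ.le, ← hp t ht,
    show γ + (μ - 1) = 1 - β by linarith, show γ + μ = 2 - β by linarith,
    show μ + γ = 2 - β by linarith]
  ring

/-- `e_μ` is dominated by `e_1`. -/
lemma norm_mlKer_mul_le (hμ : 1 < μ) {T M : ℝ} {x : ℂ}
    (h : ∀ s ∈ Ioc 0 T, ‖mlKer μ c 1 s * x‖ ≤ M) {t : ℝ} (ht : t ∈ Ioc 0 T) :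
    ‖mlKer μ c μ t * x‖ ≤ M * powKer μ T := by
  have hM : 0 ≤ M := (norm_nonneg _).trans (h t ht)
  -- Here e_μ = k_{μ-1} ⋆ e₁, and k_{μ-1} has mass k_μ(t) ≤ k_μ(T) on (0,t), so a bound on e₁x
  -- passes to e_μx.
  have h1 := conv_powKer_mlKer hμ (show 0 < μ - 1 by linarith) one_pos c ht.1
  rw [sub_add_cancel] at h1
  rw [← h1, ← conv_mul_const]
  refine (norm_conv_le (v := fun _ => M) (by linarith)
    ((integrableOn_powKer_sub (by linarith) t).mul_const M)
    fun s hs => h s ⟨hs.1, hs.2.trans ht.2⟩).trans ?_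
  rw [integral_mul_const, mul_comm]
  refine mul_le_mul_of_nonneg_left ?_ hM
  have h2 := integral_powKer_mul_powKer (show 0 < μ - 1 by linarith) one_pos ht.1
  simp only [powKer_one, mul_one, sub_add_cancel] at h2
  rw [h2]
  exact powKer_le hμ.le ht.1.le ht.2

lemma mlKer_one (t : ℝ) : mlKer μ c 1 t = mittagLeffler μ 1 (-((t ^ μ : ℝ) : ℂ) * c) := by
  simp [mlKer]

lemma norm_mlKer_eq {b t : ℝ} (hb : 0 < b) (ht : 0 < t) :
    ‖mlKer μ c b t‖ =
      Real.Gamma b * powKer b t * ‖mittagLeffler μ b (-((t ^ μ : ℝ) : ℂ) * c)‖ := by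
  rw [mlKer, norm_mul, Complex.norm_real, Real.norm_of_nonneg (Real.rpow_nonneg ht.le _), powKer]
  have := (Real.Gamma_pos_of_pos hb).ne'
  field_simp

/-- The four terms are treated separately: the one with F is bounded directly through E_{μ,μ-1},
while those with G and with the convolution only involve e_μ and are reduced to E_{μ,1} by
`norm_mlKer_mul_le`. In the convolution, the bound must hold for the kernel time and the source time
independently, hence the two variables t and s in the hypothesis on ρ. -/
lemma norm_modeAccel_le (hμ : 1 < μ) {T g : ℝ} {b : ℝ → ℝ} (hb : IntegrableOn b (Ioc 0 T))
    (hF : ∀ t ∈ Ioc 0 T, ‖c * (mittagLeffler μ (μ - 1) (-((t ^ μ : ℝ) : ℂ) * c) * F)‖ ≤ g)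
    (hG : ∀ t ∈ Ioc 0 T, ‖c * (mittagLeffler μ 1 (-((t ^ μ : ℝ) : ℂ) * c) * G)‖ ≤ g)
    (hρ : ∀ t ∈ Ioc 0 T, ∀ s ∈ Ioc 0 T,
      ‖c * (mittagLeffler μ 1 (-((t ^ μ : ℝ) : ℂ) * c) * ρ s)‖ ≤ g * b s)
    (hρ0 : ∀ s ∈ Ioc 0 T, ‖ρ s‖ ≤ g * b s) {t : ℝ} (ht : t ∈ Ioc 0 T) :
    ‖modeAccel μ c F G ρ t‖ ≤ g * (Real.Gamma (μ - 1) * powKer (μ - 1) t + powKer μ T + b t +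
      powKer μ T * ∫ s in Ioc 0 T, b s) := by
  have hT : 0 ≤ powKer μ T := powKer_nonneg (by linarith) (ht.1.le.trans ht.2)
  have h1 : ‖-c * (mlKer μ c (μ - 1) t * F)‖ ≤ g * (Real.Gamma (μ - 1) * powKer (μ - 1) t) := by
    have h0 : 0 ≤ Real.Gamma (μ - 1) * powKer (μ - 1) t :=
      mul_nonneg (Real.Gamma_pos_of_pos (by linarith)).le (powKer_nonneg (by linarith) ht.1.le)
    have := hF t ht
    rw [norm_mul, norm_mul] at this
    rw [norm_mul, norm_neg, norm_mul, norm_mlKer_eq (by linarith) ht.1]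
    nlinarith
  have h2 : ‖-c * (mlKer μ c μ t * G)‖ ≤ g * powKer μ T := by
    have := norm_mlKer_mul_le (x := c * G) hμ (fun s hs => by
      rw [mlKer_one, mul_left_comm]; exact hG s hs) ht
    rwa [neg_mul, norm_neg, mul_left_comm]
  have h4 : ‖-c * conv (mlKer μ c μ) ρ t‖ ≤ g * (powKer μ T * ∫ s in Ioc 0 T, b s) := by
    have hgb : ∀ s ∈ Ioc 0 T, 0 ≤ g * b s := fun s hs => (norm_nonneg _).trans (hρ0 s hs)
    have hi : IntegrableOn (fun s => g * b s * powKer μ T) (Ioc 0 T) :=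
      (hb.const_mul g).mul_const _
    rw [neg_mul, norm_neg, ← conv_const_mul]
    calc ‖conv (mlKer μ c μ) (fun s => c * ρ s) t‖
        ≤ ∫ s in Ioc 0 t, g * b s * powKer μ T := by
          refine norm_integral_le_of_norm_le (hi.mono_set (Ioc_subset_Ioc_right ht.2)) ?_
          filter_upwards [ae_Ioc_mem_Ioo t] with s hs
          have hsT : s ∈ Ioc 0 T := ⟨hs.1, hs.2.le.trans ht.2⟩
          refine norm_mlKer_mul_le hμ (fun r hr => ?_)
            ⟨sub_pos.2 hs.2, (sub_mem_Ioc hs).2.trans ht.2⟩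
          rw [mlKer_one, mul_left_comm]; exact hρ r hr s hsT
      _ ≤ ∫ s in Ioc 0 T, g * b s * powKer μ T := by
          refine setIntegral_mono_set hi ?_ (Ioc_subset_Ioc_right ht.2).eventuallyLE
          exact (ae_restrict_iff' measurableSet_Ioc).2 (ae_of_all _ fun s hs =>
            mul_nonneg (hgb s hs) hT)
      _ = g * (powKer μ T * ∫ s in Ioc 0 T, b s) := by
          rw [integral_mul_const, integral_const_mul]; ring
  calc ‖modeAccel μ c F G ρ t‖ ≤ _ := norm_add₄_le
    _ ≤ g * (Real.Gamma (μ - 1) * powKer (μ - 1) t) + g * powKer μ T + g * b t +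
        g * (powKer μ T * ∫ s in Ioc 0 T, b s) := by
        gcongr
        exact hρ0 t ht
    _ = _ := by ring

end

/-! The Fourier transform of functions and of tempered functions -/

open scoped FourierTransform

lemma norm_exp_I_mul (κ x : ℝ) : ‖Complex.exp (Complex.I * κ * x)‖ = 1 := by
  rw [Complex.norm_exp]; simp

lemma norm_exp_neg_I_mul (κ x : ℝ) : ‖Complex.exp (-(Complex.I * κ * x))‖ = 1 := by
  rw [Complex.norm_exp]; simp

lemma fourierHat_eq_fourier (u : ℝ → ℂ) (κ : ℝ) : fourierHat u κ = 𝓕 u (-κ / (2 * Real.pi)) := by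
  rw [Real.fourier_real_eq_integral_exp_smul, fourierHat]
  congr 1; ext x
  rw [smul_eq_mul, mul_comm]
  congr 2
  have : (Real.pi : ℂ) ≠ 0 := Complex.ofReal_ne_zero.2 Real.pi_ne_zero
  push_cast; field_simp

lemma fourierInv_eq_fourierHat (h : ℝ → ℂ) (x : ℝ) :
    fourierInv h x = 1 / (2 * Real.pi : ℂ) * fourierHat h (-x) := by
  rw [fourierInv, fourierHat]
  congr 2; ext κ
  congr 2; push_cast; ring

lemma norm_fourierHat_le (u : ℝ → ℂ) (κ : ℝ) : ‖fourierHat u κ‖ ≤ ∫ x, ‖u x‖ := by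
  refine (norm_integral_le_integral_norm _).trans_eq ?_
  simp only [norm_mul, norm_exp_I_mul, mul_one]

lemma integrable_mul_exp {u : ℝ → ℂ} (hu : Integrable u) (κ : ℝ) :
    Integrable fun x : ℝ => u x * Complex.exp (Complex.I * κ * x) := by
  refine hu.mul_bdd (c := 1) (by fun_prop) (ae_of_all _ fun x => (norm_exp_I_mul κ x).le)

lemma integrable_mul_exp_neg {u : ℝ → ℂ} (hu : Integrable u) (x : ℝ) :
    Integrable fun κ : ℝ => u κ * Complex.exp (-(Complex.I * κ * x)) := by
  refine hu.mul_bdd (c := 1) (by fun_prop) (ae_of_all _ fun κ => (norm_exp_neg_I_mul κ x).le)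

lemma continuous_fourierHat {u : ℝ → ℂ} (hu : Integrable u) : Continuous (fourierHat u) := by
  refine continuous_of_dominated (bound := fun x => ‖u x‖) (fun κ =>
    (integrable_mul_exp hu κ).aestronglyMeasurable) (fun κ => ae_of_all _ fun x => ?_) hu.norm
    (ae_of_all _ fun x => by fun_prop)
  rw [norm_mul, norm_exp_I_mul, mul_one]

lemma continuous_fourierInv {h : ℝ → ℂ} (hh : Integrable h) : Continuous (fourierInv h) := by
  have : fourierInv h = fun x => 1 / (2 * Real.pi : ℂ) * fourierHat h (-x) :=
    funext (fourierInv_eq_fourierHat h)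
  rw [this]
  exact continuous_const.mul ((continuous_fourierHat hh).comp continuous_neg)

lemma norm_inv_two_pi_le : ‖(1 / (2 * Real.pi : ℂ))‖ ≤ 1 := by
  have : (1 / (2 * Real.pi : ℂ)) = ((1 / (2 * Real.pi) : ℝ) : ℂ) := by push_cast; ring
  rw [this, Complex.norm_real, Real.norm_of_nonneg (by positivity),
    div_le_one (by positivity)]
  linarith [Real.pi_gt_three]

lemma norm_fourierInv_le (h : ℝ → ℂ) (x : ℝ) : ‖fourierInv h x‖ ≤ ∫ κ, ‖h κ‖ := by
  rw [fourierInv_eq_fourierHat, norm_mul]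
  have h1 := norm_fourierHat_le h (-x)
  have h2 := norm_inv_two_pi_le
  have h3 := norm_nonneg (fourierHat h (-x))
  nlinarith

lemma fourierInv_add {g h : ℝ → ℂ} (hg : Integrable g) (hh : Integrable h) (x : ℝ) :
    fourierInv (fun κ => g κ + h κ) x = fourierInv g x + fourierInv h x := by
  simp only [fourierInv, add_mul]
  rw [integral_add (integrable_mul_exp_neg hg x) (integrable_mul_exp_neg hh x), mul_add]

lemma fourierInv_const_mul (c : ℂ) (h : ℝ → ℂ) (x : ℝ) :
    fourierInv (fun κ => c * h κ) x = c * fourierInv h x := by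
  simp only [fourierInv, mul_assoc]
  rw [integral_const_mul]; ring

/-- Riemann–Lebesgue. For a non-integrable h the integral has the default value 0, so no hypothesis
is needed. -/
lemma tendsto_fourierInv_cocompact (h : ℝ → ℂ) :
    Tendsto (fourierInv h) (cocompact ℝ) (𝓝 0) := by
  have h1 : Tendsto (fun x : ℝ => x / (2 * Real.pi)) (cocompact ℝ) (cocompact ℝ) := by
    have hp : (0 : ℝ) < 2 * Real.pi := by positivity
    rw [cocompact_eq_atBot_atTop]
    exact (tendsto_id.atBot_div_const hp).sup_sup (tendsto_id.atTop_div_const hp)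
  have h2 := ((Real.zero_at_infty_fourier h).comp h1).const_mul (1 / (2 * Real.pi : ℂ))
  rw [mul_zero] at h2
  refine h2.congr fun x => ?_
  rw [fourierInv_eq_fourierHat, fourierHat_eq_fourier, neg_neg]; rfl

/-- Fourier inversion. -/
lemma fourierInv_fourierHat {u : ℝ → ℂ} (hc : Continuous u) (hu : Integrable u)
    (hh : Integrable (fourierHat u)) : fourierInv (fourierHat u) = u := by
  have hp : (2 * Real.pi) ≠ 0 := by positivity
  have h0 : ∀ w : ℝ, 𝓕 u w = fourierHat u (-(2 * Real.pi) * w) := fun w => by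
    rw [fourierHat_eq_fourier]; field_simp
  have h1 : Integrable (𝓕 u) := by
    rw [show 𝓕 u = fun w => fourierHat u (-(2 * Real.pi) * w) from funext h0]
    exact hh.comp_mul_left' (neg_ne_zero.2 hp)
  have h2 := hc.fourierInv_fourier_eq hu h1
  ext x
  rw [← congrFun h2 x, Real.fourierInv_eq_fourier_neg, Real.fourier_real_eq_integral_exp_smul]
  have h3 := Measure.integral_comp_mul_left
    (fun κ : ℝ => fourierHat u κ * Complex.exp (-(Complex.I * κ * x))) (-(2 * Real.pi))
  have h4 : |(-(2 * Real.pi))⁻¹| = 1 / (2 * Real.pi) := by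
    rw [abs_inv, abs_neg, abs_of_pos (by positivity), one_div]
  rw [h4, Complex.real_smul] at h3
  rw [fourierInv]
  push_cast at h3 ⊢
  rw [← h3]
  congr 1; ext w
  rw [h0, smul_eq_mul, mul_comm]
  congr 2; ring

/-- The multiplication formula. -/
lemma integral_mul_fourierHat {u v : ℝ → ℂ} (hu : Integrable u) (hv : Integrable v) :
    ∫ x, u x * fourierHat v x = ∫ κ, fourierHat u κ * v κ := by
  have hF : Integrable (Function.uncurry fun (x κ : ℝ) =>
      u x * v κ * Complex.exp (Complex.I * x * κ)) (volume.prod volume) :=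
    (hu.mul_prod hv).mul_bdd (c := 1) (by fun_prop)
      (ae_of_all _ fun p => (norm_exp_I_mul p.1 p.2).le)
  have h := integral_integral_swap hF
  calc ∫ x, u x * fourierHat v x
      = ∫ x, ∫ κ, u x * v κ * Complex.exp (Complex.I * x * κ) := by
        congr 1; ext x
        rw [fourierHat, ← integral_const_mul]
        simp only [mul_assoc]
    _ = _ := h
    _ = _ := by
        congr 1; ext κ
        rw [fourierHat, ← integral_mul_const]
        congr 1; ext x
        rw [show Complex.I * (x : ℂ) * κ = Complex.I * κ * x by ring]; ring

/-- `fourierHat` on Schwartz functions. -/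
def schwartzHat (φ : 𝓢(ℝ, ℂ)) : 𝓢(ℝ, ℂ) :=
  SchwartzMap.compCLMOfContinuousLinearEquiv ℂ
    (ContinuousLinearEquiv.unitsEquivAut ℝ (Units.mk0 (-(2 * Real.pi)⁻¹) (by
      exact neg_ne_zero.2 (inv_ne_zero (by positivity))))) (𝓕 φ)

lemma schwartzHat_apply (φ : 𝓢(ℝ, ℂ)) (x : ℝ) : schwartzHat φ x = fourierHat φ x := by
  rw [fourierHat_eq_fourier, ← SchwartzMap.fourier_coe]
  simp [schwartzHat]
  congr 1
  ring

/-- Since every Schwartz function is some φ̂, the pairings with all φ̂ determine a tempered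
function; this makes inversion possible for functions that are not integrable. -/
lemma exists_fourierHat_eq (χ : 𝓢(ℝ, ℂ)) : ∃ φ : 𝓢(ℝ, ℂ), ∀ x, fourierHat φ x = χ x := by
  have hp : (2 * Real.pi) ≠ 0 := by positivity
  refine ⟨𝓕⁻ (SchwartzMap.compCLMOfContinuousLinearEquiv ℂ
    (ContinuousLinearEquiv.unitsEquivAut ℝ (Units.mk0 (-(2 * Real.pi)) (neg_ne_zero.2 hp))) χ),
    fun x => ?_⟩
  rw [fourierHat_eq_fourier, ← SchwartzMap.fourier_coe, FourierTransform.fourier_fourierInv_eq]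
  simp

lemma exists_pow_mul_schwartz_le (φ : 𝓢(ℝ, ℂ)) (m : ℕ) :
    ∃ C, ∀ x : ℝ, (1 + |x|) ^ m * ‖φ x‖ ≤ C :=
  ⟨_, fun x => by
    simpa using SchwartzMap.one_add_le_sup_seminorm_apply (𝕜 := ℝ) (m := (m, 0)) le_rfl le_rfl φ x⟩

lemma integrable_one_add_abs_inv_sq : Integrable fun x : ℝ => (((1 + |x|) ^ 2)⁻¹ : ℝ) := by
  refine integrable_inv_one_add_sq.mono' (Continuous.aestronglyMeasurable ?_) (ae_of_all _ fun x => ?_)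
  · exact Continuous.inv₀ (by fun_prop) fun x => by positivity
  · rw [Real.norm_of_nonneg (by positivity)]
    refine inv_anti₀ (by positivity) ?_
    nlinarith [abs_nonneg x, sq_abs x]

lemma integrable_pow_mul_schwartz (φ : 𝓢(ℝ, ℂ)) (m : ℕ) :
    Integrable fun x : ℝ => (1 + |x|) ^ m * ‖φ x‖ := by
  obtain ⟨C, hC⟩ := exists_pow_mul_schwartz_le φ (m + 2)
  refine (integrable_one_add_abs_inv_sq.const_mul C).mono'
    (by fun_prop) (ae_of_all _ fun x => ?_)
  rw [Real.norm_of_nonneg (by positivity), ← div_eq_mul_inv, le_div_iff₀ (by positivity)]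
  refine le_of_eq_of_le ?_ (hC x)
  ring

lemma IsTempered.integrable_mul {u : ℝ → ℂ} (hu : IsTempered u) (φ : 𝓢(ℝ, ℂ)) :
    Integrable fun x => u x * φ x := by
  obtain ⟨m, hm⟩ := hu
  obtain ⟨C, hC⟩ := exists_pow_mul_schwartz_le φ m
  have := hm.mul_bdd (c := C) (g := fun x : ℝ => (((1 + |x|) ^ m : ℝ) : ℂ) * φ x)
    (Continuous.aestronglyMeasurable (by fun_prop)) (ae_of_all _ fun x => by
      rw [norm_mul, Complex.norm_real, Real.norm_of_nonneg (by positivity)]; exact hC x)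
  refine this.congr (ae_of_all _ fun x => ?_)
  have h0 : (((1 + |x|) ^ m : ℝ) : ℂ) ≠ 0 := Complex.ofReal_ne_zero.2 (by positivity)
  simp only [Complex.real_smul, Complex.ofReal_inv]
  field_simp

lemma IsTempered.locallyIntegrable {u : ℝ → ℂ} (hu : IsTempered u) : LocallyIntegrable u := by
  obtain ⟨m, hm⟩ := hu
  rw [locallyIntegrable_iff]
  intro K hK
  have h1 : ContinuousOn (fun x : ℝ => (((1 + |x|) ^ m : ℝ) : ℂ)) K := by fun_prop
  refine (IntegrableOn.continuousOn_mul h1 hm.integrableOn hK).congr (ae_of_all _ fun x => ?_)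
  have h0 : (((1 + |x|) ^ m : ℝ) : ℂ) ≠ 0 := Complex.ofReal_ne_zero.2 (by positivity)
  simp only [Complex.real_smul, Complex.ofReal_inv]
  field_simp

lemma isTempered_of_integrable {u : ℝ → ℂ} (hu : Integrable u) : IsTempered u :=
  ⟨0, by simpa using hu⟩

lemma isTempered_of_bdd {u : ℝ → ℂ} (hu : Continuous u) {C : ℝ} (hC : ∀ x, ‖u x‖ ≤ C) :
    IsTempered u := by
  refine ⟨2, (integrable_one_add_abs_inv_sq.const_mul C).mono'
    (Continuous.aestronglyMeasurable ?_) (ae_of_all _ fun x => ?_)⟩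
  · exact Continuous.smul (f := fun x : ℝ => ((1 + |x|) ^ 2)⁻¹)
      (Continuous.inv₀ (by fun_prop) fun x => by positivity) hu
  · rw [norm_smul, Real.norm_of_nonneg (by positivity), mul_comm]
    gcongr
    exact hC x

/-- Smooth compactly supported functions are Schwartz and already separate locally integrable
functions. Restricting to compact support matters later, where symbols and kernels are bounded only
on compact sets of frequencies. -/
lemma ae_eq_of_forall_test {h₁ h₂ : ℝ → ℂ} (hh₁ : LocallyIntegrable h₁)
    (hh₂ : LocallyIntegrable h₂)
    (h : ∀ φ : 𝓢(ℝ, ℂ), HasCompactSupport φ → ∫ κ, h₁ κ * φ κ = ∫ κ, h₂ κ * φ κ) :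
    h₁ =ᵐ[volume] h₂ := by
  refine ae_eq_of_integral_contDiff_smul_eq hh₁ hh₂ fun g hg hs => ?_
  have hs' : HasCompactSupport fun x => (g x : ℂ) := hs.comp_left Complex.ofReal_zero
  have hg' : ContDiff ℝ (⊤ : ℕ∞) fun x => (g x : ℂ) := Complex.ofRealCLM.contDiff.comp hg
  have := h (hs'.toSchwartzMap hg') hs'
  simpa only [HasCompactSupport.toSchwartzMap_toFun, Complex.real_smul, mul_comm] using this

/-- The multiplication formula moves the transform from h to the reflection of φ̂, and applying it
there returns 2πφ by inversion. -/
lemma integral_fourierInv_mul_fourierHat {h : ℝ → ℂ} (hh : Integrable h) (φ : 𝓢(ℝ, ℂ)) :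
    ∫ x, fourierInv h x * fourierHat φ x = ∫ κ, h κ * φ κ := by
  have hφ : Integrable (fourierHat φ) := by
    have := (schwartzHat φ).integrable (μ := volume)
    exact this.congr (ae_of_all _ fun x => schwartzHat_apply φ x)
  have h1 : ∀ κ, fourierHat (fun x => fourierHat φ (-x)) κ = 2 * Real.pi * φ κ := fun κ => by
    have h2 := congrFun (fourierInv_fourierHat φ.continuous φ.integrable hφ) κ
    rw [← h2, fourierInv, fourierHat, ← integral_neg_eq_self]
    have : (Real.pi : ℂ) ≠ 0 := Complex.ofReal_ne_zero.2 Real.pi_ne_zero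
    rw [← mul_assoc, mul_one_div_cancel (by simp), one_mul]
    congr 1; ext x
    rw [neg_neg]
    congr 2; push_cast; ring
  have h3 := integral_mul_fourierHat hh hφ.comp_neg
  simp only [h1] at h3
  rw [← integral_neg_eq_self]
  simp only [fourierInv_eq_fourierHat, neg_neg, mul_assoc]
  rw [integral_const_mul, ← h3, ← integral_const_mul]
  have : (Real.pi : ℂ) ≠ 0 := Complex.ofReal_ne_zero.2 Real.pi_ne_zero
  congr 1; ext x
  field_simp

lemma isFourierTransform_fourierInv {h : ℝ → ℂ} (hh : Integrable h) :
    IsFourierTransform (fourierInv h) h :=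
  ⟨isTempered_of_bdd (continuous_fourierInv hh) (norm_fourierInv_le h),
    isTempered_of_integrable hh, integral_fourierInv_mul_fourierHat hh⟩

lemma IsFourierTransform.unique {u h₁ h₂ : ℝ → ℂ} (hu₁ : IsFourierTransform u h₁)
    (hu₂ : IsFourierTransform u h₂) : h₁ =ᵐ[volume] h₂ :=
  ae_eq_of_forall_test hu₁.2.1.locallyIntegrable hu₂.2.1.locallyIntegrable fun φ _ => by
    rw [← hu₁.2.2, ← hu₂.2.2]

/-- A continuous function with integrable Fourier transform is given by the inversion formula. -/
lemma IsFourierTransform.eq_fourierInv {u h h' : ℝ → ℂ} (hu : IsFourierTransform u h)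
    (hc : Continuous u) (hh : Integrable h') (he : h =ᵐ[volume] h') : u = fourierInv h' := by
  have hv := isFourierTransform_fourierInv hh
  have h1 : u =ᵐ[volume] fourierInv h' := by
    refine ae_eq_of_forall_test hu.1.locallyIntegrable hv.1.locallyIntegrable fun χ _ => ?_
    obtain ⟨φ, hφ⟩ := exists_fourierHat_eq χ
    simp only [← hφ]
    rw [hu.2.2, hv.2.2]
    exact integral_congr_ae (he.mono fun x hx => by simp only [hx])
  exact Measure.eq_of_ae_eq h1 hc (continuous_fourierInv hh)

/-! Interchanging time convolutions with integrals over a parameter -/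

lemma conv_integral_of_integrable {K : ℝ → ℂ} {U : ℝ → ℝ → ℂ} {ρ : Measure ℝ} [SFinite ρ] {t : ℝ}
    (h : Integrable (Function.uncurry fun κ s => K (t - s) * U κ s)
      (ρ.prod (volume.restrict (Ioc 0 t)))) :
    Integrable (fun κ => conv K (U κ) t) ρ ∧
      conv K (fun s => ∫ κ, U κ s ∂ρ) t = ∫ κ, conv K (U κ) t ∂ρ := by
  refine ⟨h.integral_prod_left, ?_⟩
  have := integral_integral_swap h
  simp only [conv, ← integral_const_mul]
  exact this.symm

/-- For a ≥ 1 the kernel is bounded on (0,t], so integrability of U on the product is enough. This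
version serves N̂, for which no pointwise domination is known. -/
lemma IsKer.conv_integral {a : ℝ} {K : ℝ → ℂ} (hK : IsKer a K) (ha : 1 ≤ a) {U : ℝ → ℝ → ℂ}
    {ρ : Measure ℝ} [SFinite ρ] {t : ℝ}
    (h : Integrable (Function.uncurry U) (ρ.prod (volume.restrict (Ioc 0 t)))) :
    Integrable (fun κ => conv K (U κ) t) ρ ∧
      conv K (fun s => ∫ κ, U κ s ∂ρ) t = ∫ κ, conv K (U κ) t ∂ρ := by
  obtain ⟨C, hC0, hC⟩ := hK.bound' ha t
  refine conv_integral_of_integrable ?_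
  refine Integrable.bdd_mul (c := C) (f := fun p : ℝ × ℝ => K (t - p.2)) h
    ((measurable_kernel_sub hK.meas t).comp measurable_snd).aestronglyMeasurable ?_
  have := (Measure.quasiMeasurePreserving_snd (μ := ρ)).ae (ae_Ioc_mem_Ioo t)
  filter_upwards [this] with p hp
  exact hC _ (sub_mem_Ioc hp)

/-! ### Families dominated by a product of a function of frequency and a function of time -/

/-- A jointly measurable family dominated, on each `(0, T]`, by a product `G(κ) b(t)` of an
integrable function and a continuous integrable function. -/
structure Dominated (U : ℝ → ℝ → ℂ) : Prop where
  meas : Measurable fun p : ℝ × ℝ => (Ioi (0 : ℝ)).indicator (U p.1) p.2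
  bound : ∀ T > 0, ∃ G b : ℝ → ℝ, Integrable G ∧ ContinuousOn b (Ioc 0 T) ∧
    IntegrableOn b (Ioc 0 T) ∧ ∀ κ, ∀ t ∈ Ioc 0 T, ‖U κ t‖ ≤ G κ * b t

namespace Dominated

variable {U : ℝ → ℝ → ℂ}

lemma bound_nonneg (hU : Dominated U) {T : ℝ} (hT : 0 < T) : ∃ G b : ℝ → ℝ, Integrable G ∧
    ContinuousOn b (Ioc 0 T) ∧ IntegrableOn b (Ioc 0 T) ∧ (∀ κ, 0 ≤ G κ) ∧ (∀ t, 0 ≤ b t) ∧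
    ∀ κ, ∀ t ∈ Ioc 0 T, ‖U κ t‖ ≤ G κ * b t := by
  obtain ⟨G, b, hG, hbc, hbi, h⟩ := hU.bound T hT
  refine ⟨fun κ => |G κ|, fun t => |b t|, hG.abs, hbc.abs, hbi.abs, fun _ => abs_nonneg _,
    fun _ => abs_nonneg _, fun κ t ht => (h κ t ht).trans ?_⟩
  rw [← abs_mul]
  exact le_abs_self _

lemma measurable_left (hU : Dominated U) {t : ℝ} (ht : 0 < t) : Measurable fun κ => U κ t := by
  have := hU.meas.comp (measurable_id.prodMk (measurable_const (a := t)))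
  refine (congrArg Measurable (funext fun κ => ?_)).mp this
  simp [mem_Ioi.2 ht]

lemma aestronglyMeasurable_right (hU : Dominated U) (κ T : ℝ) :
    AEStronglyMeasurable (U κ) (volume.restrict (Ioc 0 T)) := by
  have := hU.meas.comp ((measurable_const (a := κ)).prodMk measurable_id)
  refine (this.aestronglyMeasurable (μ := volume.restrict (Ioc 0 T))).congr ?_
  filter_upwards [ae_restrict_mem measurableSet_Ioc] with t ht
  simp [mem_Ioi.2 ht.1]

lemma aestronglyMeasurable_prod (hU : Dominated U) (T : ℝ) :
    AEStronglyMeasurable (Function.uncurry U) (volume.prod (volume.restrict (Ioc 0 T))) := by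
  refine (hU.meas.aestronglyMeasurable (μ := volume.prod (volume.restrict (Ioc 0 T)))).congr ?_
  have := (Measure.quasiMeasurePreserving_snd (μ := (volume : Measure ℝ))).ae (ae_Ioc_mem_Ioo T)
  filter_upwards [this] with p hp
  simp [hp.1, Function.uncurry]

lemma integrable_left (hU : Dominated U) {t : ℝ} (ht : 0 < t) : Integrable fun κ => U κ t := by
  obtain ⟨G, b, hG, -, -, h⟩ := hU.bound t ht
  exact (hG.mul_const (b t)).mono' (hU.measurable_left ht).aestronglyMeasurable
    (ae_of_all _ fun κ => h κ t ⟨ht, le_rfl⟩)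

lemma locInt (hU : Dominated U) (κ : ℝ) : LocInt (U κ) := fun T => by
  rcases le_or_gt T 0 with hT | hT
  · rw [Ioc_eq_empty (not_lt.2 hT)]; exact integrableOn_empty
  obtain ⟨G, b, -, -, hb, h⟩ := hU.bound T hT
  exact (hb.const_mul (G κ)).mono' (hU.aestronglyMeasurable_right κ T)
    ((ae_restrict_iff' measurableSet_Ioc).2 (ae_of_all _ fun s hs => h κ s hs))

/-- The time integral kernels preserve integrability over the product. -/
lemma integrable_powKer (hU : Dominated U) {a t : ℝ} (ha : 0 < a) (ht : 0 < t) :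
    Integrable (Function.uncurry fun κ s => cPowKer a (t - s) * U κ s)
      (volume.prod (volume.restrict (Ioc 0 t))) := by
  obtain ⟨G, b, hG, hbc, hb, h⟩ := hU.bound t ht
  refine Integrable.mono' (hG.mul_prod (integrableOn_powKer_sub_mul ha ht hbc hb)) ?_ ?_
  · exact (((measurable_kernel_sub (isKer_cPowKer ha).meas t).comp
      measurable_snd).aestronglyMeasurable).mul (hU.aestronglyMeasurable_prod t)
  · have := (Measure.quasiMeasurePreserving_snd (μ := (volume : Measure ℝ))).ae (ae_Ioc_mem_Ioo t)
    filter_upwards [this] with p hp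
    have h1 := powKer_nonneg ha (sub_nonneg.2 hp.2.le)
    have h2 := h p.1 p.2 ⟨hp.1, hp.2.le⟩
    rw [Function.uncurry, norm_mul, Complex.norm_real, Real.norm_of_nonneg h1]
    calc powKer a (t - p.2) * ‖U p.1 p.2‖ ≤ powKer a (t - p.2) * (G p.1 * b p.2) := by gcongr
      _ = _ := by ring

lemma integrable_prod (hU : Dominated U) (T : ℝ) :
    Integrable (Function.uncurry U) (volume.prod (volume.restrict (Ioc 0 T))) := by
  rcases le_or_gt T 0 with hT | hT
  · rw [Ioc_eq_empty (not_lt.2 hT)]; simp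
  simpa only [cPowKer, powKer_one, Complex.ofReal_one, one_mul] using
    hU.integrable_powKer one_pos hT

lemma integrable_rlIntegral (hU : Dominated U) {a t : ℝ} (ha : 0 ≤ a) (ht : 0 < t) :
    Integrable fun κ => rlIntegral a (U κ) t := by
  rcases ha.eq_or_lt with rfl | ha
  · simpa only [rlIntegral_zero] using hU.integrable_left ht
  · simp only [rlIntegral_eq_conv ha.ne' ht.le]
    exact (conv_integral_of_integrable (hU.integrable_powKer ha ht)).1

/-- Fractional integrals commute with parameter integrals. -/
lemma rlIntegral_integral (hU : Dominated U) {a t : ℝ} (ha : 0 ≤ a) (ht : 0 < t) :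
    rlIntegral a (fun s => ∫ κ, U κ s) t = ∫ κ, rlIntegral a (U κ) t := by
  rcases ha.eq_or_lt with rfl | ha
  · simp only [rlIntegral_zero]
  · simp only [rlIntegral_eq_conv ha.ne' ht.le]
    exact (conv_integral_of_integrable (hU.integrable_powKer ha ht)).2

lemma locInt_integral (hU : Dominated U) : LocInt fun t => ∫ κ, U κ t := fun T =>
  (hU.integrable_prod T).integral_prod_right

lemma mul_bdd (hU : Dominated U) {m : ℝ → ℂ} (hm : Measurable m) {C : ℝ} (hC : ∀ κ, ‖m κ‖ ≤ C) :
    Dominated fun κ t => U κ t * m κ where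
  meas := by
    have := hU.meas.mul (hm.comp measurable_fst)
    refine (congrArg Measurable (funext fun p => ?_)).mp this
    by_cases h : 0 < p.2 <;> simp [h]
  bound T hT := by
    obtain ⟨G, b, hG, hbc, hb, h⟩ := hU.bound T hT
    refine ⟨fun κ => C * G κ, b, hG.const_mul C, hbc, hb, fun κ t ht => ?_⟩
    have := h κ t ht
    rw [norm_mul]
    calc ‖U κ t‖ * ‖m κ‖ ≤ (G κ * b t) * C :=
          mul_le_mul this (hC κ) (norm_nonneg _) ((norm_nonneg _).trans this)
      _ = _ := by ring

lemma continuousOn_fourierInv (hU : Dominated U) (hc : ∀ κ, ContinuousOn (U κ) (Ioi 0)) :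
    ContinuousOn (fun p : ℝ × ℝ => fourierInv (fun κ => U κ p.2) p.1) (univ ×ˢ Ioi 0) := by
  rintro ⟨x, t⟩ ⟨-, ht⟩
  have ht : 0 < t := ht
  refine ContinuousAt.continuousWithinAt ?_
  unfold fourierInv
  refine continuousAt_const.mul ?_
  obtain ⟨G, b, hG, hbc, -, hG0, -, h⟩ := hU.bound_nonneg (show 0 < 2 * t by linarith)
  -- On a compact window around t, away from the singularity at 0, b is bounded; this gives a
  -- majorant independent of time for dominated convergence.
  have hsub : Icc (t / 2) (2 * t) ⊆ Ioc 0 (2 * t) := fun s hs => ⟨by linarith [hs.1], hs.2⟩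
  obtain ⟨C, hC⟩ := isCompact_Icc.exists_bound_of_continuousOn (hbc.mono hsub)
  have hn : ∀ᶠ p : ℝ × ℝ in 𝓝 (x, t), p.2 ∈ Ioo (t / 2) (2 * t) :=
    continuous_snd.continuousAt.eventually_mem
      (isOpen_Ioo.mem_nhds ⟨by simp only []; linarith, by simp only []; linarith⟩)
  refine continuousAt_of_dominated (bound := fun κ => G κ * C) ?_ ?_ (hG.mul_const C) ?_
  · filter_upwards [hn] with p hp
    exact (integrable_mul_exp_neg (hU.integrable_left (by linarith [hp.1])) p.1).aestronglyMeasurable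
  · filter_upwards [hn] with p hp
    refine ae_of_all _ fun κ => ?_
    rw [norm_mul, norm_exp_neg_I_mul, mul_one]
    refine (h κ p.2 ⟨by linarith [hp.1], hp.2.le⟩).trans ?_
    exact mul_le_mul_of_nonneg_left
      ((le_abs_self _).trans (hC p.2 ⟨hp.1.le, hp.2.le⟩)) (hG0 κ)
  · refine ae_of_all _ fun κ => ContinuousAt.mul ?_ (by fun_prop)
    exact ContinuousAt.comp (f := Prod.snd) (g := U κ) ((hc κ).continuousAt (Ioi_mem_nhds ht))
      continuousAt_snd

lemma continuousOn_integral (hU : Dominated U) (hc : ∀ κ, ContinuousOn (U κ) (Ioi 0)) :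
    ContinuousOn (fun t => ∫ κ, U κ t) (Ioi 0) := by
  -- A plain integral is 2π times the inverse transform at x = 0.
  have h1 : ContinuousOn (fun t : ℝ => fourierInv (fun κ => U κ t) 0) (Ioi 0) :=
    (hU.continuousOn_fourierInv hc).comp (f := fun t : ℝ => ((0 : ℝ), t)) (by fun_prop)
      fun t ht => ⟨mem_univ _, ht⟩
  refine (continuousOn_const.mul h1).congr (f := fun t => (2 * Real.pi : ℂ) * _) fun t _ => ?_
  have : (Real.pi : ℂ) ≠ 0 := Complex.ofReal_ne_zero.2 Real.pi_ne_zero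
  simp only [fourierInv, Complex.ofReal_zero, mul_zero, neg_zero, Complex.exp_zero, mul_one]
  field_simp

lemma fourierInv_eq_integral (h : ℝ → ℂ) (x : ℝ) :
    fourierInv h x = ∫ κ, h κ * (1 / (2 * Real.pi : ℂ) * Complex.exp (-(Complex.I * κ * x))) := by
  rw [fourierInv, ← integral_const_mul]
  congr 1; ext κ; ring

/-- The family whose integral is the inverse Fourier transform at `x`. -/
lemma mul_exp (hU : Dominated U) (x : ℝ) : Dominated fun κ t =>
    U κ t * (1 / (2 * Real.pi : ℂ) * Complex.exp (-(Complex.I * κ * x))) := by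
  refine hU.mul_bdd (C := 1) (by fun_prop) fun κ => ?_
  rw [norm_mul, norm_exp_neg_I_mul, mul_one]
  exact norm_inv_two_pi_le

/-- Fractional integrals commute with the inverse Fourier transform. -/
lemma rlIntegral_fourierInv (hU : Dominated U) {a t : ℝ} (ha : 0 ≤ a) (ht : 0 < t) (x : ℝ) :
    rlIntegral a (fun s => fourierInv (fun κ => U κ s) x) t =
      fourierInv (fun κ => rlIntegral a (U κ) t) x := by
  simp only [fourierInv_eq_integral]
  rw [(hU.mul_exp x).rlIntegral_integral ha ht]
  simp only [rlIntegral_mul_const]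

lemma locInt_fourierInv (hU : Dominated U) (x : ℝ) :
    LocInt fun t => fourierInv (fun κ => U κ t) x := by
  simp only [fourierInv_eq_integral]
  exact (hU.mul_exp x).locInt_integral

lemma exists_norm_fourierInv_le (hU : Dominated U) {T : ℝ} (hT : 0 < T) :
    ∃ B : ℝ → ℝ, ContinuousOn B (Ioc 0 T) ∧ IntegrableOn B (Ioc 0 T) ∧ (∀ t, 0 ≤ B t) ∧
      ∀ x, ∀ t ∈ Ioc 0 T, ‖fourierInv (fun κ => U κ t) x‖ ≤ B t := by
  obtain ⟨G, b, hG, hbc, hb, hG0, hb0, h⟩ := hU.bound_nonneg hT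
  refine ⟨fun t => (∫ κ, G κ) * b t, continuousOn_const.mul hbc, hb.const_mul _,
    fun t => mul_nonneg (integral_nonneg hG0) (hb0 t), fun x t ht => ?_⟩
  refine (norm_fourierInv_le _ x).trans ?_
  beta_reduce
  rw [← integral_mul_const]
  exact integral_mono (hU.integrable_left ht.1).norm (hG.mul_const _) fun κ => h κ t ht

end Dominated

/-! Families of Fourier modes -/

/-- Extended by zero off 0 < s ≤ t, the integrand is jointly measurable on the whole space, and an
integral over a fixed line preserves measurability in the parameters. -/
lemma measurable_conv {K U : ℝ → ℝ → ℂ} (hK : Measurable (Function.uncurry K))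
    (hU : Measurable fun p : ℝ × ℝ => (Ioi (0 : ℝ)).indicator (U p.1) p.2) :
    Measurable fun p : ℝ × ℝ => conv (K p.1) (U p.1) p.2 := by
  have h1 : Measurable fun q : (ℝ × ℝ) × ℝ => {q : (ℝ × ℝ) × ℝ | q.2 ∈ Ioc 0 q.1.2}.indicator
      (fun q => K q.1.1 (q.1.2 - q.2) * (Ioi (0 : ℝ)).indicator (U q.1.1) q.2) q := by
    refine Measurable.indicator (Measurable.mul ?_ ?_) ?_
    · exact hK.comp (measurable_fst.fst.prodMk (measurable_fst.snd.sub measurable_snd))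
    · exact hU.comp (measurable_fst.fst.prodMk measurable_snd)
    · exact (measurableSet_lt measurable_const measurable_snd).inter
        (measurableSet_le measurable_snd measurable_fst.snd)
  have h2 := (h1.stronglyMeasurable.integral_prod_right' (ν := (volume : Measure ℝ))).measurable
  refine (congrArg Measurable (funext fun p => ?_)).mp h2
  rw [conv, ← integral_indicator measurableSet_Ioc]
  congr 1; ext s
  by_cases hs : s ∈ Ioc 0 p.2
  · rw [indicator_of_mem hs, indicator_of_mem (show (p, s) ∈ {q : (ℝ × ℝ) × ℝ | q.2 ∈ Ioc 0 q.1.2}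
      from hs), indicator_of_mem (mem_Ioi.2 hs.1)]
  · rw [indicator_of_notMem hs, indicator_of_notMem (show (p, s) ∉
      {q : (ℝ × ℝ) × ℝ | q.2 ∈ Ioc 0 q.1.2} from hs)]

lemma measurable_mlKer_family {μ b : ℝ} (hμ : 1 < μ) (hb : 0 < b) {c : ℝ → ℂ} (hc : Measurable c) :
    Measurable (Function.uncurry fun κ t => mlKer μ (c κ) b t) :=
  (measurable_mlKer hμ hb).comp ((hc.comp measurable_fst).prodMk measurable_snd)

lemma measurable_indicator_of_measurable {U : ℝ → ℝ → ℂ} (hU : Measurable (Function.uncurry U)) :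
    Measurable fun p : ℝ × ℝ => (Ioi (0 : ℝ)).indicator (U p.1) p.2 :=
  (congrArg Measurable (funext fun p => by by_cases h : 0 < p.2 <;> simp [h, Function.uncurry])).mp
    (hU.indicator (measurableSet_lt measurable_const measurable_snd :
      MeasurableSet {p : ℝ × ℝ | (0 : ℝ) < p.2}))

namespace Dominated

variable {U V : ℝ → ℝ → ℂ}

lemma congr (hU : Dominated U) (h : ∀ κ t, 0 < t → V κ t = U κ t) : Dominated V where
  meas := (congrArg Measurable (funext fun p => by
    by_cases hp : 0 < p.2
    · simp [hp, h p.1 p.2 hp]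
    · simp [hp])).mp hU.meas
  bound T hT := by
    obtain ⟨G, b, hG, hbc, hb, hle⟩ := hU.bound T hT
    exact ⟨G, b, hG, hbc, hb, fun κ t ht => by rw [h κ t ht.1]; exact hle κ t ht⟩

lemma add (hU : Dominated U) (hV : Dominated V) : Dominated fun κ t => U κ t + V κ t where
  meas := by
    refine (congrArg Measurable (funext fun p => ?_)).mp (hU.meas.add hV.meas)
    by_cases h : 0 < p.2 <;> simp [h]
  bound T hT := by
    obtain ⟨G, b, hG, hbc, hb, hG0, hb0, h⟩ := hU.bound_nonneg hT
    obtain ⟨G', b', hG', hbc', hb', hG0', hb0', h'⟩ := hV.bound_nonneg hT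
    refine ⟨fun κ => G κ + G' κ, fun t => b t + b' t, hG.add hG', hbc.add hbc', hb.add hb',
      fun κ t ht => (norm_add_le _ _).trans ?_⟩
    have h1 := h κ t ht
    have h2 := h' κ t ht
    have h3 := mul_nonneg (hG0 κ) (hb0' t)
    have h4 := mul_nonneg (hG0' κ) (hb0 t)
    linarith

lemma of_mul {r F : ℝ → ℂ} (hr : Measurable r) (hrc : ContinuousOn r (Ioi 0)) (hri : LocInt r)
    (hF : Measurable F) (hFi : Integrable F) : Dominated fun κ t => r t * F κ where
  meas := measurable_indicator_of_measurable (U := fun κ t => r t * F κ)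
    ((hr.comp measurable_snd).mul (hF.comp measurable_fst))
  bound T _ := ⟨fun κ => ‖F κ‖, fun t => ‖r t‖, hFi.norm, hrc.norm.mono fun _ ht => ht.1,
    (hri T).norm, fun κ t _ => by rw [norm_mul, mul_comm]⟩

lemma of_isKer_mul {a : ℝ} {K F : ℝ → ℂ} (hK : IsKer a K) (ha : 0 < a) (hF : Measurable F)
    (hFi : Integrable F) : Dominated fun κ t => K t * F κ :=
  of_mul hK.meas hK.cont (hK.locInt ha) hF hFi

lemma conv_cPowKer (hU : Dominated U) {a : ℝ} (ha : 1 ≤ a) :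
    Dominated fun κ t => conv (cPowKer a) (U κ) t where
  meas := measurable_indicator_of_measurable (U := fun κ t => conv (cPowKer a) (U κ) t)
    (measurable_conv (K := fun _ => cPowKer a)
      ((isKer_cPowKer (by linarith)).meas.comp measurable_snd) hU.meas)
  bound T hT := by
    obtain ⟨G, b, hG, hbc, hb, hG0, hb0, h⟩ := hU.bound_nonneg hT
    refine ⟨G, fun _ => powKer a T * ∫ s in Ioc 0 T, b s, hG, continuousOn_const,
      integrable_const _, fun κ t ht => ?_⟩
    have hi : IntegrableOn (fun s => powKer a T * (G κ * b s)) (Ioc 0 T) :=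
      (hb.const_mul (G κ)).const_mul _
    have hpT := powKer_nonneg (show 0 < a by linarith) hT.le
    calc ‖conv (cPowKer a) (U κ) t‖ ≤ ∫ s in Ioc 0 t, powKer a T * (G κ * b s) := by
          refine norm_integral_le_of_norm_le (hi.mono_set (Ioc_subset_Ioc_right ht.2)) ?_
          filter_upwards [ae_Ioc_mem_Ioo t] with s hs
          have h1 := powKer_nonneg (show 0 < a by linarith) (sub_nonneg.2 hs.2.le)
          have h2 : powKer a (t - s) ≤ powKer a T :=
            powKer_le ha (sub_nonneg.2 hs.2.le) (by linarith [hs.1, ht.2])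
          rw [norm_mul, Complex.norm_real, Real.norm_of_nonneg h1]
          gcongr
          exact h κ s ⟨hs.1, hs.2.le.trans ht.2⟩
      _ ≤ ∫ s in Ioc 0 T, powKer a T * (G κ * b s) := setIntegral_mono_set hi
          (ae_of_all _ fun s => mul_nonneg hpT (mul_nonneg (hG0 κ) (hb0 s)))
          (Ioc_subset_Ioc_right ht.2).eventuallyLE
      _ = _ := by rw [integral_const_mul, integral_const_mul]; ring

end Dominated

/-- Decay of the data of a family of modes with frequency parameter `c κ`. -/
structure ModeBounds (μ : ℝ) (c F G : ℝ → ℂ) (ρ : ℝ → ℝ → ℂ) : Prop where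
  meas_c : Measurable c
  meas_F : Measurable F
  meas_G : Measurable G
  meas_ρ : Measurable (Function.uncurry ρ)
  cont_ρ : ∀ κ, ContinuousOn (ρ κ) (Ioi 0)
  bound : ∀ T > 0, ∃ g b : ℝ → ℝ, Integrable g ∧ ContinuousOn b (Ioc 0 T) ∧
    IntegrableOn b (Ioc 0 T) ∧ (∀ κ, 0 ≤ g κ) ∧ (∀ t, 0 ≤ b t) ∧
    (∀ κ, ‖F κ‖ ≤ g κ) ∧ (∀ κ, ‖G κ‖ ≤ g κ) ∧ (∀ κ, ∀ s ∈ Ioc 0 T, ‖ρ κ s‖ ≤ g κ * b s) ∧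
    (∀ κ, ∀ t ∈ Ioc 0 T,
      ‖c κ * (mittagLeffler μ (μ - 1) (-((t ^ μ : ℝ) : ℂ) * c κ) * F κ)‖ ≤ g κ) ∧
    (∀ κ, ∀ t ∈ Ioc 0 T, ‖c κ * (mittagLeffler μ 1 (-((t ^ μ : ℝ) : ℂ) * c κ) * G κ)‖ ≤ g κ) ∧
    ∀ κ, ∀ t ∈ Ioc 0 T, ∀ s ∈ Ioc 0 T,
      ‖c κ * (mittagLeffler μ 1 (-((t ^ μ : ℝ) : ℂ) * c κ) * ρ κ s)‖ ≤ g κ * b s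

namespace ModeBounds

variable {μ β γ : ℝ} {c F G : ℝ → ℂ} {ρ p : ℝ → ℝ → ℂ}

/-- Switching off all data but one lets the bound for the whole mode yield absolute convergence of
each of the three integrals separately. -/
lemma only_F (h : ModeBounds μ c F G ρ) : ModeBounds μ c F 0 0 :=
  ⟨h.meas_c, h.meas_F, measurable_const, measurable_const, fun _ => continuousOn_const,
    fun T hT => by
      obtain ⟨g, b, h1, h2, h3, h4, h5, h6, h7, h8, h9, h10, h11⟩ := h.bound T hT
      exact ⟨g, b, h1, h2, h3, h4, h5, h6, by simpa using h4,
        fun κ s _ => by simpa using mul_nonneg (h4 κ) (h5 s), h9, fun κ _ _ => by simpa using h4 κ,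
        fun κ _ _ s _ => by simpa using mul_nonneg (h4 κ) (h5 s)⟩⟩

lemma only_G (h : ModeBounds μ c F G ρ) : ModeBounds μ c 0 G 0 :=
  ⟨h.meas_c, measurable_const, h.meas_G, measurable_const, fun _ => continuousOn_const,
    fun T hT => by
      obtain ⟨g, b, h1, h2, h3, h4, h5, h6, h7, h8, h9, h10, h11⟩ := h.bound T hT
      exact ⟨g, b, h1, h2, h3, h4, h5, by simpa using h4, h7,
        fun κ s _ => by simpa using mul_nonneg (h4 κ) (h5 s), fun κ _ _ => by simpa using h4 κ, h10,
        fun κ _ _ s _ => by simpa using mul_nonneg (h4 κ) (h5 s)⟩⟩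

lemma only_ρ (h : ModeBounds μ c F G ρ) : ModeBounds μ c 0 0 ρ :=
  ⟨h.meas_c, measurable_const, measurable_const, h.meas_ρ, h.cont_ρ,
    fun T hT => by
      obtain ⟨g, b, h1, h2, h3, h4, h5, h6, h7, h8, h9, h10, h11⟩ := h.bound T hT
      exact ⟨g, b, h1, h2, h3, h4, h5, by simpa using h4, by simpa using h4, h8,
        fun κ _ _ => by simpa using h4 κ, fun κ _ _ => by simpa using h4 κ, h11⟩⟩

lemma integrable_F (h : ModeBounds μ c F G ρ) : Integrable F := by
  obtain ⟨g, b, h1, -, -, -, -, h6, -⟩ := h.bound 1 one_pos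
  exact h1.mono' h.meas_F.aestronglyMeasurable (ae_of_all _ h6)

lemma integrable_G (h : ModeBounds μ c F G ρ) : Integrable G := by
  obtain ⟨g, b, h1, -, -, -, -, -, h7, -⟩ := h.bound 1 one_pos
  exact h1.mono' h.meas_G.aestronglyMeasurable (ae_of_all _ h7)

lemma dominated_ρ (h : ModeBounds μ c F G ρ) : Dominated ρ where
  meas := measurable_indicator_of_measurable h.meas_ρ
  bound T hT := by
    obtain ⟨g, b, h1, h2, h3, -, -, -, -, h8, -⟩ := h.bound T hT
    exact ⟨g, b, h1, h2, h3, h8⟩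

lemma dominated_accel (hμ : 1 < μ) (h : ModeBounds μ c F G ρ) :
    Dominated fun κ => modeAccel μ (c κ) (F κ) (G κ) (ρ κ) where
  meas := by
    refine measurable_indicator_of_measurable
      (U := fun κ t => modeAccel μ (c κ) (F κ) (G κ) (ρ κ) t) ?_
    have hc : Measurable fun p : ℝ × ℝ => -c p.1 := (h.meas_c.comp measurable_fst).neg
    exact (((hc.mul ((measurable_mlKer_family hμ (by linarith) h.meas_c).mul
      (h.meas_F.comp measurable_fst))).add (hc.mul
      ((measurable_mlKer_family hμ (by linarith) h.meas_c).mul (h.meas_G.comp measurable_fst)))).add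
      h.meas_ρ).add (hc.mul (measurable_conv (measurable_mlKer_family hμ (by linarith) h.meas_c)
        (measurable_indicator_of_measurable h.meas_ρ)))
  bound T hT := by
    obtain ⟨g, b, h1, h2, h3, h4, h5, h6, h7, h8, h9, h10, h11⟩ := h.bound T hT
    refine ⟨g, fun t => Real.Gamma (μ - 1) * powKer (μ - 1) t + powKer μ T + b t +
      powKer μ T * ∫ s in Ioc 0 T, b s, h1, ?_, ?_, fun κ t ht =>
        norm_modeAccel_le hμ h3 (h9 κ) (h10 κ) (h11 κ) (h8 κ) ht⟩
    · exact (((continuousOn_const.mul ((continuousOn_powKer _).mono fun t ht => ht.1)).add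
        continuousOn_const).add h2).add continuousOn_const
    · exact ((((integrableOn_powKer (by linarith) T).const_mul _).add
        (integrable_const _)).add h3).add (integrable_const _)

/-- The decay hypotheses concern E_{μ,μ-1} and E_{μ,1}, not the functions E_{μ,1-β} and E_{μ,2-β} in
the mode. The mode is therefore bounded through its acceleration: k_{2-β} ⋆ P inherits the
domination of P because 2 - β ≥ 1. -/
lemma dominated_modeSol (hμ : 1 < μ) (hβ : β < 1) (hγ : 0 ≤ γ)
    (hsum : β + γ = 2 - μ) (h : ModeBounds μ c F G ρ)
    (hp : ∀ κ t, 0 < t → p κ t = rlIntegral γ (ρ κ) t) :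
    Dominated fun κ => modeSol μ β (c κ) (F κ) (G κ) (p κ) := by
  have h1 := Dominated.of_isKer_mul (isKer_cPowKer (show 0 < 1 - β by linarith)) (by linarith)
    h.meas_F h.integrable_F
  have h2 := Dominated.of_isKer_mul (isKer_cPowKer (show 0 < 2 - β by linarith)) (by linarith)
    h.meas_G h.integrable_G
  have h3 := (h.dominated_accel hμ).conv_cPowKer (show 1 ≤ 2 - β by linarith)
  exact ((h1.add h2).add h3).congr fun κ t ht =>
    modeSol_eq_add_conv hμ hβ hγ hsum (h.dominated_ρ.locInt κ) (h.cont_ρ κ) (hp κ) ht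

end ModeBounds

/-! The closed form is a solution -/

/-- The frequency parameter `ψ_α^θ(κ) + k²`. -/
def symb (α θ k κ : ℝ) : ℂ := psi α θ κ + (k : ℂ) ^ 2

lemma measurable_sign : Measurable Real.sign := by
  unfold Real.sign
  exact Measurable.ite measurableSet_Iio measurable_const
    (Measurable.ite measurableSet_Ioi measurable_const measurable_const)

lemma measurable_psi (α θ : ℝ) : Measurable (psi α θ) := by
  unfold psi
  have := measurable_sign
  fun_prop

lemma measurable_symb (α θ k : ℝ) : Measurable (symb α θ k) :=
  (measurable_psi α θ).add_const _

lemma norm_psi (α θ κ : ℝ) : ‖psi α θ κ‖ = |κ| ^ α := by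
  rw [psi, norm_mul, Complex.norm_real, Real.norm_of_nonneg (by positivity), mul_comm Complex.I,
    Complex.norm_exp_ofReal_mul_I, mul_one]

lemma norm_symb_le (α θ k κ : ℝ) : ‖symb α θ k κ‖ ≤ (1 + k ^ 2) * (1 + |κ| ^ α) := by
  refine (norm_add_le _ _).trans ?_
  rw [norm_psi, norm_pow, Complex.norm_real, Real.norm_eq_abs, sq_abs]
  have : 0 ≤ |κ| ^ α := by positivity
  nlinarith [mul_nonneg (sq_nonneg k) this]

lemma hilferDeriv_eq {μ ν : ℝ} (hμ : 1 < μ) (hμ' : μ ≤ 2) (u : ℝ → ℂ) (t : ℝ) :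
    hilferDeriv μ ν u t =
      rlIntegral (ν * (2 - μ)) (iteratedDeriv 2 (rlIntegral ((1 - ν) * (2 - μ)) u)) t := by
  have : ⌈μ⌉₊ = 2 := (Nat.ceil_eq_iff two_ne_zero).2 ⟨by norm_num; linarith, by norm_num; linarith⟩
  rw [hilferDeriv, this, Nat.cast_two]

/-- Once modes and accelerations are dominated, fractional integrals in t commute with the inverse
transform, and every requirement on N is the inverse transform of an identity for single modes. -/
lemma isSolution_of_modes {α θ μ ν k β γ : ℝ} (hμ : 1 < μ) (hμ' : μ ≤ 2)
    (hβ : (1 - ν) * (2 - μ) = β) (hγ : ν * (2 - μ) = γ) (hβ0 : 0 ≤ β) (hβ1 : β < 1) (hγ0 : 0 ≤ γ)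
    {f g F G : ℝ → ℂ} {Φ N : ℝ → ℝ → ℂ} {ρ p : ℝ → ℝ → ℂ}
    (h : ModeBounds μ (symb α θ k) F G ρ)
    (hp : ∀ κ t, 0 < t → p κ t = rlIntegral γ (ρ κ) t) (hp' : ∀ κ, LocInt (p κ))
    (hF : fourierInv F = f) (hG : fourierInv G = g)
    (hΦ : ∀ t > 0, ∀ x, fourierInv (fun κ => p κ t) x = Φ x t)
    (hN : ∀ x, ∀ t > 0, N x t =
      fourierInv (fun κ => modeSol μ β (symb α θ k κ) (F κ) (G κ) (p κ) t) x) :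
    IsSolution α θ μ ν k f g Φ N := by
  have hsum : β + γ = 2 - μ := by rw [← hβ, ← hγ]; ring
  set c := symb α θ k with hc
  let H : ℝ → ℝ → ℂ := fun κ t => modeSol μ β (c κ) (F κ) (G κ) (p κ) t
  let P : ℝ → ℝ → ℂ := fun κ t => modeAccel μ (c κ) (F κ) (G κ) (ρ κ) t
  have hHd : Dominated H := h.dominated_modeSol hμ hβ1 hγ0 hsum hp
  have hPd : Dominated P := h.dominated_accel hμ
  have hρ := h.dominated_ρ.locInt
  have hHc : ∀ κ, ContinuousOn (H κ) (Ioi 0) := fun κ => continuousOn_modeSol hμ hβ1 (hp' κ)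
  have hPc : ∀ κ, ContinuousOn (P κ) (Ioi 0) := fun κ =>
    continuousOn_modeAccel hμ (hρ κ) (h.cont_ρ κ)
  have hpi : ∀ t, 0 < t → Integrable fun κ => p κ t := fun t ht => by
    simpa only [hp _ t ht] using h.dominated_ρ.integrable_rlIntegral hγ0 ht
  have hNt : ∀ t > 0, (fun x => N x t) = fourierInv fun κ => H κ t := fun t ht =>
    funext fun x => hN x t ht
  have hpx : ∀ x, ContinuousOn (fun t : ℝ => fourierInv (fun κ => P κ t) x) (Ioi 0) := fun x =>
    (hPd.continuousOn_fourierInv hPc).comp (f := fun t : ℝ => (x, t)) (by fun_prop)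
      fun t ht => ⟨mem_univ _, ht⟩
  -- The Taylor form of I^β N. It yields at once the C² regularity, the second derivative and both
  -- initial limits.
  have hw : ∀ x t, 0 < t → rlIntegral β (N x) t =
      f x + t * g x + conv (cPowKer 2) (fun s => fourierInv (fun κ => P κ s) x) t := by
    intro x t ht
    have h1 : Integrable fun κ => (t : ℂ) * G κ := h.integrable_G.const_mul _
    have h2 : Integrable fun κ => rlIntegral 2 (P κ) t := hPd.integrable_rlIntegral zero_le_two ht
    rw [rlIntegral_congr ht fun s hs => hN x s hs.1, hHd.rlIntegral_fourierInv hβ0 ht x,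
      ← rlIntegral_eq_conv two_ne_zero ht.le, hPd.rlIntegral_fourierInv zero_le_two ht x,
      ← hF, ← hG, ← fourierInv_const_mul, ← fourierInv_add h.integrable_F h1,
      ← fourierInv_add (g := fun κ => F κ + t * G κ) (h.integrable_F.add h1) h2]
    congr 1; ext κ
    rw [rlIntegral_modeSol_eq hμ hβ0 hβ1 hγ0 hsum (hρ κ) (h.cont_ρ κ) (hp' κ) (hp κ) ht,
      rlIntegral_eq_conv two_ne_zero ht.le]
  have hC := fun x => contDiffOn_of_eq_add_conv (hPd.locInt_fourierInv x) (hpx x) (hw x)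
  refine ⟨?_, ?_, ?_, ?_, ?_, ?_, ?_, ?_⟩
  · exact (hHd.continuousOn_fourierInv hHc).congr fun q hq => hN q.1 q.2 hq.2
  · simpa only [hβ] using fun x => (hC x).1
  · intro T hT
    obtain ⟨B₁, hc₁, hi₁, h0₁, hle₁⟩ := hHd.exists_norm_fourierInv_le hT
    obtain ⟨B₂, hc₂, hi₂, h0₂, hle₂⟩ := hPd.exists_norm_fourierInv_le hT
    refine ⟨0, fun t => B₁ t + B₂ t, hc₁.add hc₂, hi₁.add hi₂, fun x t ht => ?_⟩
    rw [hβ, (hC x).2.1 t ht.1, hN x t ht.1, pow_zero, mul_one]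
    exact ⟨(hle₁ x t ht).trans (by linarith [h0₂ t]), (hle₂ x t ht).trans (by linarith [h0₁ t])⟩
  · refine ⟨H, fun t ht => ?_, fun T _ => ⟨0, ?_⟩⟩
    · rw [hNt t ht]
      exact isFourierTransform_fourierInv (hHd.integrable_left ht)
    · simpa [Function.uncurry_def] using hHd.integrable_prod T
  · intro t ht
    have hHi := hHd.integrable_left ht
    have hk : Integrable fun κ => -(k : ℂ) ^ 2 * H κ t := hHi.const_mul _
    have hmode : ∀ κ, rlIntegral γ (P κ) t = -psi α θ κ * H κ t + -(k : ℂ) ^ 2 * H κ t + p κ t :=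
      fun κ => by
        rw [rlIntegral_modeAccel_eq hμ hγ0 hsum (hρ κ) (h.cont_ρ κ) (hp κ) ht]
        simp only [H, hc, symb]; ring
    -- There is no direct bound on ψH; the mode equation expresses it through I^γ P, k²H and p, all
    -- integrable.
    have hψ : Integrable fun κ => -psi α θ κ * H κ t := by
      refine (((hPd.integrable_rlIntegral hγ0 ht).sub hk).sub (hpi t ht)).congr
        (ae_of_all _ fun κ => ?_)
      simp only [Pi.sub_apply, hmode κ]; ring
    refine ⟨fourierInv fun κ => -psi α θ κ * H κ t, ⟨fun κ => H κ t, ?_,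
      isFourierTransform_fourierInv hψ⟩, fun x => ?_⟩
    · rw [hNt t ht]
      exact isFourierTransform_fourierInv hHi
    · rw [hilferDeriv_eq hμ hμ', hβ, hγ, rlIntegral_congr ht fun s hs => (hC x).2.1 s hs.1,
        hPd.rlIntegral_fourierInv hγ0 ht x]
      simp only [hmode]
      rw [fourierInv_add (g := fun κ => -psi α θ κ * H κ t + -(k : ℂ) ^ 2 * H κ t) (hψ.add hk)
        (hpi t ht), fourierInv_add hψ hk, fourierInv_const_mul,
        hΦ t ht x, hN x t ht]
      ring
  · simpa only [hβ] using fun x => (hC x).2.2.1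
  · simpa only [hβ] using fun x => (hC x).2.2.2
  · intro t ht
    rw [hNt t ht]
    have := tendsto_fourierInv_cocompact fun κ => H κ t
    rw [cocompact_eq_atBot_atTop] at this
    exact ⟨this.mono_left le_sup_right, this.mono_left le_sup_left⟩

/-! The closed form in terms of Fourier modes -/

lemma mittagLeffler₃_one (a b : ℝ) (z : ℂ) : mittagLeffler₃ a b 1 z = mittagLeffler a b z := by
  unfold mittagLeffler₃ mittagLeffler
  congr 1; ext n
  rw [ascPochhammer_eval_one]
  have : (n.factorial : ℂ) ≠ 0 := Nat.cast_ne_zero.2 n.factorial_ne_zero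
  rw [div_mul_div_comm, mul_comm (Complex.Gamma _), mul_div_mul_left _ _ this]

lemma mittagLeffler_zero {μ b : ℝ} (hμ : 1 < μ) (hb : 0 < b) :
    mittagLeffler μ b 0 = ((Real.Gamma b)⁻¹ : ℝ) := by
  have := mlKer_zero hμ hb one_pos
  simpa [mlKer, powKer] using this

/-- The Fourier transform of the source. -/
abbrev sourceHat (Φ : ℝ → ℝ → ℂ) (κ t : ℝ) : ℂ := fourierHat (fun x => Φ x t) κ

lemma sourceTerm_eq {α θ μ k t : ℝ} (ht : 0 ≤ t) (Φ : ℝ → ℝ → ℂ) (κ : ℝ) :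
    sourceTerm α θ μ k Φ t κ = conv (mlKer μ (symb α θ k κ) μ) (sourceHat Φ κ) t := by
  rw [sourceTerm, prabhakar, intervalIntegral.integral_of_le ht, conv]
  congr 1; ext s
  rw [mittagLeffler₃_one, mlKer, symb]
  congr 3; ring

lemma rpow_mul_symbolML {α θ μ k t : ℝ} (b κ : ℝ) :
    ((t ^ (b - 1) : ℝ) : ℂ) * symbolML α θ μ k b t κ = mlKer μ (symb α θ k κ) b t := rfl

lemma locInt_sourceHat {Φ : ℝ → ℝ → ℂ} (hΦ : ∀ T > 0, Integrable (Function.uncurry Φ)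
    (volume.prod (volume.restrict (Ioc (0 : ℝ) T)))) (κ : ℝ) : LocInt (sourceHat Φ κ) := fun T => by
  rcases le_or_gt T 0 with hT | hT
  · rw [Ioc_eq_empty (not_lt.2 hT)]; exact integrableOn_empty
  have : Integrable (fun p : ℝ × ℝ => Function.uncurry Φ p * Complex.exp (Complex.I * κ * p.1))
      (volume.prod (volume.restrict (Ioc (0 : ℝ) T))) :=
    (hΦ T hT).mul_bdd (c := 1) (Continuous.aestronglyMeasurable (by fun_prop))
      (ae_of_all _ fun p => (norm_exp_I_mul κ p.1).le)
  exact this.integral_prod_right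

section

variable {α θ μ ν k : ℝ} {f g : ℝ → ℂ} {Φ : ℝ → ℝ → ℂ}

/-- The Fourier mode of the closed form. -/
abbrev mode (α θ μ ν k : ℝ) (f g : ℝ → ℂ) (Φ : ℝ → ℝ → ℂ) (κ t : ℝ) : ℂ :=
  modeSol μ ((1 - ν) * (2 - μ)) (symb α θ k κ) (fourierHat f κ) (fourierHat g κ) (sourceHat Φ κ) t

lemma FormulaConverges.mode_parts (h : FormulaConverges α θ μ ν k f g Φ) {t : ℝ} (ht : 0 < t) :
    Integrable (fun κ =>
      mlKer μ (symb α θ k κ) (1 - (1 - ν) * (2 - μ)) t * fourierHat f κ) ∧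
    Integrable (fun κ =>
      mlKer μ (symb α θ k κ) (2 - (1 - ν) * (2 - μ)) t * fourierHat g κ) ∧
    Integrable (fun κ => conv (mlKer μ (symb α θ k κ) μ) (sourceHat Φ κ) t) := by
  refine ⟨?_, ?_, ?_⟩
  · simpa only [← rpow_mul_symbolML, mul_assoc] using (h.value t ht).const_mul _
  · simpa only [← rpow_mul_symbolML, mul_assoc] using (h.velocity t ht).const_mul _
  · exact (h.source t ht).congr (ae_of_all _ fun κ => sourceTerm_eq ht.le Φ κ)

lemma FormulaConverges.integrable_mode (h : FormulaConverges α θ μ ν k f g Φ) {t : ℝ}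
    (ht : 0 < t) : Integrable fun κ => mode α θ μ ν k f g Φ κ t :=
  ((h.mode_parts ht).1.add (h.mode_parts ht).2.1).add (h.mode_parts ht).2.2

lemma FormulaConverges.solutionFormula_eq (h : FormulaConverges α θ μ ν k f g Φ) {t : ℝ}
    (ht : 0 < t) (x : ℝ) :
    solutionFormula α θ μ ν k f g Φ x t = fourierInv (fun κ => mode α θ μ ν k f g Φ κ t) x := by
  obtain ⟨h1, h2, h3⟩ := h.mode_parts ht
  simp only [mode, modeSol]
  rw [fourierInv_add (g := fun κ => mlKer μ (symb α θ k κ) (1 - (1 - ν) * (2 - μ)) t * fourierHat f κ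
    + mlKer μ (symb α θ k κ) (2 - (1 - ν) * (2 - μ)) t * fourierHat g κ) (h1.add h2) h3,
    fourierInv_add h1 h2, solutionFormula, ← fourierInv_const_mul, ← fourierInv_const_mul]
  congr 2
  · congr 1; ext κ
    rw [← rpow_mul_symbolML, ← mul_assoc]; ring_nf
  · congr 1; ext κ
    rw [← rpow_mul_symbolML, ← mul_assoc]; ring_nf
  · ext κ; exact sourceTerm_eq ht.le Φ κ

/-- Regular data have modes with good bounds. -/
lemma RegularData.exists_modeBounds (hμ : 1 < μ) (hf : Integrable f) (hg : Integrable g)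
    (h : RegularData α θ μ ν k f g Φ) : ∃ ρ : ℝ → ℝ → ℂ,
      (∀ κ, ∀ t > 0, sourceHat Φ κ t = rlIntegral (ν * (2 - μ)) (ρ κ) t) ∧
      ModeBounds μ (symb α θ k) (fourierHat f) (fourierHat g) ρ := by
  obtain ⟨ρ, hρm, hρc, hρ, hb⟩ := h.decay_source
  refine ⟨ρ, hρ, measurable_symb α θ k, (continuous_fourierHat hf).measurable,
    (continuous_fourierHat hg).measurable, hρm, hρc, fun T hT => ?_⟩
  obtain ⟨Gf, hGf, hf1⟩ := h.decay_f T hT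
  obtain ⟨Gg, hGg, hg1⟩ := h.decay_g T hT
  obtain ⟨Gρ, B, hGρ, hBc, hB, hρ1⟩ := hb T hT
  have hΓ := Real.Gamma_pos_of_pos (show 0 < μ - 1 by linarith)
  set S : ℝ → ℝ := fun κ => |Gf κ| + |Gg κ| + |Gρ κ| with hS
  have hS0 : ∀ κ, 0 ≤ S κ := fun κ => by positivity
  -- One constant absorbing 1 + k², from |ψ + k²| ≤ (1 + k²)(1 + |κ|^α), and Γ(μ-1), from the value
  -- of E_{μ,μ-1} at 0.
  set M := (1 + k ^ 2) * (1 + Real.Gamma (μ - 1)) with hM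
  have hMk : 1 + k ^ 2 ≤ M := le_mul_of_one_le_right (by positivity) (by linarith)
  have hM1 : 1 ≤ M := le_trans (by linarith [sq_nonneg k]) hMk
  have hMΓ : Real.Gamma (μ - 1) ≤ M := by nlinarith [sq_nonneg k]
  have hSf : ∀ κ, Gf κ ≤ S κ := fun κ => by
    have := le_abs_self (Gf κ); have := abs_nonneg (Gg κ); have := abs_nonneg (Gρ κ)
    simp only [hS]; linarith
  have hSg : ∀ κ, Gg κ ≤ S κ := fun κ => by
    have := le_abs_self (Gg κ); have := abs_nonneg (Gf κ); have := abs_nonneg (Gρ κ)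
    simp only [hS]; linarith
  have hSρ : ∀ κ s, Gρ κ * B s ≤ S κ * |B s| := fun κ s => by
    have h1 : Gρ κ * B s ≤ |Gρ κ| * |B s| := (le_abs_self _).trans (abs_mul _ _).le
    have h2 : |Gρ κ| ≤ S κ := by
      have := abs_nonneg (Gg κ); have := abs_nonneg (Gf κ)
      simp only [hS]; linarith
    exact h1.trans (mul_le_mul_of_nonneg_right h2 (abs_nonneg _))
  -- The weight 1 + |κ|^α controls both multiplication by the symbol, up to 1 + k², and
  -- multiplication by 1.
  have haux : ∀ (κ : ℝ) (x : ℂ) (y : ℝ), (1 + |κ| ^ α) * ‖x‖ ≤ y →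
      ‖symb α θ k κ * x‖ ≤ M * y ∧ ‖x‖ ≤ y := fun κ x y hxy => by
    have h1 := norm_symb_le α θ k κ
    have h2 : 0 ≤ |κ| ^ α := by positivity
    have h3 := norm_nonneg x
    have h4 : ‖x‖ ≤ y := by nlinarith
    refine ⟨?_, h4⟩
    rw [norm_mul]
    calc ‖symb α θ k κ‖ * ‖x‖ ≤ (1 + k ^ 2) * (1 + |κ| ^ α) * ‖x‖ := by gcongr
      _ = (1 + k ^ 2) * ((1 + |κ| ^ α) * ‖x‖) := by ring
      _ ≤ (1 + k ^ 2) * y := by gcongr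
      _ ≤ M * y := mul_le_mul_of_nonneg_right hMk (h3.trans h4)
  -- At t = 0 the Mittag-Leffler factor is the constant 1/Γ(b), so the decay hypotheses at t = 0
  -- bound f̂, ĝ and ρ themselves. This is why they include the endpoint t = 0.
  have h0 : ∀ b κ, 0 < b → symbolML α θ μ k b 0 κ = ((Real.Gamma b)⁻¹ : ℝ) := fun b κ hb => by
    rw [symbolML, Real.zero_rpow (by linarith), ← mittagLeffler_zero hμ hb]
    simp
  have h01 : ∀ κ, symbolML α θ μ k 1 0 κ = 1 := fun κ => by
    rw [h0 1 κ one_pos]; simp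
  have hT0 : (0 : ℝ) ∈ Icc 0 T := ⟨le_rfl, hT.le⟩
  refine ⟨fun κ => M * S κ, fun s => |B s|, ((hGf.abs.add hGg.abs).add hGρ.abs).const_mul M,
    hBc.abs, hB.abs, fun κ => mul_nonneg (by linarith) (hS0 κ), fun _ => abs_nonneg _,
    fun κ => ?_, fun κ => ?_, fun κ s hs => ?_, fun κ t ht => ?_, fun κ t ht => ?_,
    fun κ t ht s hs => ?_⟩
  · have h1 := (haux κ _ _ (hf1 κ 0 hT0)).2
    rw [h0 _ κ (by linarith), norm_mul, Complex.norm_real,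
      Real.norm_of_nonneg (inv_nonneg.2 hΓ.le), inv_mul_le_iff₀ hΓ] at h1
    refine h1.trans ((mul_le_mul_of_nonneg_left (hSf κ) hΓ.le).trans ?_)
    exact mul_le_mul_of_nonneg_right hMΓ (hS0 κ)
  · have h1 := (haux κ _ _ (hg1 κ 0 hT0)).2
    rw [h01, one_mul] at h1
    exact (h1.trans (hSg κ)).trans (le_mul_of_one_le_left (hS0 κ) hM1)
  · have h1 := (haux κ _ _ (hρ1 κ 0 hT0 s hs)).2
    rw [h01, one_mul] at h1
    refine (h1.trans (hSρ κ s)).trans ?_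
    exact mul_le_mul_of_nonneg_right (le_mul_of_one_le_left (hS0 κ) hM1) (abs_nonneg _)
  · exact (haux κ _ _ (hf1 κ t ⟨ht.1.le, ht.2⟩)).1.trans
      (mul_le_mul_of_nonneg_left (hSf κ) (by linarith))
  · exact (haux κ _ _ (hg1 κ t ⟨ht.1.le, ht.2⟩)).1.trans
      (mul_le_mul_of_nonneg_left (hSg κ) (by linarith))
  · exact (haux κ _ _ (hρ1 κ t ⟨ht.1.le, ht.2⟩ s hs)).1.trans
      ((mul_le_mul_of_nonneg_left (hSρ κ s) (show 0 ≤ M by linarith)).trans_eq (mul_assoc _ _ _).symm)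

lemma conv_zero (K : ℝ → ℂ) (t : ℝ) : conv K 0 t = 0 := by simp [conv]

lemma rlIntegral_zero_right (a t : ℝ) : rlIntegral a 0 t = 0 := by
  simp [rlIntegral]

lemma order_bounds (hμ : 1 < μ) (hμ' : μ ≤ 2) (hν : 0 ≤ ν) (hν' : ν ≤ 1) :
    0 ≤ (1 - ν) * (2 - μ) ∧ (1 - ν) * (2 - μ) < 1 ∧ 0 ≤ ν * (2 - μ) ∧
      (1 - ν) * (2 - μ) + ν * (2 - μ) = 2 - μ :=
  ⟨mul_nonneg (by linarith) (by linarith), by nlinarith, mul_nonneg hν (by linarith), by ring⟩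

/-- For regular data the closed form converges. -/
lemma RegularData.formulaConverges (hμ : 1 < μ) (hμ' : μ ≤ 2) (hν : 0 ≤ ν) (hν' : ν ≤ 1)
    (hf : Integrable f) (hg : Integrable g) (h : RegularData α θ μ ν k f g Φ) :
    FormulaConverges α θ μ ν k f g Φ := by
  obtain ⟨hβ0, hβ1, hγ0, hsum⟩ := order_bounds hμ hμ' hν hν'
  obtain ⟨ρ, hρ, hb⟩ := h.exists_modeBounds hμ hf hg
  have hne : ∀ {t : ℝ} (e : ℝ), 0 < t → ((t ^ e : ℝ) : ℂ) ≠ 0 := fun e ht =>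
    Complex.ofReal_ne_zero.2 (Real.rpow_pos_of_pos ht e).ne'
  -- The zero source is the fractional integral of zero, so the mode bounds apply with the source
  -- switched off.
  have hz : ∀ κ t : ℝ, 0 < t →
      (0 : ℝ → ℝ → ℂ) κ t = rlIntegral (ν * (2 - μ)) ((0 : ℝ → ℝ → ℂ) κ) t :=
    fun κ t _ => (rlIntegral_zero_right _ t).symm
  refine ⟨fun t ht => ?_, fun t ht => ?_, fun t ht => ?_⟩
  · have h1 := (hb.only_F.dominated_modeSol (p := 0) hμ hβ1 hγ0 hsum hz).integrable_left ht
    simp only [modeSol, Pi.zero_apply, mul_zero, add_zero, conv_zero] at h1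
    refine (h1.const_mul ((t ^ (1 - (1 - ν) * (2 - μ) - 1) : ℝ) : ℂ)⁻¹).congr
      (ae_of_all _ fun κ => ?_)
    simp only [← rpow_mul_symbolML]
    rw [mul_assoc, inv_mul_cancel_left₀ (hne _ ht)]
  · have h1 := (hb.only_G.dominated_modeSol (p := 0) hμ hβ1 hγ0 hsum hz).integrable_left ht
    simp only [modeSol, Pi.zero_apply, mul_zero, zero_add, add_zero, conv_zero] at h1
    refine (h1.const_mul ((t ^ (2 - (1 - ν) * (2 - μ) - 1) : ℝ) : ℂ)⁻¹).congr
      (ae_of_all _ fun κ => ?_)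
    simp only [← rpow_mul_symbolML]
    rw [mul_assoc, inv_mul_cancel_left₀ (hne _ ht)]
  · have h1 := (hb.only_ρ.dominated_modeSol hμ hβ1 hγ0 hsum hρ).integrable_left ht
    simp only [modeSol, Pi.zero_apply, mul_zero, zero_add] at h1
    exact h1.congr (ae_of_all _ fun κ => (sourceTerm_eq ht.le Φ κ).symm)

/-- For regular data the closed form is a solution. -/
lemma RegularData.isSolution (hμ : 1 < μ) (hμ' : μ ≤ 2) (hν : 0 ≤ ν) (hν' : ν ≤ 1)
    (hf : Integrable f) (hg : Integrable g) (hΦ : ∀ t > 0, Integrable fun x => Φ x t)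
    (hΦ' : ∀ T > 0, Integrable (Function.uncurry Φ)
      (volume.prod (volume.restrict (Ioc (0 : ℝ) T))))
    (h : RegularData α θ μ ν k f g Φ) {N : ℝ → ℝ → ℂ}
    (hN : ∀ x, ∀ t > 0, N x t = solutionFormula α θ μ ν k f g Φ x t) :
    IsSolution α θ μ ν k f g Φ N := by
  obtain ⟨hβ0, hβ1, hγ0, hsum⟩ := order_bounds hμ hμ' hν hν'
  obtain ⟨ρ, hρ, hb⟩ := h.exists_modeBounds hμ hf hg
  have hconv := h.formulaConverges hμ hμ' hν hν' hf hg
  refine isSolution_of_modes hμ hμ' rfl rfl hβ0 hβ1 hγ0 hb hρ (locInt_sourceHat hΦ')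
    (fourierInv_fourierHat h.continuous_f hf hb.integrable_F)
    (fourierInv_fourierHat h.continuous_g hg hb.integrable_G) (fun t ht x => ?_)
    fun x t ht => (hN x t ht).trans (hconv.solutionFormula_eq ht x)
  refine congrFun (fourierInv_fourierHat (h.continuous_source t ht) (hΦ t ht) ?_) x
  have := hb.dominated_ρ.integrable_rlIntegral hγ0 ht
  exact this.congr (ae_of_all _ fun κ => (hρ κ t ht).symm)

end

/-! The equation tested against Schwartz functions -/

/-- The time derivative is the pointwise limit of difference quotients with step 1/(n+1), each
jointly measurable. Applied twice, this gives joint measurability of the acceleration of a solution,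
which is assumed C² only for each x separately. -/
lemma measurable_indicator_deriv {U : ℝ → ℝ → ℂ}
    (hU : Measurable fun p : ℝ × ℝ => (Ioi (0 : ℝ)).indicator (U p.1) p.2)
    (hd : ∀ x, DifferentiableOn ℝ (U x) (Ioi 0)) :
    Measurable fun p : ℝ × ℝ => (Ioi (0 : ℝ)).indicator (deriv (U p.1)) p.2 := by
  have hpos : ∀ n : ℕ, (0 : ℝ) < 1 / ((n : ℝ) + 1) := fun n => by positivity
  refine measurable_of_tendsto_metrizable (f := fun (n : ℕ) (p : ℝ × ℝ) =>
    {p : ℝ × ℝ | 0 < p.2}.indicator (fun p => (1 / ((n : ℝ) + 1))⁻¹ •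
      ((Ioi (0 : ℝ)).indicator (U p.1) (p.2 + 1 / ((n : ℝ) + 1)) -
        (Ioi (0 : ℝ)).indicator (U p.1) p.2)) p) (fun n => ?_) ?_
  · refine Measurable.indicator ?_ (measurableSet_lt measurable_const measurable_snd)
    exact ((hU.comp (measurable_fst.prodMk (measurable_snd.add_const _))).sub hU).const_smul
      ((1 / ((n : ℝ) + 1))⁻¹)
  · rw [tendsto_pi_nhds]
    rintro ⟨x, t⟩
    by_cases ht : 0 < t
    · have h1 := ((hd x).differentiableAt (Ioi_mem_nhds ht)).hasDerivAt
      rw [hasDerivAt_iff_tendsto_slope_zero] at h1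
      have h2 : Tendsto (fun n : ℕ => 1 / ((n : ℝ) + 1)) atTop (𝓝[≠] 0) :=
        tendsto_nhdsWithin_iff.2 ⟨tendsto_one_div_add_atTop_nhds_zero_nat,
          Eventually.of_forall fun n => (hpos n).ne'⟩
      refine ((h1.comp h2).congr fun n => ?_).trans_eq ?_
      · have h3 : 0 < t + 1 / ((n : ℝ) + 1) := add_pos ht (hpos n)
        rw [indicator_of_mem (show (x, t) ∈ {p : ℝ × ℝ | 0 < p.2} from ht),
          indicator_of_mem (mem_Ioi.2 h3), indicator_of_mem (mem_Ioi.2 ht)]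
        rfl
      · rw [indicator_of_mem (mem_Ioi.2 ht)]
    · have h3 : (x, t) ∉ {p : ℝ × ℝ | 0 < p.2} := ht
      simp only [indicator_of_notMem h3, indicator_of_notMem (show t ∉ Ioi 0 from ht)]
      exact tendsto_const_nhds

lemma measurable_indicator_rlIntegral {U : ℝ → ℝ → ℂ} {a : ℝ} (ha : 0 ≤ a)
    (hU : Measurable fun p : ℝ × ℝ => (Ioi (0 : ℝ)).indicator (U p.1) p.2) :
    Measurable fun p : ℝ × ℝ => (Ioi (0 : ℝ)).indicator (rlIntegral a (U p.1)) p.2 := by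
  rcases ha.eq_or_lt with rfl | ha
  · have : ∀ x, rlIntegral 0 (U x) = U x := fun x => funext (rlIntegral_zero _)
    simpa only [this] using hU
  · have h1 := measurable_indicator_of_measurable (U := fun x t => conv (cPowKer a) (U x) t)
      (measurable_conv (K := fun _ => cPowKer a)
        ((isKer_cPowKer ha).meas.comp measurable_snd) hU)
    refine (congrArg Measurable (funext fun p => ?_)).mp h1
    by_cases hp : 0 < p.2
    · rw [indicator_of_mem (mem_Ioi.2 hp), indicator_of_mem (mem_Ioi.2 hp),
        rlIntegral_eq_conv ha.ne' hp.le]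
    · rw [indicator_of_notMem (by simpa using hp), indicator_of_notMem (by simpa using hp)]

lemma measurable_indicator_of_continuousOn {N : ℝ → ℝ → ℂ}
    (hN : ContinuousOn (Function.uncurry N) (univ ×ˢ Ioi 0)) :
    Measurable fun p : ℝ × ℝ => (Ioi (0 : ℝ)).indicator (N p.1) p.2 := by
  classical
  have := hN.measurable_piecewise (g := fun _ => 0) continuousOn_const
    (MeasurableSet.univ.prod measurableSet_Ioi)
  refine (congrArg Measurable (funext fun p => ?_)).mp this
  by_cases hp : 0 < p.2 <;> simp [piecewise, hp, Function.uncurry]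

/-- Polynomially bounded families become dominated after multiplication with a Schwartz
function. -/
lemma dominated_mul_schwartz {U : ℝ → ℝ → ℂ}
    (hU : Measurable fun p : ℝ × ℝ => (Ioi (0 : ℝ)).indicator (U p.1) p.2)
    (hb : ∀ T > 0, ∃ (m : ℕ) (B : ℝ → ℝ), ContinuousOn B (Ioc 0 T) ∧ IntegrableOn B (Ioc 0 T) ∧
      ∀ x, ∀ t ∈ Ioc 0 T, ‖U x t‖ ≤ B t * (1 + |x|) ^ m) (φ : 𝓢(ℝ, ℂ)) :
    Dominated fun x t => U x t * φ x where
  meas := by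
    refine (congrArg Measurable (funext fun p => ?_)).mp
      (hU.mul (φ.continuous.measurable.comp measurable_fst))
    by_cases h : 0 < p.2 <;> simp [h]
  bound T hT := by
    obtain ⟨m, B, hBc, hB, h⟩ := hb T hT
    refine ⟨_, B, integrable_pow_mul_schwartz φ m, hBc, hB, fun x t ht => ?_⟩
    rw [norm_mul]
    calc ‖U x t‖ * ‖φ x‖ ≤ B t * (1 + |x|) ^ m * ‖φ x‖ := by gcongr; exact h x t ht
      _ = _ := by ring

/-- The Riesz–Feller derivative comes with some representative of the transform of u; by uniqueness
it agrees a.e. with the prescribed one and can be exchanged for it. -/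
lemma isFourierTransform_of_isRieszFeller {α θ : ℝ} {u h : ℝ → ℂ} (hu : IsRieszFeller α θ u h)
    {uhat : ℝ → ℂ} (hh : IsFourierTransform u uhat) :
    IsFourierTransform h fun κ => -psi α θ κ * uhat κ := by
  obtain ⟨h₁, h₁u, h₁h⟩ := hu
  have he := h₁u.unique hh
  have he' : (fun κ => -psi α θ κ * h₁ κ) =ᵐ[volume] fun κ => -psi α θ κ * uhat κ :=
    he.mono fun κ hκ => by simp only [hκ]
  refine ⟨h₁h.1, ?_, fun φ => ?_⟩
  · obtain ⟨m, hm⟩ := h₁h.2.1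
    exact ⟨m, hm.congr (he'.mono fun κ hκ => by simp only [hκ])⟩
  · rw [h₁h.2.2]
    exact integral_congr_ae (he'.mono fun κ hκ => by simp only [hκ])

section

variable {α θ μ ν k : ℝ} {f g : ℝ → ℂ} {Φ N Nhat : ℝ → ℝ → ℂ}

lemma IsSolution.dominated_N (hN : IsSolution α θ μ ν k f g Φ N) (φ : 𝓢(ℝ, ℂ)) :
    Dominated fun x t => N x t * φ x := by
  refine dominated_mul_schwartz (measurable_indicator_of_continuousOn hN.continuousOn)
    (fun T hT => ?_) φ
  obtain ⟨m, B, hBc, hB, h⟩ := hN.growth T hT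
  exact ⟨m, B, hBc, hB, fun x t ht => (h x t ht).1⟩

lemma IsSolution.measurable_accel (hN : IsSolution α θ μ ν k f g Φ N)
    (hβ : 0 ≤ (1 - ν) * (2 - μ)) : Measurable fun p : ℝ × ℝ => (Ioi (0 : ℝ)).indicator
      (iteratedDeriv 2 (rlIntegral ((1 - ν) * (2 - μ)) (N p.1))) p.2 := by
  have h1 := measurable_indicator_deriv (measurable_indicator_rlIntegral hβ
    (measurable_indicator_of_continuousOn hN.continuousOn))
    fun x => (hN.contDiffOn x).differentiableOn (by norm_num)
  have h2 := measurable_indicator_deriv h1 fun x => (((contDiffOn_succ_iff_deriv_of_isOpen (n := 1)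
    isOpen_Ioi).1 (hN.contDiffOn x)).2.2).differentiableOn (by norm_num)
  have h3 : ∀ w : ℝ → ℂ, iteratedDeriv 2 w = deriv (deriv w) := fun w => by
    rw [iteratedDeriv_succ, iteratedDeriv_one]
  simpa only [h3] using h2

lemma IsSolution.dominated_accel (hN : IsSolution α θ μ ν k f g Φ N)
    (hβ : 0 ≤ (1 - ν) * (2 - μ)) (φ : 𝓢(ℝ, ℂ)) : Dominated fun x t =>
      iteratedDeriv 2 (rlIntegral ((1 - ν) * (2 - μ)) (N x)) t * φ x := by
  refine dominated_mul_schwartz (hN.measurable_accel hβ) (fun T hT => ?_) φ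
  obtain ⟨m, B, hBc, hB, h⟩ := hN.growth T hT
  exact ⟨m, B, hBc, hB, fun x t ht => (h x t ht).2⟩

lemma IsSolution.locInt_accel (hN : IsSolution α θ μ ν k f g Φ N) (x : ℝ) :
    LocInt (iteratedDeriv 2 (rlIntegral ((1 - ν) * (2 - μ)) (N x))) := fun T => by
  rcases le_or_gt T 0 with hT | hT
  · rw [Ioc_eq_empty (not_lt.2 hT)]; exact integrableOn_empty
  obtain ⟨m, B, hBc, hB, h⟩ := hN.growth T hT
  have h1 : ContinuousOn (deriv (deriv (rlIntegral ((1 - ν) * (2 - μ)) (N x)))) (Ioi 0) :=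
    (((contDiffOn_succ_iff_deriv_of_isOpen (n := 1) isOpen_Ioi).1
      (hN.contDiffOn x)).2.2).continuousOn_deriv_of_isOpen isOpen_Ioi le_rfl
  refine Integrable.mono' (hB.mul_const ((1 + |x|) ^ m)) ?_
    ((ae_restrict_iff' measurableSet_Ioc).2 (ae_of_all _ fun t ht => (h x t ht).2))
  rw [iteratedDeriv_succ, iteratedDeriv_one]
  exact (h1.mono fun t ht => ht.1).aestronglyMeasurable measurableSet_Ioc

lemma schwartzHat_eq (φ : 𝓢(ℝ, ℂ)) : fourierHat φ = schwartzHat φ :=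
  (funext (schwartzHat_apply φ)).symm

lemma integrable_mul_schwartz {u : ℝ → ℂ} (hu : Integrable u) (φ : 𝓢(ℝ, ℂ)) :
    Integrable fun x => u x * φ x :=
  (isTempered_of_integrable hu).integrable_mul φ

/-- The initial value problem tested against `φ̂` and convolved with `t^{-β}/Γ(1-β)`. -/
lemma IsSolution.tested (hμ : 1 < μ) (hμ' : μ ≤ 2) (hν : 0 ≤ ν) (hν' : ν ≤ 1)
    (hf : Integrable f) (hg : Integrable g) (hΦ : ∀ t > 0, Integrable fun x => Φ x t)
    (hN : IsSolution α θ μ ν k f g Φ N)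
    (hhat : ∀ t > 0, IsFourierTransform (fun x => N x t) fun κ => Nhat κ t) (φ : 𝓢(ℝ, ℂ))
    {t : ℝ} (ht : 0 < t) :
    conv (cPowKer 1) (fun s => ∫ κ, Nhat κ s * φ κ) t =
      cPowKer (2 - (1 - ν) * (2 - μ)) t * (∫ κ, fourierHat f κ * φ κ) +
      cPowKer (3 - (1 - ν) * (2 - μ)) t * (∫ κ, fourierHat g κ * φ κ) +
      conv (cPowKer (μ + 1))
        (fun s => ∫ κ, (-symb α θ k κ * Nhat κ s + sourceHat Φ κ s) * φ κ) t := by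
  obtain ⟨hβ0, hβ1, hγ0, hsum⟩ := order_bounds hμ hμ' hν hν'
  have hdN := hN.dominated_N (schwartzHat φ)
  have hdW := hN.dominated_accel hβ0 (schwartzHat φ)
  set β := (1 - ν) * (2 - μ) with hβ
  set γ := ν * (2 - μ) with hγ
  set w : ℝ → ℝ → ℂ := fun x => iteratedDeriv 2 (rlIntegral β (N x)) with hw
  set n : ℝ → ℂ := fun s => ∫ x, N x s * schwartzHat φ x with hn
  set u : ℝ → ℂ := fun s => ∫ x, w x s * schwartzHat φ x with hu
  have hφ : ∀ {v : ℝ → ℂ}, Integrable v →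
      ∫ x, v x * schwartzHat φ x = ∫ κ, fourierHat v κ * φ κ := fun hv => by
    rw [← schwartzHat_eq]
    exact integral_mul_fourierHat hv φ.integrable
  have hnN : ∀ s, 0 < s → n s = ∫ κ, Nhat κ s * φ κ := fun s hs => by
    rw [← (hhat s hs).2.2 φ, schwartzHat_eq]
  have hLn : LocInt n := hdN.locInt_integral
  have hLu : LocInt u := hdW.locInt_integral
  -- Taylor's formula for I^β N(x,·) at each x, integrated against φ̂; the growth bounds justify
  -- moving I^β and I² through the x-integral.
  have hTaylor : ∀ s, 0 < s → rlIntegral β n s = (∫ κ, fourierHat f κ * φ κ) +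
      s * (∫ κ, fourierHat g κ * φ κ) + conv (cPowKer 2) u s := by
    intro s hs
    have hi1 := integrable_mul_schwartz hf (schwartzHat φ)
    have hi2 := integrable_mul_schwartz (hg.const_mul (s : ℂ)) (schwartzHat φ)
    have hi3 := hdW.integrable_rlIntegral zero_le_two hs
    have hi12 : Integrable fun x => f x * schwartzHat φ x + s * g x * schwartzHat φ x :=
      hi1.add hi2
    rw [hdN.rlIntegral_integral hβ0 hs, ← rlIntegral_eq_conv two_ne_zero hs.le,
      hdW.rlIntegral_integral zero_le_two hs, ← hφ hf, ← hφ hg, ← integral_const_mul]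
    simp only [← mul_assoc]
    rw [← integral_add hi1 hi2, ← integral_add hi12 hi3]
    congr 1; ext x
    rw [rlIntegral_mul_const, rlIntegral_mul_const, rlIntegral_eq_conv two_ne_zero hs.le,
      eq_add_conv_of_contDiffOn (hN.contDiffOn x) (hN.initial_value x) (hN.initial_velocity x)
        (hN.locInt_accel x) hs]
    ring
  -- The equation at time s, integrated against φ̂; the definition of the Fourier transform turns
  -- the Riesz–Feller term into multiplication by -ψ.
  have hHilfer : ∀ s, 0 < s → rlIntegral γ u s =
      ∫ κ, (-symb α θ k κ * Nhat κ s + sourceHat Φ κ s) * φ κ := by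
    intro s hs
    obtain ⟨v, hv, heq⟩ := hN.equation s hs
    have hvF := isFourierTransform_of_isRieszFeller hv (hhat s hs)
    have hi1 := hvF.1.integrable_mul (schwartzHat φ)
    have hi2 := (((hhat s hs).1.integrable_mul (schwartzHat φ)).const_mul (-(k : ℂ) ^ 2))
    have hi3 := integrable_mul_schwartz (hΦ s hs) (schwartzHat φ)
    have hi12 : Integrable fun x => v x * schwartzHat φ x + -(k : ℂ) ^ 2 * (N x s * schwartzHat φ x) :=
      hi1.add hi2
    have hj1 := hvF.2.1.integrable_mul φ
    have hj2 := (((hhat s hs).2.1.integrable_mul φ).const_mul (-(k : ℂ) ^ 2))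
    have hj3 : Integrable fun κ => sourceHat Φ κ s * φ κ := by
      refine φ.integrable.bdd_mul (c := ∫ x, ‖Φ x s‖)
        (continuous_fourierHat (hΦ s hs)).aestronglyMeasurable
        (ae_of_all _ fun κ => norm_fourierHat_le _ κ)
    have hj12 : Integrable fun κ => -psi α θ κ * Nhat κ s * φ κ +
      -(k : ℂ) ^ 2 * (Nhat κ s * φ κ) := hj1.add hj2
    have e1 : ∀ x, rlIntegral γ (fun s => w x s * schwartzHat φ x) s =
        v x * schwartzHat φ x + -(k : ℂ) ^ 2 * (N x s * schwartzHat φ x) +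
          Φ x s * schwartzHat φ x := fun x => by
      have := heq x
      rw [hilferDeriv_eq hμ hμ'] at this
      rw [rlIntegral_mul_const, this]; ring
    rw [hdW.rlIntegral_integral hγ0 hs]
    refine (integral_congr_ae (ae_of_all _ e1)).trans ?_
    rw [integral_add hi12 hi3, integral_add hi1 hi2, integral_const_mul, hφ (hΦ s hs)]
    have e2 : ∫ x, v x * schwartzHat φ x = ∫ κ, -psi α θ κ * Nhat κ s * φ κ := by
      rw [← hvF.2.2 φ, schwartzHat_eq]
    have e3 : ∫ x, N x s * schwartzHat φ x = ∫ κ, Nhat κ s * φ κ := hnN s hs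
    rw [e2, e3, ← integral_const_mul, ← integral_add hj1 hj2, ← integral_add hj12 hj3]
    congr 1; ext κ
    rw [symb]; ring
  -- Convolution with k_{1-β} completes I^β to one full integration, which removes the fractional
  -- order without differentiating.
  have key : conv (cPowKer (1 - β)) (rlIntegral β n) t = conv (cPowKer 1) n t := by
    rw [conv_cPowKer_rlIntegral hβ0 (by linarith) (by linarith) hLn, sub_add_cancel]
  rw [← conv_congr (u := n) fun s hs => hnN s hs.1, ← key,
    conv_congr fun s hs => hTaylor s hs.1,
    ← conv_congr (u := rlIntegral γ u) fun s hs => hHilfer s hs.1,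
    conv_cPowKer_rlIntegral hγ0 (by linarith) (by linarith) hLu]
  have hk := isKer_cPowKer (show 0 < 1 - β by linarith)
  have hb1 : 0 < 1 - β := by linarith
  have i1 : IntegrableOn (fun s => cPowKer (1 - β) (t - s) *
      (cPowKer 1 s * (∫ κ, fourierHat f κ * φ κ))) (Ioc 0 t) := IntegrableOn.congr_fun
    ((hk.integrableOn_mul (isKer_cPowKer one_pos) hb1 one_pos ht).mul_const _)
    (fun s _ => by ring) measurableSet_Ioc
  have i2 : IntegrableOn (fun s => cPowKer (1 - β) (t - s) *
      (cPowKer 2 s * (∫ κ, fourierHat g κ * φ κ))) (Ioc 0 t) := IntegrableOn.congr_fun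
    ((hk.integrableOn_mul (isKer_cPowKer two_pos) hb1 two_pos ht).mul_const _)
    (fun s _ => by ring) measurableSet_Ioc
  have i3 := hk.integrableOn_conv hb1 (isKer_cPowKer two_pos) one_le_two hLu ht
  have i12 : IntegrableOn (fun s => cPowKer (1 - β) (t - s) *
      (cPowKer 1 s * (∫ κ, fourierHat f κ * φ κ) + cPowKer 2 s * (∫ κ, fourierHat g κ * φ κ)))
      (Ioc 0 t) := (i1.add i2).congr (ae_of_all _ fun s => by simp only [Pi.add_apply, mul_add])
  -- The coefficients 1 and s are written as k₁ and k₂ so that the semigroup law applies. The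
  -- remaining indices match because 3 - β = (μ + 1) + γ, where k_{μ+1} meets the equation for I^γ
  -- u.
  have e4 : ∀ s : ℝ, (∫ κ, fourierHat f κ * φ κ) + s * (∫ κ, fourierHat g κ * φ κ) +
      conv (cPowKer 2) u s = cPowKer 1 s * (∫ κ, fourierHat f κ * φ κ) +
      cPowKer 2 s * (∫ κ, fourierHat g κ * φ κ) + conv (cPowKer 2) u s := fun s => by
    simp only [cPowKer, powKer_one, powKer_two, Complex.ofReal_one, one_mul]
  simp only [e4]
  rw [conv_add i12 i3, conv_add i1 i2, conv_mul_const, conv_mul_const,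
    conv_cPowKer_cPowKer hb1 one_pos ht, conv_cPowKer_cPowKer hb1 two_pos ht,
    conv_cPowKer_conv two_pos hb1 (by linarith) hLu, show 1 - β + 1 = 2 - β by ring,
    show 1 - β + 2 = 3 - β by ring, show μ + 1 + γ = 3 - β by linarith]

end

/-! Families integrable on bounded rectangles -/

/-- Integrability on all rectangles `[-R, R] × (0, T]`. -/
def RectInt (V : ℝ → ℝ → ℂ) : Prop := ∀ R T : ℝ,
  Integrable (Function.uncurry V) ((volume.restrict (Icc (-R) R)).prod (volume.restrict (Ioc 0 T)))

lemma ae_prod_fst_mem (R T : ℝ) :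
    ∀ᵐ p ∂((volume.restrict (Icc (-R) R)).prod (volume.restrict (Ioc (0 : ℝ) T))),
      p.1 ∈ Icc (-R) R :=
  Measure.quasiMeasurePreserving_fst.ae (ae_restrict_mem measurableSet_Icc)

lemma exists_support_subset {φ : 𝓢(ℝ, ℂ)} (hφ : HasCompactSupport φ) :
    ∃ R : ℝ, ∀ κ, κ ∉ Icc (-R) R → φ κ = 0 := by
  obtain ⟨R, hR⟩ := hφ.isCompact.isBounded.subset_closedBall 0
  refine ⟨R, fun κ hκ => image_eq_zero_of_notMem_tsupport fun h => hκ ?_⟩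
  have := hR h
  rwa [Real.closedBall_eq_Icc, zero_sub, zero_add] at this

namespace RectInt

variable {V W : ℝ → ℝ → ℂ}

lemma add (hV : RectInt V) (hW : RectInt W) : RectInt fun κ s => V κ s + W κ s :=
  fun R T => (hV R T).add (hW R T)

lemma mul_left (hV : RectInt V) {c : ℝ → ℂ} (hc : Measurable c)
    (hb : ∀ R, ∃ C, ∀ κ ∈ Icc (-R) R, ‖c κ‖ ≤ C) : RectInt fun κ s => c κ * V κ s := fun R T => by
  obtain ⟨C, hC⟩ := hb R
  refine Integrable.bdd_mul (c := C) (f := fun p : ℝ × ℝ => c p.1) (hV R T)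
    (hc.comp measurable_fst).aestronglyMeasurable ?_
  filter_upwards [ae_prod_fst_mem R T] with p hp using hC _ hp

/-- For |κ| ≤ R the weight (1+|κ|)^{-m} is bounded below by (1+R)^{-m} and can be divided out. -/
lemma of_weight (h : ∀ T > 0, ∃ m : ℕ, Integrable
    (fun p : ℝ × ℝ => (((1 + |p.1|) ^ m)⁻¹ : ℝ) • V p.1 p.2)
      (volume.prod (volume.restrict (Ioc 0 T)))) : RectInt V := fun R T => by
  rcases le_or_gt T 0 with hT | hT
  · rw [Ioc_eq_empty (not_lt.2 hT)]; simp
  obtain ⟨m, hm⟩ := h T hT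
  have h1 : Integrable (fun p : ℝ × ℝ => (((1 + |p.1|) ^ m)⁻¹ : ℝ) • V p.1 p.2)
      ((volume.restrict (Icc (-R) R)).prod (volume.restrict (Ioc 0 T))) := by
    have : (volume.restrict (Icc (-R) R)).prod (volume.restrict (Ioc 0 T)) =
        (volume.prod (volume.restrict (Ioc 0 T))).restrict (Icc (-R) R ×ˢ univ) := by
      rw [← Measure.prod_restrict, Measure.restrict_univ]
    rw [this]
    exact hm.restrict
  have h2 := h1.bdd_mul (c := (1 + R) ^ m) (f := fun p : ℝ × ℝ => (((1 + |p.1|) ^ m : ℝ) : ℂ))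
    (Continuous.aestronglyMeasurable (by fun_prop)) (by
      filter_upwards [ae_prod_fst_mem R T] with p hp
      rw [Complex.norm_real, Real.norm_of_nonneg (by positivity)]
      have := abs_le.2 hp
      gcongr)
  refine h2.congr (ae_of_all _ fun p => ?_)
  have h0 : (((1 + |p.1|) ^ m : ℝ) : ℂ) ≠ 0 := Complex.ofReal_ne_zero.2 (by positivity)
  simp only [Complex.real_smul, Complex.ofReal_inv, Function.uncurry]
  field_simp

lemma locallyIntegrable_conv (hV : RectInt V) {a : ℝ} {K : ℝ → ℂ} (hK : IsKer a K) (ha : 1 ≤ a)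
    (t : ℝ) : LocallyIntegrable fun κ => conv K (V κ) t := by
  rw [locallyIntegrable_iff]
  intro A hA
  obtain ⟨R, hR⟩ := hA.isBounded.subset_closedBall 0
  rw [Real.closedBall_eq_Icc, zero_sub, zero_add] at hR
  exact IntegrableOn.mono_set (hK.conv_integral ha (hV R t)).1 hR

/-- Convolution in time commutes with testing in frequency. -/
lemma conv_test (hV : RectInt V) {a : ℝ} {K : ℝ → ℂ} (hK : IsKer a K) (ha : 1 ≤ a) (t : ℝ)
    {φ : 𝓢(ℝ, ℂ)} (hφ : HasCompactSupport φ) :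
    conv K (fun s => ∫ κ, V κ s * φ κ) t = ∫ κ, conv K (V κ) t * φ κ := by
  obtain ⟨R, hR⟩ := exists_support_subset hφ
  obtain ⟨C, hC⟩ := exists_pow_mul_schwartz_le φ 0
  have hset : ∀ v : ℝ → ℂ, ∫ κ, v κ * φ κ = ∫ κ in Icc (-R) R, v κ * φ κ := fun v =>
    (setIntegral_eq_integral_of_forall_compl_eq_zero fun κ hκ => by rw [hR κ hκ, mul_zero]).symm
  have h1 : Integrable (Function.uncurry fun κ s => V κ s * φ κ)
      ((volume.restrict (Icc (-R) R)).prod (volume.restrict (Ioc 0 t))) :=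
    (hV R t).mul_bdd (c := C) (g := fun p : ℝ × ℝ => φ p.1)
      (φ.continuous.comp continuous_fst).aestronglyMeasurable
      (ae_of_all _ fun p => by simpa using hC p.1)
  simp only [hset]
  rw [(hK.conv_integral ha h1).2]
  simp only [conv_mul_const]

/-- Fubini gives this for a.e. κ on each rectangle; countably many rectangles with integer sides
exhaust the half-plane, so a single null set of κ serves for all T. -/
lemma ae_locInt (hV : RectInt V) : ∀ᵐ κ : ℝ, LocInt (V κ) := by
  have h1 : ∀ R n : ℕ, ∀ᵐ κ : ℝ, κ ∈ Icc (-(R : ℝ)) R → IntegrableOn (V κ) (Ioc 0 (n : ℝ)) :=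
    fun R n => (ae_restrict_iff' measurableSet_Icc).1 (hV R n).prod_right_ae
  have h2 := ae_all_iff.2 fun R => ae_all_iff.2 (h1 R)
  filter_upwards [h2] with κ hκ T
  obtain ⟨R, hR⟩ := exists_nat_ge |κ|
  obtain ⟨n, hn⟩ := exists_nat_ge T
  exact (hκ R n (abs_le.1 hR)).mono_set (Ioc_subset_Ioc_right hn)

end RectInt

/-- The Fourier transform of the source agrees, for almost every time, with a jointly measurable
function. -/
lemma exists_measurable_sourceHat {Φ : ℝ → ℝ → ℂ} (hΦ : ∀ T > 0, Integrable (Function.uncurry Φ)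
    (volume.prod (volume.restrict (Ioc (0 : ℝ) T)))) :
    ∃ Q : ℝ → ℝ → ℂ, Measurable (Function.uncurry Q) ∧
      ∀ᵐ s ∂(volume.restrict (Ioi (0 : ℝ))), ∀ κ, sourceHat Φ κ s = Q κ s := by
  have h1 : AEStronglyMeasurable (Function.uncurry Φ)
      (volume.prod (volume.restrict (Ioi (0 : ℝ)))) := by
    have e : ∀ S : Set ℝ, (volume : Measure ℝ).prod (volume.restrict S) =
        (volume.prod volume).restrict (univ ×ˢ S) := fun S => by
      rw [← Measure.prod_restrict, Measure.restrict_univ]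
    have e2 : (univ : Set ℝ) ×ˢ Ioi (0 : ℝ) = ⋃ n : ℕ, univ ×ˢ Ioc (0 : ℝ) (n + 1) := by
      ext p
      simp only [mem_prod, mem_univ, true_and, mem_Ioi, mem_iUnion, mem_Ioc]
      refine ⟨fun h => ?_, fun ⟨n, h⟩ => h.1⟩
      obtain ⟨n, hn⟩ := exists_nat_ge p.2
      exact ⟨n, h, by linarith⟩
    rw [e, e2, aestronglyMeasurable_iUnion_iff]
    intro n
    rw [← e]
    exact (hΦ (n + 1) (by positivity)).aestronglyMeasurable
  -- With Ψ a strongly measurable version of Φ on the half-plane, for a.e. s the sections in x agree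
  -- a.e., and then their transforms agree at every κ.
  obtain ⟨Ψ, hΨ, hae⟩ := h1
  refine ⟨fun κ s => fourierHat (fun x => Ψ (x, s)) κ, ?_, ?_⟩
  · have h2 : StronglyMeasurable fun q : (ℝ × ℝ) × ℝ =>
        Ψ (q.2, q.1.2) * Complex.exp (Complex.I * q.1.1 * q.2) := by
      refine StronglyMeasurable.mul ?_ (Continuous.stronglyMeasurable (by fun_prop))
      exact hΨ.comp_measurable (measurable_snd.prodMk measurable_fst.snd)
    exact (h2.integral_prod_right' (ν := (volume : Measure ℝ))).measurable
  · have h3 : ∀ᵐ s ∂(volume.restrict (Ioi (0 : ℝ))), ∀ᵐ x, Φ x s = Ψ (x, s) :=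
      Measure.ae_ae_of_ae_prod (Measure.measurePreserving_swap.quasiMeasurePreserving.ae hae)
    filter_upwards [h3] with s hs κ
    exact integral_congr_ae (hs.mono fun x hx => by simp only [hx])

lemma norm_symb_le_of_mem {α θ k R κ : ℝ} (hα : 0 ≤ α) (hκ : κ ∈ Icc (-R) R) :
    ‖symb α θ k κ‖ ≤ (1 + k ^ 2) * (1 + R ^ α) := by
  refine (norm_symb_le α θ k κ).trans ?_
  have := abs_le.2 hκ
  gcongr

lemma integrableOn_integral_norm {Φ : ℝ → ℝ → ℂ} (hΦ : ∀ T > 0, Integrable (Function.uncurry Φ)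
    (volume.prod (volume.restrict (Ioc (0 : ℝ) T)))) (T : ℝ) :
    IntegrableOn (fun s => ∫ x, ‖Φ x s‖) (Ioc 0 T) := by
  rcases le_or_gt T 0 with hT | hT
  · rw [Ioc_eq_empty (not_lt.2 hT)]; exact integrableOn_empty
  exact (hΦ T hT).norm.integral_prod_right

lemma rectInt_sourceHat {Φ : ℝ → ℝ → ℂ} (hΦ : ∀ T > 0, Integrable (Function.uncurry Φ)
    (volume.prod (volume.restrict (Ioc (0 : ℝ) T)))) : RectInt (sourceHat Φ) := fun R T => by
  obtain ⟨Q, hQ, hae⟩ := exists_measurable_sourceHat hΦ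
  have h1 : ∀ᵐ s ∂(volume.restrict (Ioc (0 : ℝ) T)), ∀ κ, sourceHat Φ κ s = Q κ s :=
    ae_mono (Measure.restrict_mono Ioc_subset_Ioi_self le_rfl) hae
  have h2 : Function.uncurry Q =ᵐ[(volume.restrict (Icc (-R) R)).prod (volume.restrict (Ioc 0 T))]
      Function.uncurry (sourceHat Φ) := by
    have := (Measure.quasiMeasurePreserving_snd (μ := volume.restrict (Icc (-R) R))).ae h1
    filter_upwards [this] with p hp using (hp p.1).symm
  refine Integrable.mono' (g := fun p : ℝ × ℝ => 1 * ∫ x, ‖Φ x p.2‖)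
    ((integrable_const (1 : ℝ)).mul_prod (integrableOn_integral_norm hΦ T))
    (hQ.aestronglyMeasurable.congr h2) (ae_of_all _ fun p => ?_)
  rw [one_mul]
  exact norm_fourierHat_le _ _

/-- The modes of the closed form, multiplied by a compactly supported test function. -/
lemma dominated_mode_mul {α θ μ ν k : ℝ} {f g : ℝ → ℂ} {Φ : ℝ → ℝ → ℂ} (hα : 0 ≤ α) (hμ : 1 < μ)
    (hβ : (1 - ν) * (2 - μ) < 1) (hf : Integrable f) (hg : Integrable g)
    (hΦ : ∀ T > 0, Integrable (Function.uncurry Φ)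
      (volume.prod (volume.restrict (Ioc (0 : ℝ) T)))) {φ : 𝓢(ℝ, ℂ)} (hφ : HasCompactSupport φ) :
    Dominated fun κ t => mode α θ μ ν k f g Φ κ t * φ κ where
  meas := by
    obtain ⟨Q, hQ, hae⟩ := exists_measurable_sourceHat hΦ
    have hc := measurable_symb α θ k
    have h1 : Measurable (Function.uncurry fun κ t => modeSol μ ((1 - ν) * (2 - μ)) (symb α θ k κ)
        (fourierHat f κ) (fourierHat g κ) (Q κ) t * φ κ) := by
      refine Measurable.mul (((Measurable.mul ?_ ?_).add (Measurable.mul ?_ ?_)).add ?_) ?_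
      · exact measurable_mlKer_family hμ (by linarith) hc
      · exact (continuous_fourierHat hf).measurable.comp measurable_fst
      · exact measurable_mlKer_family hμ (by linarith) hc
      · exact (continuous_fourierHat hg).measurable.comp measurable_fst
      · exact measurable_conv (measurable_mlKer_family hμ (by linarith) hc)
          (measurable_indicator_of_measurable hQ)
      · exact φ.continuous.measurable.comp measurable_fst
    refine (congrArg Measurable (funext fun p => ?_)).mp (measurable_indicator_of_measurable h1)
    by_cases hp : 0 < p.2
    · rw [indicator_of_mem (mem_Ioi.2 hp), indicator_of_mem (mem_Ioi.2 hp)]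
      simp only [mode, modeSol]
      -- The convolution in time does not see the null set of times at which the source transform
      -- and its measurable version Q differ.
      rw [conv_congr_ae (u := Q p.1) (v := sourceHat Φ p.1)]
      have h2 : ∀ᵐ s ∂(volume.restrict (Ioc 0 p.2)), ∀ κ, sourceHat Φ κ s = Q κ s :=
        ae_mono (Measure.restrict_mono Ioc_subset_Ioi_self le_rfl) hae
      exact h2.mono fun s hs => (hs p.1).symm
    · rw [indicator_of_notMem (by simpa using hp), indicator_of_notMem (by simpa using hp)]
  bound T hT := by
    obtain ⟨R, hR⟩ := exists_support_subset hφ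
    -- A bound for the symbol on the support of φ; it makes the three kernel constants uniform in κ.
    set M := (1 + k ^ 2) * (1 + R ^ α)
    set β := (1 - ν) * (2 - μ)
    obtain ⟨C₁, h10, h1⟩ := exists_norm_mlKer_le hμ (show 0 < 1 - β by linarith) M T
    obtain ⟨C₂, h20, h2⟩ := exists_norm_mlKer_le hμ (show 0 < 2 - β by linarith) M T
    obtain ⟨C₃, h30, h3⟩ := exists_norm_mlKer_le hμ (show 0 < μ by linarith) M T
    have hsrc := integrableOn_integral_norm hΦ
    have hpT := powKer_nonneg (show 0 < μ by linarith) hT.le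
    refine ⟨fun κ => ‖φ κ‖, fun t => C₁ * powKer (1 - β) t * (∫ x, ‖f x‖) +
      C₂ * powKer (2 - β) t * (∫ x, ‖g x‖) +
      C₃ * powKer μ T * ∫ s in Ioc 0 T, ∫ x, ‖Φ x s‖, φ.integrable.norm, ?_, ?_, fun κ t ht => ?_⟩
    · have hcont := fun a => (continuousOn_powKer a).mono fun t (ht : t ∈ Ioc 0 T) => mem_Ioi.2 ht.1
      exact ((((continuousOn_const.mul (hcont _)).mul continuousOn_const).add
        ((continuousOn_const.mul (hcont _)).mul continuousOn_const)).add continuousOn_const)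
    · exact ((((integrableOn_powKer (by linarith) T).const_mul _).mul_const _).add
        (((integrableOn_powKer (by linarith) T).const_mul _).mul_const _)).add (integrable_const _)
    by_cases hκ : κ ∈ Icc (-R) R
    swap
    · simp [hR κ hκ]
    have hM : ‖symb α θ k κ‖ ≤ M := norm_symb_le_of_mem hα hκ
    have b3 : ‖conv (mlKer μ (symb α θ k κ) μ) (sourceHat Φ κ) t‖ ≤
        C₃ * powKer μ T * ∫ s in Ioc 0 T, ∫ x, ‖Φ x s‖ := by
      have hi := (hsrc T).const_mul (C₃ * powKer μ T)
      calc ‖conv (mlKer μ (symb α θ k κ) μ) (sourceHat Φ κ) t‖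
          ≤ ∫ s in Ioc 0 t, C₃ * powKer μ T * ∫ x, ‖Φ x s‖ := by
            refine norm_integral_le_of_norm_le ((hsrc t).const_mul _) ?_
            filter_upwards [ae_Ioc_mem_Ioo t] with s hs
            have hts : t - s ∈ Ioc 0 T := ⟨sub_pos.2 hs.2, (sub_mem_Ioc hs).2.trans ht.2⟩
            rw [norm_mul]
            refine mul_le_mul ((h3 _ hM _ hts).trans ?_) (norm_fourierHat_le _ _) (norm_nonneg _)
              (by positivity)
            exact mul_le_mul_of_nonneg_left (powKer_le hμ.le hts.1.le hts.2) h30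
        _ ≤ ∫ s in Ioc 0 T, C₃ * powKer μ T * ∫ x, ‖Φ x s‖ := setIntegral_mono_set hi
            (ae_of_all _ fun s => by positivity) (Ioc_subset_Ioc_right ht.2).eventuallyLE
        _ = _ := integral_const_mul _ _
    have b1 : ‖mlKer μ (symb α θ k κ) (1 - β) t * fourierHat f κ‖ ≤
        C₁ * powKer (1 - β) t * ∫ x, ‖f x‖ := by
      rw [norm_mul]
      exact mul_le_mul (h1 _ hM t ht) (norm_fourierHat_le f κ) (norm_nonneg _)
        ((norm_nonneg _).trans (h1 _ hM t ht))
    have b2 : ‖mlKer μ (symb α θ k κ) (2 - β) t * fourierHat g κ‖ ≤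
        C₂ * powKer (2 - β) t * ∫ x, ‖g x‖ := by
      rw [norm_mul]
      exact mul_le_mul (h2 _ hM t ht) (norm_fourierHat_le g κ) (norm_nonneg _)
        ((norm_nonneg _).trans (h2 _ hM t ht))
    rw [norm_mul, mul_comm]
    refine mul_le_mul_of_nonneg_left ?_ (norm_nonneg _)
    exact norm_add₃_le.trans (add_le_add (add_le_add b1 b2) b3)

/-! ### Uniqueness of the solution -/

/-- Functions continuous on `(0, ∞)` that agree at rational points agree. -/
lemma eq_of_eq_rat {u v : ℝ → ℂ} (hu : ContinuousOn u (Ioi 0)) (hv : ContinuousOn v (Ioi 0))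
    (h : ∀ q : ℚ, 0 < (q : ℝ) → u q = v q) {t : ℝ} (ht : 0 < t) : u t = v t := by
  have hd : Dense (range ((↑) : ℚ → ℝ)) := Rat.isDenseEmbedding_coe_real.dense
  have hcl : t ∈ closure (Ioi 0 ∩ range ((↑) : ℚ → ℝ)) :=
    hd.open_subset_closure_inter isOpen_Ioi ht
  have hn : (𝓝[Ioi 0 ∩ range ((↑) : ℚ → ℝ)] t).NeBot := mem_closure_iff_nhdsWithin_neBot.1 hcl
  have h1 := ((hu t ht).mono (inter_subset_left (t := range ((↑) : ℚ → ℝ)))).tendsto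
  have h2 := ((hv t ht).mono (inter_subset_left (t := range ((↑) : ℚ → ℝ)))).tendsto
  refine tendsto_nhds_unique_of_eventuallyEq h1 h2 ?_
  filter_upwards [self_mem_nhdsWithin] with s hs
  obtain ⟨hs0, q, rfl⟩ := hs
  exact h q hs0

/-- Every solution is given by the closed form. -/
lemma IsSolution.eq_solutionFormula {α θ μ ν k : ℝ} {f g : ℝ → ℂ} {Φ N : ℝ → ℝ → ℂ} (hα : 0 ≤ α)
    (hμ : 1 < μ) (hμ' : μ ≤ 2) (hν : 0 ≤ ν) (hν' : ν ≤ 1)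
    (hf : Integrable f) (hg : Integrable g) (hΦ : ∀ t > 0, Integrable fun x => Φ x t)
    (hΦ' : ∀ T > 0, Integrable (Function.uncurry Φ)
      (volume.prod (volume.restrict (Ioc (0 : ℝ) T))))
    (hconv : FormulaConverges α θ μ ν k f g Φ) (hN : IsSolution α θ μ ν k f g Φ N)
    (x : ℝ) {t : ℝ} (ht : 0 < t) : N x t = solutionFormula α θ μ ν k f g Φ x t := by
  obtain ⟨hβ0, hβ1, hγ0, hsum⟩ := order_bounds hμ hμ' hν hν'
  obtain ⟨Nhat, hhat, hweight⟩ := hN.hasFourier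
  set H := mode α θ μ ν k f g Φ with hH
  have hRN : RectInt Nhat := RectInt.of_weight hweight
  have hRS : RectInt fun κ s => -symb α θ k κ * Nhat κ s + sourceHat Φ κ s :=
    (hRN.mul_left (c := fun κ => -symb α θ k κ) (measurable_symb α θ k).neg fun R => ⟨(1 + k ^ 2) * (1 + R ^ α), fun κ hκ => by
      rw [norm_neg]; exact norm_symb_le_of_mem hα hκ⟩).add (rectInt_sourceHat hΦ')
  have hk1 := isKer_cPowKer one_pos
  have hkμ := isKer_cPowKer (show 0 < μ + 1 by linarith)
  have hk2 := isKer_cPowKer two_pos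
  have hlf : LocallyIntegrable (fourierHat f) := (continuous_fourierHat hf).locallyIntegrable
  have hlg : LocallyIntegrable (fourierHat g) := (continuous_fourierHat hg).locallyIntegrable
  -- The tested equation holds for all compactly supported φ, hence frequency by frequency, with an
  -- exceptional null set that still depends on s.
  have hae : ∀ s, 0 < s → ∀ᵐ κ, conv (cPowKer 1) (Nhat κ) s =
      cPowKer (2 - (1 - ν) * (2 - μ)) s * fourierHat f κ +
      cPowKer (3 - (1 - ν) * (2 - μ)) s * fourierHat g κ +
      conv (cPowKer (μ + 1)) (fun r => -symb α θ k κ * Nhat κ r + sourceHat Φ κ r) s := by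
    intro s hs
    have l3 := hRS.locallyIntegrable_conv hkμ (by linarith) s
    have l1 : LocallyIntegrable fun κ => cPowKer (2 - (1 - ν) * (2 - μ)) s * fourierHat f κ :=
      hlf.smul (cPowKer (2 - (1 - ν) * (2 - μ)) s)
    have l2 : LocallyIntegrable fun κ => cPowKer (3 - (1 - ν) * (2 - μ)) s * fourierHat g κ :=
      hlg.smul (cPowKer (3 - (1 - ν) * (2 - μ)) s)
    refine ae_eq_of_forall_test (hRN.locallyIntegrable_conv hk1 le_rfl s) ((l1.add l2).add l3)
      fun φ hφ => ?_
    have hint : ∀ {v : ℝ → ℂ}, LocallyIntegrable v → Integrable fun κ => v κ * φ κ := fun hv => by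
      simpa only [smul_eq_mul] using
        hv.integrable_smul_right_of_hasCompactSupport φ.continuous hφ
    have i12 : Integrable fun κ => cPowKer (2 - (1 - ν) * (2 - μ)) s * fourierHat f κ * φ κ +
        cPowKer (3 - (1 - ν) * (2 - μ)) s * fourierHat g κ * φ κ := (hint l1).add (hint l2)
    rw [← hRN.conv_test hk1 le_rfl s hφ, hN.tested hμ hμ' hν hν' hf hg hΦ hhat φ hs,
      hRS.conv_test hkμ (by linarith) s hφ, ← integral_const_mul, ← integral_const_mul]
    simp only [add_mul, ← mul_assoc]
    rw [integral_add i12 (hint l3), integral_add (hint l1) (hint l2)]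
  -- Rational times give one null set for all of them; continuity in s of both sides extends the
  -- equation to every s > 0, and the Volterra equation is then solved for each remaining κ.
  have hae' : ∀ᵐ κ, ∀ s, 0 < s → conv (cPowKer 2) (Nhat κ) s = conv (cPowKer 2) (H κ) s := by
    have hq : ∀ᵐ κ, ∀ q : ℚ, 0 < (q : ℝ) → conv (cPowKer 1) (Nhat κ) q =
        cPowKer (2 - (1 - ν) * (2 - μ)) q * fourierHat f κ +
        cPowKer (3 - (1 - ν) * (2 - μ)) q * fourierHat g κ +
        conv (cPowKer (μ + 1)) (fun r => -symb α θ k κ * Nhat κ r + sourceHat Φ κ r) q := by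
      refine ae_all_iff.2 fun q => ?_
      by_cases hq : 0 < (q : ℝ)
      · filter_upwards [hae q hq] with κ hκ _ using hκ
      · exact ae_of_all _ fun κ h => absurd h hq
    filter_upwards [hq, hRN.ae_locInt] with κ hκ hloc s hs
    have hsrc := locInt_sourceHat hΦ' κ
    refine conv_two_eq_of_volterra hμ hβ1 hloc hsrc (fun r hr => ?_) hs
    refine eq_of_eq_rat (v := fun r => cPowKer (2 - (1 - ν) * (2 - μ)) r * fourierHat f κ +
      cPowKer (3 - (1 - ν) * (2 - μ)) r * fourierHat g κ + conv (cPowKer (μ + 1))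
        (fun r => -symb α θ k κ * Nhat κ r + sourceHat Φ κ r) r) (hk1.continuousOn_conv le_rfl hloc) ?_ hκ hr
    exact (((isKer_cPowKer (by linarith)).cont.mul continuousOn_const).add
      ((isKer_cPowKer (by linarith)).cont.mul continuousOn_const)).add
      (hkμ.continuousOn_conv (by linarith) ((hloc.const_mul _).add hsrc))
  -- For fixed κ, N̂ has no continuity in s, so k₂ can be removed only after testing: ∫ N̂ φ = ∫ N
  -- φ̂ is continuous in s because N is, and ∫ H φ because the modes are. Equality therefore holds
  -- at every time, not merely almost every time.
  have htest : ∀ φ : 𝓢(ℝ, ℂ), HasCompactSupport φ → ∀ s, 0 < s →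
      ∫ κ, Nhat κ s * φ κ = ∫ κ, H κ s * φ κ := by
    intro φ hφ
    have hdN := hN.dominated_N (schwartzHat φ)
    have hdH := dominated_mode_mul (α := α) (θ := θ) (k := k) hα hμ hβ1 hf hg hΦ' hφ
    have hnN : ∀ s, 0 < s → ∫ x, N x s * schwartzHat φ x = ∫ κ, Nhat κ s * φ κ := fun s hs => by
      rw [← (hhat s hs).2.2 φ, schwartzHat_eq]
    have hcN : ContinuousOn (fun s => ∫ x, N x s * schwartzHat φ x) (Ioi 0) :=
      hdN.continuousOn_integral fun x => ContinuousOn.mul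
        (hN.continuousOn.comp (f := fun s : ℝ => (x, s)) (by fun_prop)
          fun s hs => ⟨mem_univ _, hs⟩) continuousOn_const
    have hcH : ContinuousOn (fun s => ∫ κ, H κ s * φ κ) (Ioi 0) :=
      hdH.continuousOn_integral fun κ => ContinuousOn.mul
        (continuousOn_modeSol hμ hβ1 (locInt_sourceHat hΦ' κ)) continuousOn_const
    intro s hs
    have h0 := eq_zero_of_conv_two_eq_zero
      (hdN.locInt_integral.add (hdH.locInt_integral.const_mul (-1)))
      (hcN.add (continuousOn_const.mul hcH)) (fun r hr => ?_) hs
    · rw [hnN s hs] at h0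
      linear_combination h0
    · rw [conv_add (hk2.integrableOn one_le_two (hdN.locInt_integral r))
        (hk2.integrableOn one_le_two (hdH.locInt_integral.const_mul (-1) r)), conv_const_mul,
        conv_congr fun s hs => hnN s hs.1, hRN.conv_test hk2 one_le_two r hφ,
        ← rlIntegral_eq_conv two_ne_zero hr.le (fun s => ∫ κ, H κ s * φ κ),
        hdH.rlIntegral_integral zero_le_two hr]
      have e : ∫ κ, conv (cPowKer 2) (Nhat κ) r * φ κ =
          ∫ κ, rlIntegral 2 (fun s => mode α θ μ ν k f g Φ κ s * φ κ) r :=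
        integral_congr_ae (hae'.mono fun κ hκ => by
          beta_reduce
          rw [rlIntegral_mul_const, rlIntegral_eq_conv two_ne_zero hr.le, hκ r hr])
      rw [e]
      ring
  have hHi := hconv.integrable_mode ht
  -- Convergence of the closed form enters only from here on: it makes H(·,t) integrable, so that
  -- N(·,t), being continuous, is its inverse transform at every x.
  have heq : (fun κ => Nhat κ t) =ᵐ[volume] fun κ => H κ t :=
    ae_eq_of_forall_test (hhat t ht).2.1.locallyIntegrable hHi.locallyIntegrable
      fun φ hφ => htest φ hφ t ht
  have hNc : Continuous fun x => N x t :=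
    hN.continuousOn.comp_continuous (f := fun x : ℝ => (x, t)) (by fun_prop)
      fun x => ⟨mem_univ _, ht⟩
  rw [hconv.solutionFormula_eq ht]
  exact congrFun ((hhat t ht).eq_fourierInv hNc hHi heq) x

end FracWave

end

theorem mainTheorem6 (α θ μ ν k : ℝ) (hα : 1 < α) (hα' : α ≤ 2)
    (hθ : |θ| ≤ min α (2 - α)) (hμ : 1 < μ) (hμ' : μ ≤ 2) (hν : 0 ≤ ν) (hν' : ν ≤ 1)
    (f g : ℝ → ℂ) (Φ : ℝ → ℝ → ℂ)
    (hf : MeasureTheory.Integrable f) (hg : MeasureTheory.Integrable g)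
    (hΦ : ∀ t > 0, MeasureTheory.Integrable fun x => Φ x t)
    (hΦ' : ∀ T > 0, MeasureTheory.Integrable (Function.uncurry Φ)
      (MeasureTheory.volume.prod (MeasureTheory.volume.restrict (Set.Ioc (0 : ℝ) T)))) :
    (FracWave.FormulaConverges α θ μ ν k f g Φ →
      ∀ N : ℝ → ℝ → ℂ, FracWave.IsSolution α θ μ ν k f g Φ N →
        ∀ x, ∀ t > 0, N x t = FracWave.solutionFormula α θ μ ν k f g Φ x t) ∧
    (FracWave.RegularData α θ μ ν k f g Φ →
      FracWave.FormulaConverges α θ μ ν k f g Φ ∧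
      ∀ N : ℝ → ℝ → ℂ, FracWave.IsSolution α θ μ ν k f g Φ N ↔
        ∀ x, ∀ t > 0, N x t = FracWave.solutionFormula α θ μ ν k f g Φ x t) := by
  have hα0 : 0 ≤ α := by linarith
  refine ⟨fun hconv N hN x t ht =>
    hN.eq_solutionFormula hα0 hμ hμ' hν hν' hf hg hΦ hΦ' hconv x ht, fun h => ?_⟩
  have hconv := h.formulaConverges hμ hμ' hν hν' hf hg
  exact ⟨hconv, fun N => ⟨fun hN x t ht =>
    hN.eq_solutionFormula hα0 hμ hμ' hν hν' hf hg hΦ hΦ' hconv x ht,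
    fun hN => h.isSolution hμ hμ' hν hν' hf hg hΦ hΦ' hN⟩⟩
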